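/- Let $\mathcal K$ be a finite planar complex whose 2-cells are (nondegenerate) Euclidean triangles: a finite simplicial complex of dimension 2 with Euclidean cells, whose 1-skeleton has a planar drawing with (polygonal) arcs as edges, the 2-cells being exactly the inner faces of the drawing. Equip $\mathcal K$ with its intrinsic metric $d$ and assume that $(\mathcal K,d)$ is a CAT(0) space. Write $\gamma(u,v)$ for the geodesic between $u$ and $v$, $\partial\mathcal K$ for the union of the edges that do not lie in two different 2-cells, $\angle$ for the Alexandrov angle, and $\theta(v)$ for the sum of the angles at a vertex $v$ of the 2-cells containing $v$; $v$ has negative curvature if $\theta(v)>2\pi$. A cone $\mathcal C(z;p,q)$ with apex $z\in\mathcal K$ and $p,q\in\partial\mathcal K$, where $0<\angle_z(p,q)<\pi$, consists of its two sides $\gamma(z,p),\gamma(z,q)$ and of the connected component of $\mathcal K\setminus(\gamma(z,p)\cup\gamma(z,q))$ that contains the angle $\angle_z(p,q)$ (that is, such that $\gamma(a,b)\subseteq\mathcal C(z;p,q)$ for all $a\in\gamma(z,p)$, $b\in\gamma(z,q)$ sufficiently close to $z$). Its interior is the cone without its two sides. For $x\in\mathcal K$, a shortest path map SPM($x$) is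 a set of cones which cover $\mathcal K$ and have pairwise disjoint interiors, such that (1) every vertex $y$ of $\mathcal K$ lies on $\gamma(x,p)$ for some $p$ that is the endpoint of a side $\gamma(z,p)$ of a cone of the map; (a) if $\theta(y)=2\pi$, then $y$ lies on sides of two different cones of the map; (b) if $\theta(y)>2\pi$, then $y$ is the apex of a cone of the map; (2) for every cone $\mathcal C(z;p,q)$ of the map, $z$ belongs to $\gamma(x,p)$ and to $\gamma(x,q)$; (3) every side $\gamma(z,p)$ of a cone of the map with apex $z$ either passes through a vertex of $\mathcal K$ other than $z$, or forms with $\gamma(z,x)$ an angle equal to $\pi$, i.e. there is a point $w$ of $\mathcal K$ with $\angle_z(x,w)>0$, $\angle_z(w,p)>0$ and $\angle_z(x,w)+\angle_z(w,p)=\pi$. Then there is an absolute constant $C$ such that, for every such complex $\mathcal K$ with $n$ vertices, every point $x\in\mathcal K$ and every shortest path map SPM($x$) of origin $x$, the map SPM($x$) is finite and contains at most $Cn$ cones. -/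

import Mathlib

open scoped Topology

/-! ### Comparison geometry for a distance function -/

namespace MetricGeometry

variable {X : Type*}

/-- The Euclidean angle between two sides of lengths `a` and `b` of a triangle whose third side
has length `c`. -/
noncomputable def euclAngle (a b c : ℝ) : ℝ :=
  Real.arccos ((a ^ 2 + b ^ 2 - c ^ 2) / (2 * a * b))

/-- `γ`, restricted to `[0, l]`, is a geodesic from `x` to `y` for the distance `d`. -/
def IsGeodesic (d : X → X → ℝ) (γ : ℝ → X) (l : ℝ) (x y : X) : Prop :=
  0 ≤ l ∧ γ 0 = x ∧ γ l = y ∧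
    ∀ s ∈ Set.Icc 0 l, ∀ t ∈ Set.Icc 0 l, d (γ s) (γ t) = |s - t|

/-- `(X, d)` is a CAT(0) space: it is geodesic, and whenever `y = γ t` lies on the side of a
geodesic triangle that joins `x₁` to `x₂`, and `y'` is the corresponding point on the side
`[x₁', x₂']` of a comparison triangle in the Euclidean plane, `d x₃ y ≤ dist x₃' y'`. -/
def IsCAT0 (d : X → X → ℝ) : Prop :=
  (∀ x y : X, ∃ γ l, IsGeodesic d γ l x y) ∧
  ∀ (x₁ x₂ x₃ : X) (γ : ℝ → X) (l : ℝ), IsGeodesic d γ l x₁ x₂ → ∀ t ∈ Set.Icc 0 l,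
    ∀ x₁' x₂' x₃' : EuclideanSpace ℝ (Fin 2),
      dist x₁' x₂' = d x₁ x₂ → dist x₁' x₃' = d x₁ x₃ → dist x₂' x₃' = d x₂ x₃ →
      ∀ y' ∈ segment ℝ x₁' x₂', dist x₁' y' = d x₁ (γ t) → dist x₂' y' = d x₂ (γ t) →
        d x₃ (γ t) ≤ dist x₃' y'

/-- The geodesic segment between `u` and `v` (in a CAT(0) space this is the image of the unique
geodesic that joins `u` to `v`). -/
def seg (d : X → X → ℝ) (u v : X) : Set X :=
  {y | d u y + d y v = d u v}

/-- The Alexandrov angle at `z` between the geodesics from `z` to `p` and from `z` to `q`: the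
upper limit of the comparison angles at `z` of the triples `z, a, b`, as the points
`a ≠ z` of the first geodesic and `b ≠ z` of the second one tend to `z`. -/
noncomputable def angle (d : X → X → ℝ) (z p q : X) : ℝ :=
  Filter.limsup (fun ab : X × X => euclAngle (d z ab.1) (d z ab.2) (d ab.1 ab.2))
    (Filter.comap (fun ab : X × X => (d z ab.1, d z ab.2)) (𝓝[>] (0 : ℝ) ×ˢ 𝓝[>] (0 : ℝ)) ⊓
      Filter.principal (seg d z p ×ˢ seg d z q))

end MetricGeometry

/-! ### Planar complexes -/

/-- A finite complex made of Euclidean triangles and edges, with vertex set `V`: a graph (the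
1-skeleton), a set of 3-cliques (the 2-cells), and edge lengths which on every 2-cell are
the side lengths of a nondegenerate Euclidean triangle.  Only the values of `len` on
adjacent pairs (and on the diagonal) carry information. -/
structure TriComplex (V : Type*) [DecidableEq V] where
  graph : SimpleGraph V
  faces : Set (Finset V)
  len : V → V → ℝ
  isNClique_of_mem_faces : ∀ f ∈ faces, graph.IsNClique 3 f
  len_self : ∀ v, len v v = 0
  len_comm : ∀ u v, len u v = len v u
  len_pos : ∀ u v, graph.Adj u v → 0 < len u v
  len_lt_add : ∀ a b c, ({a, b, c} : Finset V) ∈ faces → len a c < len a b + len b c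

namespace TriComplex

open MetricGeometry

variable {V : Type*} [Fintype V] [DecidableEq V] (K : TriComplex V)

/-- The vertex sets of the closed cells of dimensions 0, 1 and 2. -/
def IsCell (s : Finset V) : Prop :=
  (∃ v, s = {v}) ∨ (∃ u v, K.graph.Adj u v ∧ s = {u, v}) ∨ s ∈ K.faces

/-- The points of the complex, in barycentric coordinates.  The topology is the one induced from
`V → ℝ`, which is the usual topology of the geometric realization; all the lengths below refer
to `K.d` and not to the distance that Mathlib puts on `V → ℝ`. -/
abbrev Pt : Type _ :=
  {w : V → ℝ // (∀ v, 0 ≤ w v) ∧ ∑ v, w v = 1 ∧ ∃ s, K.IsCell s ∧ ∀ v, w v ≠ 0 → v ∈ s}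

/-- The closed simplex spanned by `s`. -/
def cell (s : Finset V) : Set K.Pt := {x | ∀ v, x.1 v ≠ 0 → v ∈ s}

/-- The vertex `v`, as a point of the complex. -/
def vert (v : V) : K.Pt :=
  ⟨Pi.single v 1, by
    refine ⟨fun u => ?_, by simp, {v}, Or.inl ⟨v, rfl⟩, fun u hu => ?_⟩
    · by_cases h : u = v
      · subst h; simp
      · simp [h]
    · by_contra h
      exact hu (by simp [Finset.mem_singleton.not.mp h])⟩

/-- The Euclidean distance between two points of a common cell, computed from the edge lengths:
if `P v` are points of a Euclidean space with `dist (P u) (P v) = len u v`, the distance between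
`∑ v, x v • P v` and `∑ v, y v • P v` is the square root of
`-(1/2) * ∑ u, ∑ v, (x u - y u) * (x v - y v) * len u v ^ 2`. -/
noncomputable def cellDist (x y : K.Pt) : ℝ :=
  Real.sqrt (-(1 / 2) * ∑ u, ∑ v, (x.1 u - y.1 u) * (x.1 v - y.1 v) * K.len u v ^ 2)

/-- `p 0 = x, p 1, …, p k = y` is a path: consecutive points lie in a common closed cell. -/
def IsPath (x y : K.Pt) (k : ℕ) (p : ℕ → K.Pt) : Prop :=
  p 0 = x ∧ p k = y ∧ ∀ i < k, ∃ s, K.IsCell s ∧ p i ∈ K.cell s ∧ p (i + 1) ∈ K.cell s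

/-- The intrinsic distance: the infimum of the lengths of the paths from `x` to `y`. -/
noncomputable def d (x y : K.Pt) : ℝ :=
  sInf {L | ∃ k p, K.IsPath x y k p ∧ L = ∑ i ∈ Finset.range k, K.cellDist (p i) (p (i + 1))}

/-- The complex is connected and, with its intrinsic distance, it is a CAT(0) space. -/
def IsCAT0Complex : Prop :=
  (∀ x y : K.Pt, ∃ k p, K.IsPath x y k p) ∧ IsCAT0 K.d

/-- The 1-skeleton, as a set of points. -/
def skeleton : Set K.Pt :=
  {x | (∃ v, x ∈ K.cell {v}) ∨ ∃ u v, K.graph.Adj u v ∧ x ∈ K.cell {u, v}}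

/-- The boundary of the triangle with vertex set `f`. -/
def faceBoundary (f : Finset V) : Set K.Pt :=
  {x | x ∈ K.cell f ∧ ∃ v ∈ f, x.1 v = 0}

/-- `φ` draws the 1-skeleton in the plane: it is injective and continuous there, and every edge is
drawn as a polygonal arc. -/
def IsDrawing (φ : K.Pt → EuclideanSpace ℝ (Fin 2)) : Prop :=
  ContinuousOn φ K.skeleton ∧ Set.InjOn φ K.skeleton ∧
  ∀ u v, K.graph.Adj u v →
    ∃ F : Finset (EuclideanSpace ℝ (Fin 2) × EuclideanSpace ℝ (Fin 2)),
      φ '' K.cell {u, v} = ⋃ s ∈ F, segment ℝ s.1 s.2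

/-- `D` is an inner face of the drawing `φ`: a bounded connected component of the complement of
the drawn 1-skeleton. -/
def IsInnerFace (φ : K.Pt → EuclideanSpace ℝ (Fin 2)) (D : Set (EuclideanSpace ℝ (Fin 2))) :
    Prop :=
  Bornology.IsBounded D ∧
    ∃ a ∈ (φ '' K.skeleton)ᶜ, D = connectedComponentIn (φ '' K.skeleton)ᶜ a

/-- `K` is a planar complex: it is 2-dimensional and its 1-skeleton has a planar drawing in which
the triangles that bound an inner face are exactly the 2-cells, and all inner faces are
of this kind. -/
def IsPlanar : Prop :=
  K.faces.Nonempty ∧ ∃ φ, K.IsDrawing φ ∧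
    (∀ f ∈ K.faces, ∃ D, K.IsInnerFace φ D ∧ frontier D = φ '' K.faceBoundary f) ∧
    (∀ D, K.IsInnerFace φ D → ∃ f ∈ K.faces, frontier D = φ '' K.faceBoundary f)

/-- The boundary of the complex: the union of the edges that do not lie in two different 2-cells. -/
def boundary : Set K.Pt :=
  {x | ∃ u v, K.graph.Adj u v ∧ x ∈ K.cell {u, v} ∧
    ¬ ∃ f ∈ K.faces, ∃ g ∈ K.faces, f ≠ g ∧ {u, v} ⊆ f ∧ {u, v} ⊆ g}

open Classical in
/-- The sum of the angles at `v` of the 2-cells that contain `v` (each 2-cell `{v, a, b}` occurs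
twice in the double sum). -/
noncomputable def theta (v : V) : ℝ :=
  (1 / 2) * ∑ a, ∑ b, if ({v, a, b} : Finset V) ∈ K.faces then
    euclAngle (K.len v a) (K.len v b) (K.len a b) else 0

/-! ### Cones and shortest path maps -/

/-- The data of a cone `C(z; p, q)`: its apex `z`, the endpoints `p`, `q` of its sides and
the set of its points. -/
structure Cone where
  apex : K.Pt
  p : K.Pt
  q : K.Pt
  carrier : Set K.Pt

variable {K}

/-- The union of the two sides of a cone. -/
def Cone.sides (c : K.Cone) : Set K.Pt := seg K.d c.apex c.p ∪ seg K.d c.apex c.q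

/-- The interior of a cone: its points outside its two sides. -/
def Cone.int (c : K.Cone) : Set K.Pt := c.carrier \ c.sides

/-- `c` is a cone: `p` and `q` lie on the boundary of the complex, the geodesics `γ(z, p)` and
`γ(z, q)` form an angle `α` with `0 < α < π`, and the carrier consists of these two geodesics and
of the region (connected component of the complement of the two geodesics) which contains the
angle `α`, that is, in which the two geodesics are joined by short geodesics near `z`. -/
def Cone.IsCone (c : K.Cone) : Prop :=
  c.p ∈ K.boundary ∧ c.q ∈ K.boundary ∧
  0 < angle K.d c.apex c.p c.q ∧ angle K.d c.apex c.p c.q < Real.pi ∧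
  (∃ r ∈ c.sidesᶜ, c.carrier = c.sides ∪ connectedComponentIn c.sidesᶜ r) ∧
  ∃ ε > 0, ∀ a ∈ seg K.d c.apex c.p, ∀ b ∈ seg K.d c.apex c.q,
    K.d c.apex a < ε → K.d c.apex b < ε → seg K.d a b ⊆ c.carrier

variable (K) in
/-- One of the angles at `z` formed by the geodesics `γ(z, x)` and `γ(z, p)` equals `π`, measured
inside the complex: it is divided by some geodesic `γ(z, w)` into two positive angles of
sum `π`.  (The Alexandrov angle alone does not say this, since it never exceeds `π`.) -/
def FormAnglePi (x z p : K.Pt) : Prop :=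
  ∃ w, 0 < angle K.d z x w ∧ 0 < angle K.d z w p ∧ angle K.d z x w + angle K.d z w p = Real.pi

variable (K) in
/-- The geodesic `γ(z, p)`, issuing from `z`, is admitted as a side of a cone of apex `z` in a
shortest path map of origin `x`: it passes through a vertex other than `z`, or it forms
with `γ(x, z)` an angle equal to `π`. -/
def IsAdmissibleSide (x z p : K.Pt) : Prop :=
  (∃ v, K.vert v ≠ z ∧ K.vert v ∈ seg K.d z p) ∨ FormAnglePi K x z p

variable (K) in
/-- `S` is a shortest path map of origin `x`. -/
structure IsSPM (x : K.Pt) (S : Set K.Cone) : Prop where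
  /-- The members of `S` are cones. -/
  isCone : ∀ c ∈ S, c.IsCone
  /-- The cones cover the complex. -/
  cover : ∀ y : K.Pt, ∃ c ∈ S, y ∈ c.carrier
  /-- Different cones have disjoint interiors. -/
  disjoint : ∀ c ∈ S, ∀ c' ∈ S, c ≠ c' → Disjoint c.int c'.int
  /-- Every vertex lies on a geodesic `γ(x, p)` of the map, where `γ(z, p)` is a side of a cone. -/
  vertex_mem : ∀ v, ∃ c ∈ S, K.vert v ∈ seg K.d x c.p ∪ seg K.d x c.q
  /-- A vertex of total angle `2π` lies on a side common to two cones, at least up to it. -/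
  flat_vertex : ∀ v, K.theta v = 2 * Real.pi →
    ∃ c ∈ S, ∃ c' ∈ S, c ≠ c' ∧ K.vert v ∈ c.sides ∧ K.vert v ∈ c'.sides
  /-- A vertex of negative curvature is the apex of a cone. -/
  negative_vertex : ∀ v, 2 * Real.pi < K.theta v → ∃ c ∈ S, c.apex = K.vert v
  /-- The apex of a cone lies on the geodesics from `x` to the endpoints of its sides. -/
  apex_mem : ∀ c ∈ S, c.apex ∈ seg K.d x c.p ∧ c.apex ∈ seg K.d x c.q
  /-- The map uses only geodesics determined by the vertices of the complex. -/
  side : ∀ c ∈ S, IsAdmissibleSide K x c.apex c.p ∧ IsAdmissibleSide K x c.apex c.q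

end TriComplex

/-!
A shortest path map has at most `6 n` cones. Only the first side `γ(z, p)` of each cone is used.

Near a point `z` the complex is a Euclidean cone, and by the `CAT(0)` inequality the comparison
angles at `z` of two geodesics are constant there. So the law of cosines holds with the Alexandrov
angle (`exists_cos_law`), two geodesics with angle less than `π` span a flat sector
(`exists_angle_between`), and short geodesics between them sweep this sector
(`exists_forall_mem_of_angle_add`).

At a point that is not a vertex the complex embeds locally in the plane (`exists_chart`). This uses
planarity, through the fact that an edge lies in at most two 2-cells
(`exists_eq_of_three_faces`). Hence geodesics branch only at vertices, and the apex of a cone is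
`x` or a vertex. Moreover a geodesic has only two sides: of three sectors at `z` with a common side,
two overlap (`exists_common_direction`, `exists_mem_of_three_sectors`). As the interiors of
the cones are disjoint, at most two cones have a given apex and a given direction of their first
side (`card_le_two`).

It remains to count the directions. If `γ(z, p)` passes through a vertex, let `v` be the first
one after `z`. It determines the direction, and also `z`, which is the last vertex before `v` on
`γ(x, v)`, or `x` itself (`apex_eq_of_first_vertex`). This gives at most `n` directions, and `2 n`
cones. Otherwise `γ(z, p)` forms an angle `π` with `γ(z, x)` on one of the two sides of `γ(z, x)`,
`z` is a vertex, and on each side there is only one such direction, because two half-planes that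
overlap along `γ(z, x)` coincide by non-branching (`exists_common_point_of_angle_pi`). This gives
at most `2 n` directions, and `4 n` cones.
-/

/-! ### Geodesics in a `CAT(0)` space -/

namespace MetricGeometry

variable {X : Type*}

/-- `d` is a distance function that satisfies the `CAT(0)` inequality. (That points at distance `0`
coincide follows, since there are geodesics between them.) -/
structure IsCAT0Metric (d : X → X → ℝ) : Prop where
  self : ∀ x, d x x = 0
  comm : ∀ x y, d x y = d y x
  tri : ∀ x y z, d x z ≤ d x y + d y z
  cat0 : IsCAT0 d

/-- The metric properties of a piecewise Euclidean `CAT(0)` complex with vertex set `Vt` on which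
the counting argument rests: near every point `z` the space is a Euclidean cone (shrinking two
points towards `z` by the same factor shrinks their distance by that factor), and near
every point that is not a vertex it embeds isometrically in the plane. -/
structure IsPolygonal (d : X → X → ℝ) (Vt : Set X) : Prop extends IsCAT0Metric d where
  finite : Vt.Finite
  conical : ∀ z, ∃ R > 0, ∀ t ∈ Set.Ioc (0 : ℝ) 1, ∀ a b a' b', d z a < R → d z b < R →
    a' ∈ seg d z a → d z a' = t * d z a → b' ∈ seg d z b → d z b' = t * d z b →
    d a' b' = t * d a b
  chart : ∀ z ∉ Vt, ∃ r > 0, ∃ Φ : X → ℂ, ∀ a b, d z a < r → d z b < r →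
    d a b = dist (Φ a) (Φ b)

/-- A comparison triangle in the plane, with the point that divides one side in the ratio
`t : 1 - t`; the last clause is Stewart's theorem. -/
theorem exists_comparison_triangle {a b c t : ℝ} (hc : 0 < c) (hb : 0 ≤ b) (ha : 0 ≤ a)
    (h1 : c ≤ b + a) (h2 : b ≤ c + a) (h3 : a ≤ c + b) (ht0 : 0 ≤ t) (ht1 : t ≤ 1) :
    ∃ P Q R y : EuclideanSpace ℝ (Fin 2), dist P Q = c ∧ dist P R = b ∧ dist Q R = a ∧
      y ∈ segment ℝ P Q ∧ dist P y = t * c ∧ dist Q y = (1 - t) * c ∧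
      dist R y ^ 2 = (1 - t) * b ^ 2 + t * a ^ 2 - t * (1 - t) * c ^ 2 := by
  set x : ℝ := (b ^ 2 + c ^ 2 - a ^ 2) / (2 * c) with hx
  have hxc : 2 * c * x = b ^ 2 + c ^ 2 - a ^ 2 := by rw [hx]; field_simp
  have hxb : x ^ 2 ≤ b ^ 2 := by
    have e : (2 * c) ^ 2 * (b ^ 2 - x ^ 2) =
        (b + c + a) * (b + c - a) * ((a + b - c) * (a + c - b)) := by
      have : (2 * c) ^ 2 * x ^ 2 = (b ^ 2 + c ^ 2 - a ^ 2) ^ 2 := by rw [← hxc]; ring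
      rw [mul_sub, this]; ring
    have : 0 ≤ (2 * c) ^ 2 * (b ^ 2 - x ^ 2) := by
      rw [e]
      exact mul_nonneg (mul_nonneg (by linarith) (by linarith))
        (mul_nonneg (by linarith) (by linarith))
    have := nonneg_of_mul_nonneg_right this (by positivity)
    linarith
  have hy : Real.sqrt (b ^ 2 - x ^ 2) ^ 2 = b ^ 2 - x ^ 2 := Real.sq_sqrt (by linarith)
  refine ⟨!₂[0, 0], !₂[c, 0], !₂[x, Real.sqrt (b ^ 2 - x ^ 2)], !₂[t * c, 0],
    ?_, ?_, ?_, ?_, ?_, ?_, ?_⟩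
  · simp [EuclideanSpace.dist_eq, Fin.sum_univ_two, Real.dist_eq, Real.sqrt_sq hc.le]
  · simp [EuclideanSpace.dist_eq, Fin.sum_univ_two, Real.dist_eq, hy, hb]
  · simp only [EuclideanSpace.dist_eq, Fin.sum_univ_two, Real.dist_eq, sq_abs]
    rw [Real.sqrt_eq_iff_mul_self_eq (by positivity) ha]
    simp [hy]
    nlinarith
  · refine ⟨1 - t, t, by linarith, ht0, by ring, ?_⟩
    ext i; fin_cases i <;> simp
  · simp [EuclideanSpace.dist_eq, Fin.sum_univ_two, Real.dist_eq,
      Real.sqrt_sq (mul_nonneg ht0 hc.le)]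
  · have : c - t * c = (1 - t) * c := by ring
    simp only [EuclideanSpace.dist_eq, Fin.sum_univ_two, Real.dist_eq, sq_abs]
    simp [this, Real.sqrt_sq (mul_nonneg (sub_nonneg.2 ht1) hc.le)]
  · rw [EuclideanSpace.dist_eq, Real.sq_sqrt (by positivity)]
    simp only [Fin.sum_univ_two, Real.dist_eq, sq_abs]
    simp [hy]
    nlinarith

namespace IsCAT0Metric

variable {d : X → X → ℝ} (h : IsCAT0Metric d)
include h

theorem nonneg (x y : X) : 0 ≤ d x y := by
  have := h.tri x y x
  rw [h.self, h.comm y x] at this; linarith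

theorem eq_of_eq_zero {x y : X} (hxy : d x y = 0) : x = y := by
  obtain ⟨γ, l, h0, h1, h2, h3⟩ := h.cat0.1 x y
  have := h3 0 ⟨le_rfl, h0⟩ l ⟨h0, le_rfl⟩
  rw [h1, h2, hxy] at this
  have : l = 0 := by simpa using this.symm
  rw [← h1, ← h2, this]

theorem pos_of_ne {x y : X} (hxy : x ≠ y) : 0 < d x y :=
  lt_of_le_of_ne (h.nonneg x y) fun e => hxy (h.eq_of_eq_zero e.symm)

theorem ne_of_pos {x y : X} (hxy : 0 < d x y) : x ≠ y := by
  rintro rfl; rw [h.self] at hxy; exact lt_irrefl _ hxy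

theorem exists_geodesic (x y : X) : ∃ γ : ℝ → X, IsGeodesic d γ (d x y) x y := by
  obtain ⟨γ, l, h0, h1, h2, h3⟩ := h.cat0.1 x y
  have := h3 0 ⟨le_rfl, h0⟩ l ⟨h0, le_rfl⟩
  rw [h1, h2, zero_sub, abs_neg, abs_of_nonneg h0] at this
  exact ⟨γ, by rw [this]; exact ⟨h0, h1, h2, h3⟩⟩

theorem exists_mem_seg {x y : X} {s : ℝ} (h0 : 0 ≤ s) (h1 : s ≤ d x y) :
    ∃ m ∈ seg d x y, d x m = s := by
  obtain ⟨γ, g0, g1, g2, g3⟩ := h.exists_geodesic x y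
  have e1 := g3 0 ⟨le_rfl, g0⟩ s ⟨h0, h1⟩
  have e2 := g3 s ⟨h0, h1⟩ _ ⟨g0, le_rfl⟩
  rw [g1, zero_sub, abs_neg, abs_of_nonneg h0] at e1
  rw [g2, abs_sub_comm, abs_of_nonneg (by linarith)] at e2
  exact ⟨γ s, by simp [seg, e1, e2], e1⟩

theorem sq_le_geodesic {u v : X} {γ : ℝ → X} (hγ : IsGeodesic d γ (d u v) u v) (w : X)
    {t : ℝ} (ht0 : 0 ≤ t) (ht1 : t ≤ 1) :
    d w (γ (t * d u v)) ^ 2 ≤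
      (1 - t) * d w u ^ 2 + t * d w v ^ 2 - t * (1 - t) * d u v ^ 2 := by
  obtain ⟨g0, g1, g2, g3⟩ := hγ
  rcases eq_or_lt_of_le g0 with hc | hc
  · rw [← hc, mul_zero, g1, ← h.eq_of_eq_zero hc.symm]; nlinarith
  have htc : t * d u v ∈ Set.Icc 0 (d u v) := ⟨by positivity, by nlinarith⟩
  have e1 := g3 0 ⟨le_rfl, g0⟩ _ htc
  have e2 := g3 _ ⟨g0, le_rfl⟩ _ htc
  rw [g1, zero_sub, abs_neg, abs_of_nonneg htc.1] at e1
  rw [g2, abs_of_nonneg (by linarith [htc.2])] at e2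
  obtain ⟨P, Q, R, y, k1, k2, k3, k4, k5, k6, k7⟩ := exists_comparison_triangle (t := t) hc
    (h.nonneg w u) (h.nonneg w v)
    (by rw [h.comm w u]; exact h.tri u w v)
    (by rw [h.comm w u, h.comm w v]; exact h.tri u v w)
    (by rw [add_comm]; exact h.tri w u v) ht0 ht1
  have := h.cat0.2 u v w γ (d u v) ⟨g0, g1, g2, g3⟩ _ htc P Q R k1 (k2.trans (h.comm _ _))
    (k3.trans (h.comm _ _)) y k4 (k5.trans e1.symm) (by rw [k6, e2]; ring)
  rw [← k7]
  exact pow_le_pow_left₀ (h.nonneg _ _) this 2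

theorem eq_geodesic {u v m : X} {γ : ℝ → X} (hγ : IsGeodesic d γ (d u v) u v)
    (hm : m ∈ seg d u v) : m = γ (d u m) := by
  have hm' : d u m + d m v = d u v := hm
  rcases eq_or_lt_of_le (h.nonneg u v) with hc | hc
  · have h1 := h.nonneg u m
    have h2 := h.nonneg m v
    have h3 : d u m = 0 := by linarith
    rw [h3, hγ.2.1, h.eq_of_eq_zero h3]
  · have h2 := h.nonneg m v
    have := h.sq_le_geodesic hγ m (t := d u m / d u v) (div_nonneg (h.nonneg _ _) hc.le)
      ((div_le_one hc).2 (by linarith))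
    rw [div_mul_cancel₀ _ hc.ne'] at this
    have e : (1 - d u m / d u v) * d m u ^ 2 + d u m / d u v * d m v ^ 2 -
        d u m / d u v * (1 - d u m / d u v) * d u v ^ 2 = 0 := by
      rw [h.comm m u, show d m v = d u v - d u m by linarith]; field_simp; ring
    rw [e] at this
    exact h.eq_of_eq_zero (pow_eq_zero_iff two_ne_zero |>.1 (le_antisymm this (sq_nonneg _)))

/-- A point of a geodesic is determined by its distance to the starting point. -/
theorem eq_of_mem_seg {u v m m' : X} (hm : m ∈ seg d u v) (hm' : m' ∈ seg d u v)
    (e : d u m = d u m') : m = m' := by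
  obtain ⟨γ, hγ⟩ := h.exists_geodesic u v
  rw [h.eq_geodesic hγ hm, h.eq_geodesic hγ hm', e]

/-- The inequality of Bruhat and Tits, for an arbitrary point of the side. -/
theorem sq_le_of_mem_seg {u v m : X} (hm : m ∈ seg d u v) (w : X) {t : ℝ} (ht0 : 0 ≤ t)
    (ht1 : t ≤ 1) (e : d u m = t * d u v) :
    d w m ^ 2 ≤ (1 - t) * d w u ^ 2 + t * d w v ^ 2 - t * (1 - t) * d u v ^ 2 := by
  obtain ⟨γ, hγ⟩ := h.exists_geodesic u v
  rw [h.eq_geodesic hγ hm, e]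
  exact h.sq_le_geodesic hγ w ht0 ht1

theorem right_mem_seg (u v : X) : v ∈ seg d u v := by simp [seg, h.self]

theorem mem_seg_comm {u v m : X} : m ∈ seg d u v ↔ m ∈ seg d v u := by
  simp only [seg, Set.mem_ofPred_eq]
  rw [h.comm u m, h.comm m v, h.comm u v, add_comm]

/-- Points of an initial piece of a geodesic lie on the geodesic. -/
theorem mem_seg_trans {u v m m' : X} (hm : m ∈ seg d u v) (hm' : m' ∈ seg d u m) :
    m' ∈ seg d u v := by
  simp only [seg, Set.mem_ofPred_eq] at *
  have h1 := h.tri m' m v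
  have h2 := h.tri u m' v
  linarith

theorem mem_seg_right {u v m m' : X} (hm : m ∈ seg d u v) (hm' : m' ∈ seg d u m) :
    m ∈ seg d m' v := by
  simp only [seg, Set.mem_ofPred_eq] at *
  have h1 := h.tri m' m v
  have h2 := h.tri u m' v
  linarith

theorem mem_seg_of_right {u v m m' : X} (hm : m ∈ seg d u v) (hm' : m' ∈ seg d m v) :
    m ∈ seg d u m' ∧ m' ∈ seg d u v := by
  rw [h.mem_seg_comm] at hm hm'
  exact ⟨h.mem_seg_comm.1 (h.mem_seg_right hm hm'), h.mem_seg_comm.1 (h.mem_seg_trans hm hm')⟩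

theorem d_le_of_mem_seg {u v m : X} (hm : m ∈ seg d u v) : d u m ≤ d u v := by
  have := h.nonneg m v
  simp only [seg, Set.mem_ofPred_eq] at hm
  linarith

/-- Two points of a geodesic, in the order of their distances to the starting point. -/
theorem mem_seg_of_le {u v m m' : X} (hm : m ∈ seg d u v) (hm' : m' ∈ seg d u v)
    (e : d u m' ≤ d u m) : m' ∈ seg d u m := by
  obtain ⟨p, hp, hpe⟩ := h.exists_mem_seg (h.nonneg u m') e
  rwa [← h.eq_of_mem_seg (h.mem_seg_trans hm hp) hm' hpe]

end IsCAT0Metric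

end MetricGeometry

/-! ### The law of cosines for Alexandrov angles -/

namespace MetricGeometry
namespace IsPolygonal

variable {X : Type*} {d : X → X → ℝ} {Vt : Set X} (h : IsPolygonal d Vt)

/-- The cosine of the comparison angle at `z` of the triple `z, a, b`. -/
noncomputable def compCos (d : X → X → ℝ) (z a b : X) : ℝ :=
  (d z a ^ 2 + d z b ^ 2 - d a b ^ 2) / (2 * d z a * d z b)

include h

theorem compCos_comm (z a b : X) : compCos d z a b = compCos d z b a := by
  simp only [compCos, h.comm a b]; ring

/-- Comparison angles at `z` decrease when one of the points moves towards `z`. -/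
theorem compCos_le {z a a' b : X} (ha' : a' ∈ seg d z a) (hz : a' ≠ z) (hb : b ≠ z) :
    compCos d z a b ≤ compCos d z a' b := by
  have p1 : 0 < d z a' := h.pos_of_ne hz.symm
  have p2 : 0 < d z b := h.pos_of_ne hb.symm
  have l1 := h.d_le_of_mem_seg ha'
  have p3 : 0 < d z a := p1.trans_le l1
  have := h.sq_le_of_mem_seg ha' b (t := d z a' / d z a) (by positivity)
    ((div_le_one p3).2 l1) (by field_simp)
  rw [h.comm b a', h.comm b z, h.comm b a] at this
  unfold compCos
  rw [div_le_div_iff₀ (by positivity) (by positivity)]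
  have e : d z a' / d z a * d z a = d z a' := by field_simp
  set l := d z a' / d z a
  rw [← e]
  have : 0 ≤ (2 * d z a * d z b) *
      ((1 - l) * d z b ^ 2 + l * d a b ^ 2 - l * (1 - l) * d z a ^ 2 - d a' b ^ 2) :=
    mul_nonneg (by positivity) (by linarith)
  linarith

theorem compCos_le₂ {z p q a a' b b' : X} (ha : a ∈ seg d z p) (ha' : a' ∈ seg d z p)
    (hb : b ∈ seg d z q) (hb' : b' ∈ seg d z q) (az : a' ≠ z) (bz : b' ≠ z)
    (la : d z a' ≤ d z a) (lb : d z b' ≤ d z b) : compCos d z a b ≤ compCos d z a' b' := by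
  have bz' : b ≠ z := by
    rintro rfl; rw [h.self] at lb
    exact absurd (h.pos_of_ne bz.symm) (not_lt.2 lb)
  refine (h.compCos_le (h.mem_seg_of_le ha ha' la) az bz').trans ?_
  rw [h.compCos_comm z a' b, h.compCos_comm z a' b']
  exact h.compCos_le (h.mem_seg_of_le hb hb' lb) bz az

theorem compCos_mem (z a b : X) (ha : a ≠ z) (hb : b ≠ z) :
    -1 ≤ compCos d z a b ∧ compCos d z a b ≤ 1 := by
  have p1 : 0 < d z a := h.pos_of_ne ha.symm
  have p2 : 0 < d z b := h.pos_of_ne hb.symm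
  have t1 := h.tri a z b
  have t2 := h.tri z a b
  have t3 := h.tri z b a
  have n := h.nonneg a b
  rw [h.comm a z] at t1
  rw [h.comm b a] at t3
  unfold compCos
  constructor
  · rw [le_div_iff₀ (by positivity)]; nlinarith
  · rw [div_le_one (by positivity)]
    have := abs_le_abs (a := d z a - d z b) (b := d a b) (by linarith) (by linarith)
    have := sq_le_sq.2 this
    linarith [sub_sq (d z a) (d z b)]

/-- Inside the radius on which the space is a Euclidean cone with apex `z`, the comparison angles
of two geodesics issuing from `z` are all equal: they are monotone by the `CAT(0)` inequality
and invariant under homotheties. -/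
theorem exists_compCos_eq (z : X) : ∃ R > 0, ∀ p q a b a' b' : X,
    a ∈ seg d z p → b ∈ seg d z q → a' ∈ seg d z p → b' ∈ seg d z q →
    a ≠ z → b ≠ z → a' ≠ z → b' ≠ z → d z a < R → d z b < R → d z a' < R → d z b' < R →
    compCos d z a b = compCos d z a' b' := by
  obtain ⟨R, hR, H⟩ := h.conical z
  refine ⟨R, hR, ?_⟩
  suffices key : ∀ p q a b a' b' : X,
      a ∈ seg d z p → b ∈ seg d z q → a' ∈ seg d z p → b' ∈ seg d z q →
      a ≠ z → b ≠ z → a' ≠ z → b' ≠ z → d z a < R → d z b < R →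
      compCos d z a' b' ≤ compCos d z a b from fun p q a b a' b' h1 h2 h3 h4 h5 h6 h7 h8 h9 h10
        h11 h12 => le_antisymm (key p q a' b' a b h3 h4 h1 h2 h7 h8 h5 h6 h11 h12)
        (key p q a b a' b' h1 h2 h3 h4 h5 h6 h7 h8 h9 h10)
  intro p q a b a' b' ha hb ha' hb' na nb na' nb' ra rb
  have p1 := h.pos_of_ne na.symm
  have p2 := h.pos_of_ne nb.symm
  have p3 := h.pos_of_ne na'.symm
  have p4 := h.pos_of_ne nb'.symm
  obtain ⟨t, ht0, ht1, hta, htb⟩ : ∃ t : ℝ, 0 < t ∧ t ≤ 1 ∧ t * d z a ≤ d z a' ∧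
      t * d z b ≤ d z b' := by
    refine ⟨min 1 (min (d z a' / d z a) (d z b' / d z b)), by positivity, min_le_left _ _,
      ?_, ?_⟩
    · rw [← le_div_iff₀ p1]; exact (min_le_right _ _).trans (min_le_left _ _)
    · rw [← le_div_iff₀ p2]; exact (min_le_right _ _).trans (min_le_right _ _)
  obtain ⟨a₁, ha₁, ea⟩ := h.exists_mem_seg (x := z) (y := a) (s := t * d z a)
    (by positivity) (by nlinarith)
  obtain ⟨b₁, hb₁, eb⟩ := h.exists_mem_seg (x := z) (y := b) (s := t * d z b)
    (by positivity) (by nlinarith)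
  have e := H t ⟨ht0, ht1⟩ a b a₁ b₁ ra rb ha₁ ea hb₁ eb
  have : compCos d z a b = compCos d z a₁ b₁ := by
    unfold compCos
    rw [ea, eb, e]; field_simp
  rw [this]
  exact h.compCos_le₂ ha' (h.mem_seg_trans ha ha₁) hb' (h.mem_seg_trans hb hb₁)
    (h.ne_of_pos (ea ▸ by positivity)).symm (h.ne_of_pos (eb ▸ by positivity)).symm
    (ea ▸ hta) (eb ▸ htb)

omit h in
theorem angle_eq_zero_of_bot {z p q : X}
    (hb : Filter.comap (fun ab : X × X => (d z ab.1, d z ab.2)) (𝓝[>] (0 : ℝ) ×ˢ 𝓝[>] (0 : ℝ)) ⊓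
      Filter.principal (seg d z p ×ˢ seg d z q) = ⊥) : angle d z p q = 0 := by
  unfold angle
  rw [hb, Filter.limsup_eq]
  simp

/-- The angle at `z` with a trivial geodesic is the upper limit along the trivial filter, hence `0`,
so a positive angle has nontrivial sides. -/
theorem ne_of_angle_pos {z p q : X} (hpos : 0 < angle d z p q) : p ≠ z ∧ q ≠ z := by
  have key : ∀ p' : X, p' = z → ∀ a ∈ seg d z p', d z a = 0 := by
    rintro p' rfl a ha
    have h1 := h.nonneg p' a
    have h2 := h.nonneg a p'
    have : d p' a + d a p' = d p' p' := ha
    rw [h.self] at this; linarith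
  refine ⟨fun e => hpos.ne' (angle_eq_zero_of_bot ?_),
    fun e => hpos.ne' (angle_eq_zero_of_bot ?_)⟩
  all_goals
    rw [← Filter.eventually_false_iff_eq_bot, Filter.eventually_inf_principal]
    refine Filter.mem_comap.2 ⟨Set.Ioi 0 ×ˢ Set.Ioi 0,
      Filter.prod_mem_prod self_mem_nhdsWithin self_mem_nhdsWithin, ?_⟩
    rintro ⟨a, b⟩ ⟨h1, h2⟩ ⟨h3, h4⟩
  · exact (ne_of_gt h1) (key p e a h3)
  · exact (ne_of_gt h2) (key q e b h4)

/-- Near `z` the law of cosines holds exactly, with the Alexandrov angle as angle. -/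
theorem exists_cos_law (z : X) : ∃ R > 0, ∀ p q, p ≠ z → q ≠ z →
    angle d z p q ∈ Set.Icc 0 Real.pi ∧ ∀ a ∈ seg d z p, ∀ b ∈ seg d z q, d z a < R → d z b < R →
      d a b ^ 2 = d z a ^ 2 + d z b ^ 2 - 2 * d z a * d z b * Real.cos (angle d z p q) := by
  obtain ⟨R, hR, H⟩ := h.exists_compCos_eq z
  refine ⟨R, hR, fun p q hp hq => ?_⟩
  have pp := h.pos_of_ne hp.symm
  have pq := h.pos_of_ne hq.symm
  obtain ⟨a₀, ha₀, ea⟩ := h.exists_mem_seg (x := z) (y := p) (s := min (R / 2) (d z p))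
    (by positivity) (min_le_right _ _)
  obtain ⟨b₀, hb₀, eb⟩ := h.exists_mem_seg (x := z) (y := q) (s := min (R / 2) (d z q))
    (by positivity) (min_le_right _ _)
  have na₀ : a₀ ≠ z := (h.ne_of_pos (ea ▸ by positivity)).symm
  have nb₀ : b₀ ≠ z := (h.ne_of_pos (eb ▸ by positivity)).symm
  have la₀ : d z a₀ < R := by rw [ea]; exact (min_le_left _ _).trans_lt (by linarith)
  have lb₀ : d z b₀ < R := by rw [eb]; exact (min_le_left _ _).trans_lt (by linarith)
  have key : ∀ a ∈ seg d z p, ∀ b ∈ seg d z q, 0 < d z a → d z a < R → 0 < d z b → d z b < R →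
      compCos d z a b = compCos d z a₀ b₀ := fun a ha b hb a0 a1 b0 b1 =>
    H p q a b a₀ b₀ ha hb ha₀ hb₀ (h.ne_of_pos a0).symm (h.ne_of_pos b0).symm na₀ nb₀ a1 b1
      la₀ lb₀
  have hne : (Filter.comap (fun ab : X × X => (d z ab.1, d z ab.2))
      (𝓝[>] (0 : ℝ) ×ˢ 𝓝[>] (0 : ℝ)) ⊓ Filter.principal (seg d z p ×ˢ seg d z q)).NeBot := by
    rw [Filter.inf_principal_neBot_iff]
    intro U hU
    obtain ⟨t, ht, htU⟩ := Filter.mem_comap.1 hU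
    have : (Set.Ioo 0 (d z p)) ×ˢ (Set.Ioo 0 (d z q)) ∈ 𝓝[>] (0 : ℝ) ×ˢ 𝓝[>] (0 : ℝ) :=
      Filter.prod_mem_prod (Ioo_mem_nhdsGT pp) (Ioo_mem_nhdsGT pq)
    obtain ⟨⟨s, u⟩, hst, hs, hu⟩ := Filter.nonempty_of_mem (Filter.inter_mem ht this)
    obtain ⟨a, ha, ea⟩ := h.exists_mem_seg (x := z) (y := p) hs.1.le hs.2.le
    obtain ⟨b, hb, eb⟩ := h.exists_mem_seg (x := z) (y := q) hu.1.le hu.2.le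
    simp only at ea eb
    exact ⟨(a, b), htU (by simpa [ea, eb] using hst), ha, hb⟩
  have hang : angle d z p q = Real.arccos (compCos d z a₀ b₀) := by
    unfold angle
    rw [Filter.limsup_congr (v := fun _ => Real.arccos (compCos d z a₀ b₀))]
    · exact Filter.limsup_const _
    · rw [Filter.eventually_inf_principal]
      refine Filter.mem_comap.2 ⟨Set.Ioo 0 R ×ˢ Set.Ioo 0 R,
        Filter.prod_mem_prod (Ioo_mem_nhdsGT hR) (Ioo_mem_nhdsGT hR), ?_⟩
      rintro ⟨a, b⟩ ⟨h1, h2⟩ ⟨h3, h4⟩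
      exact congrArg Real.arccos (key a h3 b h4 h1.1 h1.2 h2.1 h2.2)
  have hm := h.compCos_mem z a₀ b₀ na₀ nb₀
  refine ⟨hang ▸ ⟨Real.arccos_nonneg _, Real.arccos_le_pi _⟩, fun a ha b hb a1 b1 => ?_⟩
  rw [hang, Real.cos_arccos hm.1 hm.2]
  rcases eq_or_lt_of_le (h.nonneg z a) with a0 | a0
  · rw [← a0, ← h.eq_of_eq_zero a0.symm]; ring
  rcases eq_or_lt_of_le (h.nonneg z b) with b0 | b0
  · rw [← b0, ← h.eq_of_eq_zero b0.symm, h.comm a z]; ring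
  rw [← key a ha b hb a0 a1 b0 b1]
  unfold compCos
  field_simp
  ring

end IsPolygonal
end MetricGeometry

/-! ### Angles at a point -/

namespace MetricGeometry

variable {X : Type*}

/-- The law of cosines, with the Alexandrov angle as angle, holds for any two points at distance
less than `R` from `z`. -/
def IsConeRadius (d : X → X → ℝ) (z : X) (R : ℝ) : Prop :=
  0 < R ∧ ∀ p q, p ≠ z → q ≠ z →
    angle d z p q ∈ Set.Icc 0 Real.pi ∧ ∀ a ∈ seg d z p, ∀ b ∈ seg d z q, d z a < R → d z b < R →
      d a b ^ 2 = d z a ^ 2 + d z b ^ 2 - 2 * d z a * d z b * Real.cos (angle d z p q)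

namespace IsPolygonal

variable {d : X → X → ℝ} {Vt : Set X} (h : IsPolygonal d Vt)
include h

theorem exists_coneRadius (z : X) : ∃ R, IsConeRadius d z R := by
  obtain ⟨R, hR, H⟩ := h.exists_cos_law z
  exact ⟨R, hR, H⟩

theorem angle_nonneg {z p q : X} (hp : p ≠ z) (hq : q ≠ z) : 0 ≤ angle d z p q :=
  ((h.exists_coneRadius z).choose_spec.2 p q hp hq).1.1

theorem angle_le_pi {z p q : X} (hp : p ≠ z) (hq : q ≠ z) : angle d z p q ≤ Real.pi :=
  ((h.exists_coneRadius z).choose_spec.2 p q hp hq).1.2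

theorem exists_mem_seg_ne {z p : X} {s : ℝ} (h0 : 0 < s) (h1 : s ≤ d z p) :
    ∃ m ∈ seg d z p, d z m = s ∧ m ≠ z := by
  obtain ⟨m, hm, e⟩ := h.exists_mem_seg h0.le h1
  exact ⟨m, hm, e, (h.ne_of_pos (e ▸ h0)).symm⟩

/-- Angles depend only on the initial pieces of the geodesics. -/
theorem angle_congr {z p q a b : X} (ha : a ∈ seg d z p) (hb : b ∈ seg d z q) (na : a ≠ z)
    (nb : b ≠ z) : angle d z a b = angle d z p q := by
  have np : p ≠ z := by
    rintro rfl
    have := h.d_le_of_mem_seg ha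
    rw [h.self] at this
    exact absurd (h.pos_of_ne na.symm) (not_lt.2 this)
  have nq : q ≠ z := by
    rintro rfl
    have := h.d_le_of_mem_seg hb
    rw [h.self] at this
    exact absurd (h.pos_of_ne nb.symm) (not_lt.2 this)
  obtain ⟨R, hR, H⟩ := h.exists_coneRadius z
  have pa := h.pos_of_ne na.symm
  have pb := h.pos_of_ne nb.symm
  obtain ⟨a', ha', ea, na'⟩ := h.exists_mem_seg_ne (z := z) (p := a) (s := min (R / 2) (d z a))
    (by positivity) (min_le_right _ _)
  obtain ⟨b', hb', eb, nb'⟩ := h.exists_mem_seg_ne (z := z) (p := b) (s := min (R / 2) (d z b))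
    (by positivity) (min_le_right _ _)
  have la : d z a' < R := by rw [ea]; exact (min_le_left _ _).trans_lt (by linarith)
  have lb : d z b' < R := by rw [eb]; exact (min_le_left _ _).trans_lt (by linarith)
  have e1 := (H a b na nb).2 a' ha' b' hb' la lb
  have e2 := (H p q np nq).2 a' (h.mem_seg_trans ha ha') b' (h.mem_seg_trans hb hb') la lb
  have pa' := h.pos_of_ne na'.symm
  have pb' := h.pos_of_ne nb'.symm
  refine Real.injOn_cos (H a b na nb).1 (H p q np nq).1 ?_
  have : (2 * d z a' * d z b') * Real.cos (angle d z a b) =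
    (2 * d z a' * d z b') * Real.cos (angle d z p q) := by linarith
  exact mul_left_cancel₀ (by positivity) this

theorem cos_law {z a b : X} {R : ℝ} (hR : IsConeRadius d z R) (na : a ≠ z) (nb : b ≠ z)
    (la : d z a < R) (lb : d z b < R) :
    d a b ^ 2 = d z a ^ 2 + d z b ^ 2 - 2 * d z a * d z b * Real.cos (angle d z a b) :=
  (hR.2 a b na nb).2 a (h.right_mem_seg z a) b (h.right_mem_seg z b) la lb

theorem angle_comm {z p q : X} (np : p ≠ z) (nq : q ≠ z) : angle d z p q = angle d z q p := by
  obtain ⟨R, hR⟩ := h.exists_coneRadius z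
  have hR0 := hR.1
  have pa := h.pos_of_ne np.symm
  have pb := h.pos_of_ne nq.symm
  obtain ⟨a, ha, ea, na⟩ := h.exists_mem_seg_ne (z := z) (p := p) (s := min (R / 2) (d z p))
    (by positivity) (min_le_right _ _)
  obtain ⟨b, hb, eb, nb⟩ := h.exists_mem_seg_ne (z := z) (p := q) (s := min (R / 2) (d z q))
    (by positivity) (min_le_right _ _)
  have la : d z a < R := by rw [ea]; exact (min_le_left _ _).trans_lt (by linarith)
  have lb : d z b < R := by rw [eb]; exact (min_le_left _ _).trans_lt (by linarith)
  rw [← h.angle_congr ha hb na nb, ← h.angle_congr hb ha nb na]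
  have e1 := h.cos_law hR na nb la lb
  have e2 := h.cos_law hR nb na lb la
  rw [h.comm b a] at e2
  have pa' := h.pos_of_ne na.symm
  have pb' := h.pos_of_ne nb.symm
  refine Real.injOn_cos (hR.2 a b na nb).1 (hR.2 b a nb na).1 ?_
  have : (2 * d z a * d z b) * Real.cos (angle d z a b) =
    (2 * d z a * d z b) * Real.cos (angle d z b a) := by linarith
  exact mul_left_cancel₀ (by positivity) this

/-- The side of an isosceles triangle with apex `z`. -/
theorem dist_eq_two_mul_sin {z a b : X} {R : ℝ} (hR : IsConeRadius d z R) (na : a ≠ z)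
    (nb : b ≠ z) (la : d z a < R) (e : d z b = d z a) :
    d a b = 2 * d z a * Real.sin (angle d z a b / 2) := by
  have e1 := h.cos_law hR na nb la (e ▸ la)
  have h0 := h.angle_nonneg na nb
  have h1 := h.angle_le_pi na nb
  have hs : 0 ≤ Real.sin (angle d z a b / 2) :=
    Real.sin_nonneg_of_nonneg_of_le_pi (by linarith) (by linarith [Real.pi_pos])
  refine (sq_eq_sq₀ (h.nonneg _ _) (by have := h.nonneg z a; positivity)).1 ?_
  have c : Real.cos (angle d z a b) = 1 - 2 * Real.sin (angle d z a b / 2) ^ 2 := by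
    have := Real.cos_two_mul (angle d z a b / 2)
    rw [mul_div_cancel₀ _ (two_ne_zero)] at this
    rw [this, Real.cos_sq']; ring
  rw [e1, e, c]; ring

theorem angle_self {z p : X} (np : p ≠ z) : angle d z p p = 0 := by
  obtain ⟨R, hR⟩ := h.exists_coneRadius z
  have hR0 := hR.1
  have pa := h.pos_of_ne np.symm
  obtain ⟨a, ha, ea, na⟩ := h.exists_mem_seg_ne (z := z) (p := p) (s := min (R / 2) (d z p))
    (by positivity) (min_le_right _ _)
  have la : d z a < R := by rw [ea]; exact (min_le_left _ _).trans_lt (by linarith)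
  rw [← h.angle_congr ha ha na na]
  have e1 := h.dist_eq_two_mul_sin hR na na la rfl
  have h0 := h.angle_nonneg na na
  have h1 := h.angle_le_pi na na
  have pa' := h.pos_of_ne na.symm
  rw [h.self, eq_comm, mul_eq_zero, or_iff_right (by positivity),
    Real.sin_eq_zero_iff_of_lt_of_lt (by linarith [Real.pi_pos]) (by linarith [Real.pi_pos])] at e1
  linarith

/-- The polar radius, in direction `θ₁` from one end, of the point of the base of an isosceles
triangle with legs `s` and angle `θ₁ + θ₂` at the apex. -/
noncomputable def chordRadius (s θ₁ θ₂ : ℝ) : ℝ :=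
  s * Real.cos ((θ₁ + θ₂) / 2) / Real.cos ((θ₁ - θ₂) / 2)

omit h in
theorem cos_half_pos {θ₁ θ₂ : ℝ} (h1 : 0 ≤ θ₁) (h2 : 0 ≤ θ₂) (h3 : θ₁ + θ₂ < Real.pi) :
    0 < Real.cos ((θ₁ - θ₂) / 2) ∧ 0 < Real.cos ((θ₁ + θ₂) / 2) ∧
      Real.cos ((θ₁ + θ₂) / 2) ≤ Real.cos ((θ₁ - θ₂) / 2) := by
  refine ⟨Real.cos_pos_of_mem_Ioo ⟨by linarith, by linarith⟩,
    Real.cos_pos_of_mem_Ioo ⟨by linarith, by linarith⟩, ?_⟩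
  rw [← Real.cos_abs ((θ₁ - θ₂) / 2)]
  exact Real.cos_le_cos_of_nonneg_of_le_pi (abs_nonneg _) (by linarith)
    (abs_le.2 ⟨by linarith, by linarith⟩)

omit h in
theorem chordRadius_pos {s θ₁ θ₂ : ℝ} (hs : 0 < s) (h1 : 0 ≤ θ₁) (h2 : 0 ≤ θ₂)
    (h3 : θ₁ + θ₂ < Real.pi) : 0 < chordRadius s θ₁ θ₂ := by
  obtain ⟨c1, c2, c3⟩ := cos_half_pos h1 h2 h3
  exact div_pos (mul_pos hs c2) c1

omit h in
theorem chordRadius_le {s θ₁ θ₂ : ℝ} (hs : 0 < s) (h1 : 0 ≤ θ₁) (h2 : 0 ≤ θ₂)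
    (h3 : θ₁ + θ₂ < Real.pi) : chordRadius s θ₁ θ₂ ≤ s := by
  obtain ⟨c1, c2, c3⟩ := cos_half_pos h1 h2 h3
  rw [chordRadius, div_le_iff₀ c1]
  exact mul_le_mul_of_nonneg_left c3 hs.le

omit h in
/-- The law of cosines in the triangle cut off from an isosceles triangle by a ray through its
apex. -/
theorem chord_sq {s θ₁ θ₂ : ℝ} (hc : Real.cos ((θ₁ - θ₂) / 2) ≠ 0) :
    s ^ 2 + chordRadius s θ₁ θ₂ ^ 2 - 2 * s * chordRadius s θ₁ θ₂ * Real.cos θ₁ =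
      (s * Real.sin θ₁ / Real.cos ((θ₁ - θ₂) / 2)) ^ 2 := by
  unfold chordRadius
  have e : θ₁ = (θ₁ + θ₂) / 2 + (θ₁ - θ₂) / 2 := by ring
  set φ := (θ₁ + θ₂) / 2
  set δ := (θ₁ - θ₂) / 2
  rw [e, Real.cos_add, Real.sin_add]
  field_simp
  have h1 := Real.sin_sq_add_cos_sq φ
  have h2 := Real.sin_sq_add_cos_sq δ
  have e1 : Real.sin φ ^ 2 = 1 - Real.cos φ ^ 2 := by linarith
  have e2 : Real.sin δ ^ 2 = 1 - Real.cos δ ^ 2 := by linarith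
  ring_nf
  rw [e1, e2]
  ring

/-- A broken line with two pieces that crosses a sector of angle less than `π` has the length of
the chord, if its break point lies on the chord of the developed sector. -/
theorem dist_add_dist_eq {z a m b : X} {R : ℝ} (hR : IsConeRadius d z R) (na : a ≠ z)
    (nm : m ≠ z) (nb : b ≠ z) (la : d z a < R) (e : d z b = d z a)
    (hπ : angle d z a m + angle d z m b < Real.pi)
    (em : d z m = chordRadius (d z a) (angle d z a m) (angle d z m b)) :
    d a m + d m b = 2 * d z a * Real.sin ((angle d z a m + angle d z m b) / 2) := by
  have h1 := h.angle_nonneg na nm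
  have h2 := h.angle_nonneg nm nb
  have pa := h.pos_of_ne na.symm
  have h1' := Real.sin_nonneg_of_nonneg_of_le_pi h1 (h.angle_le_pi na nm)
  have h2' := Real.sin_nonneg_of_nonneg_of_le_pi h2 (h.angle_le_pi nm nb)
  obtain ⟨c1, c2, c3⟩ := cos_half_pos h1 h2 hπ
  have lm : d z m < R := em ▸ (chordRadius_le pa h1 h2 hπ).trans_lt la
  have e1 := h.cos_law hR na nm la lm
  have e2 := h.cos_law hR nb nm (e ▸ la) lm
  have em' : d z m = chordRadius (d z a) (angle d z m b) (angle d z a m) := by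
    rw [em]; unfold chordRadius
    rw [add_comm, ← Real.cos_neg ((angle d z a m - angle d z m b) / 2)]
    congr 2; ring
  have c1' : Real.cos ((angle d z m b - angle d z a m) / 2) =
      Real.cos ((angle d z a m - angle d z m b) / 2) := by
    rw [← Real.cos_neg]; congr 1; ring
  rw [em, chord_sq c1.ne'] at e1
  rw [h.angle_comm nb nm, em', e, chord_sq (c1' ▸ c1.ne'), c1'] at e2
  rw [(sq_eq_sq₀ (h.nonneg _ _) (by positivity)).1 e1, h.comm m b,
    (sq_eq_sq₀ (h.nonneg _ _) (by positivity)).1 e2, ← add_div, div_eq_iff c1.ne']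
  rw [← mul_add]
  set x := angle d z a m
  set y := angle d z m b
  rw [Real.sin_add_sin]; ring

/-- The triangle inequality for angles. -/
theorem angle_triangle {z p m q : X} (np : p ≠ z) (nm : m ≠ z) (nq : q ≠ z) :
    angle d z p q ≤ angle d z p m + angle d z m q := by
  rcases le_or_gt Real.pi (angle d z p m + angle d z m q) with hπ | hπ
  · exact (h.angle_le_pi np nq).trans hπ
  obtain ⟨R, hR⟩ := h.exists_coneRadius z
  have hR0 := hR.1
  have p1 := h.pos_of_ne np.symm
  have p2 := h.pos_of_ne nm.symm
  have p3 := h.pos_of_ne nq.symm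
  obtain ⟨s, hs, s1, s2, s3, s4⟩ : ∃ s : ℝ, 0 < s ∧ s < R ∧ s ≤ d z p ∧ s ≤ d z m ∧ s ≤ d z q :=
    ⟨min (R / 2) (min (d z p) (min (d z m) (d z q))), by positivity,
      (min_le_left _ _).trans_lt (by linarith), by simp, by simp, by simp⟩
  obtain ⟨a, ha, ea, na⟩ := h.exists_mem_seg_ne hs s2
  obtain ⟨b, hb, eb, nb⟩ := h.exists_mem_seg_ne hs s4
  have h1 := h.angle_nonneg np nm
  have h2 := h.angle_nonneg nm nq
  obtain ⟨c, hc, ec, nc⟩ := h.exists_mem_seg_ne (chordRadius_pos hs h1 h2 hπ)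
    ((chordRadius_le hs h1 h2 hπ).trans s3)
  rw [← h.angle_congr ha hb na nb]
  rw [← h.angle_congr ha hc na nc, ← h.angle_congr hc hb nc nb] at *
  have key := h.dist_add_dist_eq hR na nc nb (ea ▸ s1) (eb.trans ea.symm) hπ (ea ▸ ec)
  have := h.tri a c b
  rw [key, h.dist_eq_two_mul_sin hR na nb (ea ▸ s1) (eb.trans ea.symm), ea] at this
  have := le_of_mul_le_mul_left this (by positivity)
  have h3 := h.angle_nonneg na nb
  have h4 := h.angle_le_pi na nb
  have := (Real.strictMonoOn_sin.le_iff_le ⟨by linarith [Real.pi_pos], by linarith⟩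
    ⟨by linarith, by linarith⟩).1 this
  linarith

/-- If a direction splits an angle less than `π`, the ray in this direction meets the chord. -/
theorem mem_seg_of_angle_add {z a m b : X} {R : ℝ} (hR : IsConeRadius d z R) (na : a ≠ z)
    (nm : m ≠ z) (nb : b ≠ z) (la : d z a < R) (e : d z b = d z a)
    (hα : angle d z a m + angle d z m b = angle d z a b) (hπ : angle d z a b < Real.pi)
    (em : d z m = chordRadius (d z a) (angle d z a m) (angle d z m b)) : m ∈ seg d a b := by
  have := h.dist_add_dist_eq hR na nm nb la e (hα ▸ hπ) em
  rw [hα, ← h.dist_eq_two_mul_sin hR na nb la e] at this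
  exact this

end IsPolygonal
end MetricGeometry

/-! ### Flat sectors and non-branching of geodesics -/

namespace MetricGeometry

variable {X : Type*}

theorem dist_polar_sq (r s x y : ℝ) :
    dist (⟨r * Real.cos x, r * Real.sin x⟩ : ℂ) ⟨s * Real.cos y, s * Real.sin y⟩ ^ 2 =
      r ^ 2 + s ^ 2 - 2 * r * s * Real.cos (y - x) := by
  rw [Complex.dist_eq_re_im, Real.sq_sqrt (by positivity), Real.cos_sub]
  have h1 := Real.sin_sq_add_cos_sq x
  have h2 := Real.sin_sq_add_cos_sq y
  simp only
  linear_combination r ^ 2 * h1 + s ^ 2 * h2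

theorem eq_of_polar_eq {r s x y : ℝ} (hr : 0 ≤ r) (hs : 0 < s) (hx : x ∈ Set.Icc 0 Real.pi)
    (hy : y ∈ Set.Icc 0 Real.pi)
    (h : (⟨r * Real.cos x, r * Real.sin x⟩ : ℂ) = ⟨s * Real.cos y, s * Real.sin y⟩) :
    r = s ∧ x = y := by
  have h1 := congrArg Complex.re h
  have h2 := congrArg Complex.im h
  simp only at h1 h2
  have e1 := Real.sin_sq_add_cos_sq x
  have e2 := Real.sin_sq_add_cos_sq y
  have : r ^ 2 = s ^ 2 := by
    have : (r * Real.cos x) ^ 2 + (r * Real.sin x) ^ 2 =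
      (s * Real.cos y) ^ 2 + (s * Real.sin y) ^ 2 := by rw [h1, h2]
    linear_combination this - r ^ 2 * e1 + s ^ 2 * e2
  have hrs := (sq_eq_sq₀ hr hs.le).1 this
  subst hrs
  exact ⟨rfl, Real.injOn_cos hx hy (mul_left_cancel₀ hs.ne' h1)⟩

theorem eq_of_dist_midpoint {x m y y' : ℂ} {r : ℝ} (h1 : dist x m = r) (h2 : dist m y = r)
    (h3 : dist x y = 2 * r) (h2' : dist m y' = r) (h3' : dist x y' = 2 * r) : y = y' := by
  have e1 := eq_midpoint_of_dist_eq_half (x := x) (y := m) (z := y) (by linarith) (by linarith)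
  have e2 := eq_midpoint_of_dist_eq_half (x := x) (y := m) (z := y') (by linarith) (by linarith)
  have := e1.symm.trans e2
  rw [midpoint_eq_iff, AffineEquiv.pointReflection_midpoint_left] at this
  exact this.symm

namespace IsPolygonal

variable {d : X → X → ℝ} {Vt : Set X} (h : IsPolygonal d Vt)
include h

/-- Two geodesics with angle `α < π` at `z` span a flat sector: every intermediate direction
occurs, on the chord between points at equal distance from `z`. -/
theorem exists_angle_between {z a b : X} {R : ℝ} (hR : IsConeRadius d z R) (na : a ≠ z)
    (nb : b ≠ z) (la : d z a < R) (e : d z b = d z a) (hπ : angle d z a b < Real.pi) {θ : ℝ}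
    (h0 : 0 < θ) (h1 : θ < angle d z a b) :
    ∃ u, u ≠ z ∧ d z u = chordRadius (d z a) θ (angle d z a b - θ) ∧ angle d z a u = θ ∧
      angle d z u b = angle d z a b - θ := by
  set α := angle d z a b with hα
  set s := d z a with hs
  have ps : 0 < s := h.pos_of_ne na.symm
  obtain ⟨c1, -, -⟩ := cos_half_pos h0.le (sub_nonneg.2 h1.le) (θ₂ := α - θ) (by linarith)
  have c1' : Real.cos ((α - θ - θ) / 2) = Real.cos ((θ - (α - θ)) / 2) := by
    rw [← Real.cos_neg]; congr 1; ring
  have s1 := Real.sin_nonneg_of_nonneg_of_le_pi h0.le (by linarith)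
  have s2 := Real.sin_nonneg_of_nonneg_of_le_pi (sub_nonneg.2 h1.le) (by linarith)
  have hab := h.dist_eq_two_mul_sin hR na nb la e
  rw [← hα, ← hs] at hab
  have hsum : s * Real.sin θ / Real.cos ((θ - (α - θ)) / 2) +
      s * Real.sin (α - θ) / Real.cos ((θ - (α - θ)) / 2) = d a b := by
    rw [← add_div, ← mul_add, Real.sin_add_sin, hab, div_eq_iff c1.ne',
      show (θ + (α - θ)) / 2 = α / 2 by ring]
    ring
  have t1 : 0 ≤ s * Real.sin θ / Real.cos ((θ - (α - θ)) / 2) := by positivity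
  have t2 : 0 ≤ s * Real.sin (α - θ) / Real.cos ((θ - (α - θ)) / 2) := by positivity
  have q1 := chord_sq (s := s) (θ₁ := θ) (θ₂ := α - θ) c1.ne'
  have q2 := chord_sq (s := s) (θ₁ := α - θ) (θ₂ := θ) (c1' ▸ c1.ne')
  rw [c1', show chordRadius s (α - θ) θ = chordRadius s θ (α - θ) by
    unfold chordRadius; rw [c1', add_comm]] at q2
  have pρ := chordRadius_pos ps h0.le (sub_nonneg.2 h1.le) (θ₂ := α - θ) (by linarith)
  set τ := s * Real.sin θ / Real.cos ((θ - (α - θ)) / 2)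
  set τ' := s * Real.sin (α - θ) / Real.cos ((θ - (α - θ)) / 2)
  set ρ := chordRadius s θ (α - θ)
  obtain ⟨m, hm, em⟩ := h.exists_mem_seg (x := a) (y := b) t1 (by linarith)
  have em' : d m b = τ' := by
    have : d a m + d m b = d a b := hm
    linarith
  have nm : m ≠ z := by
    rintro rfl
    have : d a m + d m b = d a b := hm
    rw [h.comm a m, e, hab] at this
    have : Real.sin (α / 2) < Real.sin (Real.pi / 2) :=
      Real.strictMonoOn_sin ⟨by linarith, by linarith⟩ ⟨by linarith, le_rfl⟩ (by linarith)
    rw [Real.sin_pi_div_two] at this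
    nlinarith
  have lm : d z m < R := by
    -- the distance to `z` is convex along the chord
    have hdab : 0 < d a b := by
      have : 0 < Real.sin (α / 2) := Real.sin_pos_of_pos_of_lt_pi (by linarith) (by linarith)
      rw [hab]; positivity
    have hpos : 0 ≤ τ / d a b := by positivity
    have hle : τ / d a b ≤ 1 := by rw [div_le_one hdab]; linarith
    have := h.sq_le_of_mem_seg hm z (t := τ / d a b) hpos hle
      (by rw [em, div_mul_cancel₀ _ hdab.ne'])
    rw [e] at this
    have : d z m ^ 2 ≤ s ^ 2 := by
      have : 0 ≤ τ / d a b * (1 - τ / d a b) * d a b ^ 2 :=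
        mul_nonneg (mul_nonneg hpos (by linarith)) (sq_nonneg _)
      nlinarith
    exact (pow_le_pow_iff_left₀ (h.nonneg _ _) ps.le two_ne_zero |>.1 this).trans_lt la
  have pm := h.pos_of_ne nm.symm
  have k1 := h.cos_law hR na nm la lm
  have k2 := h.cos_law hR nb nm (e ▸ la) lm
  rw [h.comm b m, h.angle_comm nb nm, em', e] at k2
  rw [em] at k1
  have a1 := h.angle_nonneg na nm
  have a2 := h.angle_nonneg nm nb
  have a1' := h.angle_le_pi na nm
  have a2' := h.angle_le_pi nm nb
  have tri := h.angle_triangle na nm nb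
  rw [← hα] at tri
  set θ₁ := angle d z a m with hθ₁
  set θ₂ := angle d z m b with hθ₂
  set r := d z m
  -- the two triangles are developed side by side; an excess over `π` is cut off
  set β := min (θ₁ + θ₂) Real.pi with hβ
  have hβ1 : θ₁ ≤ β := le_min (by linarith) a1'
  have hβ2 : β ≤ θ₁ + θ₂ := min_le_left _ _
  have hβ3 : β ≤ Real.pi := min_le_right _ _
  have hαβ : α ≤ β := le_min tri hπ.le
  have dAM : dist (⟨s * Real.cos 0, s * Real.sin 0⟩ : ℂ) ⟨r * Real.cos θ₁, r * Real.sin θ₁⟩ = τ := by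
    rw [← sq_eq_sq₀ dist_nonneg t1, dist_polar_sq, sub_zero, ← k1]
  have dMB : dist (⟨r * Real.cos θ₁, r * Real.sin θ₁⟩ : ℂ) ⟨s * Real.cos β, s * Real.sin β⟩ ≤ τ' := by
    rw [← pow_le_pow_iff_left₀ dist_nonneg t2 two_ne_zero, dist_polar_sq, k2]
    have := Real.cos_le_cos_of_nonneg_of_le_pi (sub_nonneg.2 hβ1) a2' (by linarith)
    have : 2 * s * r * Real.cos θ₂ ≤ 2 * s * r * Real.cos (β - θ₁) :=
      mul_le_mul_of_nonneg_left this (by positivity)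
    nlinarith
  have dAB : ∀ x, 0 ≤ x → x ≤ Real.pi →
      dist (⟨s * Real.cos 0, s * Real.sin 0⟩ : ℂ) ⟨s * Real.cos x, s * Real.sin x⟩ =
        2 * s * Real.sin (x / 2) := by
    intro x x0 x1
    have hs : 0 ≤ Real.sin (x / 2) :=
      Real.sin_nonneg_of_nonneg_of_le_pi (by linarith) (by linarith [Real.pi_pos])
    rw [← sq_eq_sq₀ dist_nonneg (by positivity), dist_polar_sq, sub_zero]
    have : Real.cos x = 1 - 2 * Real.sin (x / 2) ^ 2 := by
      have := Real.cos_two_mul (x / 2)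
      rw [mul_div_cancel₀ _ (two_ne_zero)] at this
      rw [this, Real.cos_sq']; ring
    rw [this]; ring
  have hαβ' : β = α := by
    refine le_antisymm ?_ hαβ
    have := dist_triangle (⟨s * Real.cos 0, s * Real.sin 0⟩ : ℂ)
      ⟨r * Real.cos θ₁, r * Real.sin θ₁⟩ ⟨s * Real.cos β, s * Real.sin β⟩
    rw [dAM, dAB β (by linarith) hβ3] at this
    have : 2 * s * Real.sin (β / 2) ≤ 2 * s * Real.sin (α / 2) := by linarith
    have := le_of_mul_le_mul_left this (by positivity)
    have := (Real.strictMonoOn_sin.le_iff_le ⟨by linarith, by linarith⟩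
      ⟨by linarith, by linarith⟩).1 this
    linarith
  have hθ : θ₁ + θ₂ = α := by
    rw [← hαβ']
    rcases min_choice (θ₁ + θ₂) Real.pi with hc | hc
    · rw [hβ, hc]
    · rw [hβ, hc] at hαβ'; linarith
  rw [hαβ'] at dMB
  have dMB' : dist (⟨r * Real.cos θ₁, r * Real.sin θ₁⟩ : ℂ)
      ⟨s * Real.cos α, s * Real.sin α⟩ = τ' := by
    refine le_antisymm dMB ?_
    have := dist_triangle (⟨s * Real.cos 0, s * Real.sin 0⟩ : ℂ)
      ⟨r * Real.cos θ₁, r * Real.sin θ₁⟩ ⟨s * Real.cos α, s * Real.sin α⟩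
    rw [dAM, dAB α (by linarith) hπ.le] at this
    linarith
  have dAM₀ : dist (⟨s * Real.cos 0, s * Real.sin 0⟩ : ℂ) ⟨ρ * Real.cos θ, ρ * Real.sin θ⟩ = τ := by
    rw [← sq_eq_sq₀ dist_nonneg t1, dist_polar_sq, sub_zero, ← q1]
  have dMB₀ : dist (⟨ρ * Real.cos θ, ρ * Real.sin θ⟩ : ℂ) ⟨s * Real.cos α, s * Real.sin α⟩ = τ' := by
    rw [← sq_eq_sq₀ dist_nonneg t2, dist_polar_sq, ← q2]; ring
  have hd := dAB α (by linarith) hπ.le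
  have pd : 0 < 2 * s * Real.sin (α / 2) := by
    have : 0 < Real.sin (α / 2) := Real.sin_pos_of_pos_of_lt_pi (by linarith) (by linarith)
    positivity
  have u1 := eq_lineMap_of_dist_eq_mul_of_dist_eq_mul (E := ℂ) (PE := ℂ)
    (z := ⟨s * Real.cos α, s * Real.sin α⟩)
    (r := τ / (2 * s * Real.sin (α / 2)))
    (by rw [dAM, hd, div_mul_cancel₀ _ pd.ne'])
    (by rw [dMB', hd, sub_mul, div_mul_cancel₀ _ pd.ne']; linarith)
  have u2 := eq_lineMap_of_dist_eq_mul_of_dist_eq_mul (E := ℂ) (PE := ℂ)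
    (z := ⟨s * Real.cos α, s * Real.sin α⟩)
    (r := τ / (2 * s * Real.sin (α / 2)))
    (by rw [dAM₀, hd, div_mul_cancel₀ _ pd.ne'])
    (by rw [dMB₀, hd, sub_mul, div_mul_cancel₀ _ pd.ne']; linarith)
  obtain ⟨v1, v2⟩ := eq_of_polar_eq pm.le pρ ⟨a1, a1'⟩ ⟨h0.le, by linarith⟩ (u1.trans u2.symm)
  exact ⟨m, nm, v1, v2, by linarith⟩

/-- Geodesics do not branch at a point that is not a vertex. -/
theorem angle_eq_zero_of_mem_seg {x z p q : X} (hz : z ∉ Vt) (hx : x ≠ z) (np : p ≠ z)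
    (nq : q ≠ z) (hp : z ∈ seg d x p) (hq : z ∈ seg d x q) : angle d z p q = 0 := by
  obtain ⟨R, hR⟩ := h.exists_coneRadius z
  obtain ⟨r, hr, Φ, hΦ⟩ := h.chart z hz
  have hR0 := hR.1
  have p1 := h.pos_of_ne np.symm
  have p2 := h.pos_of_ne nq.symm
  have p3 := h.pos_of_ne hx.symm
  obtain ⟨s, hs, s0, s1, s2, s3, s4⟩ : ∃ s : ℝ, 0 < s ∧ s < r ∧ s < R ∧ s ≤ d z p ∧ s ≤ d z q ∧
      s ≤ d z x :=
    ⟨min (r / 2) (min (R / 2) (min (d z p) (min (d z q) (d z x)))), by positivity,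
      (min_le_left _ _).trans_lt (by linarith),
      (min_le_right _ _).trans_lt ((min_le_left _ _).trans_lt (by linarith)),
      by simp, by simp, by simp⟩
  obtain ⟨a, ha, ea, na⟩ := h.exists_mem_seg_ne hs s2
  obtain ⟨b, hb, eb, nb⟩ := h.exists_mem_seg_ne hs s3
  obtain ⟨c, hc, ec, nc⟩ := h.exists_mem_seg_ne hs s4
  have key : ∀ {p a : X}, z ∈ seg d x p → a ∈ seg d z p → d z a = s → d c a = 2 * s := by
    intro p a hp ha ea
    have h1 := (h.mem_seg_of_right hp ha).1
    have h2 := h.mem_seg_of_right (h.mem_seg_comm.1 h1) hc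
    have h3 : d a z + d z c = d a c := h2.1
    rw [h.comm c a, ← h3, h.comm a z, ea, ec]; ring
  have hzz : d z z < r := by rw [h.self]; exact hr
  have e : Φ a = Φ b := eq_of_dist_midpoint (x := Φ c) (m := Φ z) (r := s)
    (by rw [← hΦ c z (ec ▸ s0) hzz, h.comm, ec]) (by rw [← hΦ z a hzz (ea ▸ s0), ea])
    (by rw [← hΦ c a (ec ▸ s0) (ea ▸ s0), key hp ha ea])
    (by rw [← hΦ z b hzz (eb ▸ s0), eb])
    (by rw [← hΦ c b (ec ▸ s0) (eb ▸ s0), key hq hb eb])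
  have : a = b := h.eq_of_eq_zero (by rw [hΦ a b (ea ▸ s0) (eb ▸ s0), e, dist_self])
  rw [← h.angle_congr ha hb na nb, ← this, h.angle_self na]

/-- Two geodesics from `y` of the same length which avoid the vertices and have a point besides
`y` in common coincide. -/
theorem eq_of_mem_seg_of_mem_seg {y b₁ b₂ m : X} (hL : d y b₁ = d y b₂) (h1 : m ∈ seg d y b₁)
    (h2 : m ∈ seg d y b₂) (nm : m ≠ y) (hv : ∀ v ∈ Vt, v ∉ seg d y b₁) : b₁ = b₂ := by
  set L := d y b₁ with hLdef
  obtain ⟨γ, hγ⟩ := h.exists_geodesic y b₁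
  obtain ⟨η, hη⟩ := h.exists_geodesic y b₂
  rw [← hL] at hη
  rw [← hLdef] at hγ
  have L0 : 0 ≤ L := hγ.1
  have dγ : ∀ t ∈ Set.Icc 0 L, d y (γ t) = t := by
    intro t ht
    have := hγ.2.2.2 0 ⟨le_rfl, L0⟩ t ht
    rwa [hγ.2.1, zero_sub, abs_neg, abs_of_nonneg ht.1] at this
  have dη : ∀ t ∈ Set.Icc 0 L, d y (η t) = t := by
    intro t ht
    have := hη.2.2.2 0 ⟨le_rfl, L0⟩ t ht
    rwa [hη.2.1, zero_sub, abs_neg, abs_of_nonneg ht.1] at this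
  set A : Set ℝ := {t | t ∈ Set.Icc 0 L ∧ γ t = η t} with hA
  have lm : d y m ≤ L := h.d_le_of_mem_seg h1
  have pm := h.pos_of_ne nm.symm
  have mA : d y m ∈ A := ⟨⟨pm.le, lm⟩, by
    exact (h.eq_geodesic hγ h1).symm.trans (h.eq_geodesic (by rwa [← hL]) h2)⟩
  have bA : BddAbove A := ⟨L, fun t ht => ht.1.2⟩
  have T0 : d y m ≤ sSup A := le_csSup bA mA
  have T1 : sSup A ≤ L := csSup_le ⟨_, mA⟩ fun t ht => ht.1.2
  set T := sSup A with hT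
  have TI : T ∈ Set.Icc 0 L := ⟨pm.le.trans T0, T1⟩
  have eT : γ T = η T := by
    refine h.eq_of_eq_zero (le_antisymm (le_of_forall_pos_le_add fun ε hε => ?_) (h.nonneg _ _))
    obtain ⟨t, ht, htT⟩ := exists_lt_of_lt_csSup ⟨_, mA⟩ (show T - ε / 2 < sSup A by linarith)
    have le : t ≤ T := le_csSup bA ht
    have k1 := hγ.2.2.2 T TI t ht.1
    have k2 := hη.2.2.2 t ht.1 T TI
    rw [abs_of_nonneg (by linarith)] at k1
    rw [abs_sub_comm, abs_of_nonneg (by linarith), ← ht.2] at k2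
    have := h.tri (γ T) (γ t) (η T)
    linarith
  rcases eq_or_lt_of_le T1 with hTL | hTL
  · rw [← hγ.2.2.1, ← hη.2.2.1, ← hTL, eT]
  exfalso
  have segγ : ∀ t ∈ Set.Icc 0 L, ∀ t' ∈ Set.Icc 0 t, γ t' ∈ seg d y (γ t) := by
    intro t ht t' ht'
    have ht'' : t' ∈ Set.Icc 0 L := ⟨ht'.1, ht'.2.trans ht.2⟩
    have := hγ.2.2.2 t' ht'' t ht
    rw [abs_sub_comm, abs_of_nonneg (by linarith [ht'.2])] at this
    simp only [seg, Set.mem_ofPred_eq, this, dγ t ht, dγ t' ht'']; ring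
  have segη : ∀ t ∈ Set.Icc 0 L, ∀ t' ∈ Set.Icc 0 t, η t' ∈ seg d y (η t) := by
    intro t ht t' ht'
    have ht'' : t' ∈ Set.Icc 0 L := ⟨ht'.1, ht'.2.trans ht.2⟩
    have := hη.2.2.2 t' ht'' t ht
    rw [abs_sub_comm, abs_of_nonneg (by linarith [ht'.2])] at this
    simp only [seg, Set.mem_ofPred_eq, this, dη t ht, dη t' ht'']; ring
  have nV : γ T ∉ Vt := fun hc => hv _ hc (by
    have := segγ L ⟨L0, le_rfl⟩ T TI
    rwa [hγ.2.2.1] at this)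
  obtain ⟨r, hr, Φ, hΦ⟩ := h.chart _ nV
  have hTpos : 0 < T := pm.trans_le T0
  obtain ⟨k, hk, k1, k2, k3⟩ : ∃ k : ℝ, 0 < k ∧ k < r ∧ k ≤ T ∧ k ≤ L - T :=
    ⟨min (r / 2) (min T (L - T)), lt_min (by linarith) (lt_min hTpos (by linarith)),
      (min_le_left _ _).trans_lt (by linarith), by simp, by simp⟩
  have I1 : T - k ∈ Set.Icc 0 L := ⟨by linarith, by linarith⟩
  have I2 : T + k ∈ Set.Icc 0 L := ⟨by linarith [TI.1], by linarith⟩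
  have e1 : γ (T - k) = η (T - k) := by
    refine h.eq_of_mem_seg (segγ T TI _ ⟨by linarith, by linarith⟩)
      (eT ▸ segη T TI _ ⟨by linarith, by linarith⟩) ?_
    rw [dγ _ I1, dη _ I1]
  have hTT : d (γ T) (γ T) < r := by rw [h.self]; exact hr
  have g1 : d (γ (T - k)) (γ T) = k := by
    rw [hγ.2.2.2 _ I1 _ TI, abs_sub_comm, abs_of_nonneg] <;> linarith
  have g2 : d (γ T) (γ (T + k)) = k := by
    rw [hγ.2.2.2 _ TI _ I2, abs_sub_comm, abs_of_nonneg] <;> linarith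
  have g3 : d (γ (T - k)) (γ (T + k)) = 2 * k := by
    rw [hγ.2.2.2 _ I1 _ I2, abs_sub_comm, abs_of_nonneg] <;> linarith
  have g4 : d (γ T) (η (T + k)) = k := by
    rw [eT, hη.2.2.2 _ TI _ I2, abs_sub_comm, abs_of_nonneg] <;> linarith
  have g5 : d (γ (T - k)) (η (T + k)) = 2 * k := by
    rw [e1, hη.2.2.2 _ I1 _ I2, abs_sub_comm, abs_of_nonneg] <;> linarith
  have g2' := g2.trans_lt k1
  have g4' := g4.trans_lt k1
  have g1' : d (γ T) (γ (T - k)) < r := by rw [h.comm, g1]; exact k1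
  have e : Φ (γ (T + k)) = Φ (η (T + k)) :=
    eq_of_dist_midpoint (x := Φ (γ (T - k))) (m := Φ (γ T)) (r := k)
    (by rw [← hΦ _ _ g1' hTT, g1]) (by rw [← hΦ _ _ hTT g2', g2])
    (by rw [← hΦ _ _ g1' g2', g3])
    (by rw [← hΦ _ _ hTT g4', g4])
    (by rw [← hΦ _ _ g1' g4', g5])
  have : γ (T + k) = η (T + k) :=
    h.eq_of_eq_zero (by rw [hΦ _ _ g2' g4', e, dist_self])
  have := le_csSup bA (show T + k ∈ A from ⟨I2, this⟩)
  linarith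

end IsPolygonal
end MetricGeometry

/-! ### Overlapping sectors -/

namespace MetricGeometry

variable {X : Type*}

/-- Two circles with different centres have at most two points in common. -/
theorem exists_eq_of_dist_eq {c c' : ℂ} (hc : c ≠ c') {r r' : ℝ} (p : Fin 3 → ℂ)
    (h1 : ∀ i, dist (p i) c = r) (h2 : ∀ i, dist (p i) c' = r') : ∃ i j, i ≠ j ∧ p i = p j := by
  by_cases h01 : p 0 = p 1
  · exact ⟨0, 1, by decide, h01⟩
  rcases EuclideanGeometry.eq_of_dist_eq_of_dist_eq_of_finrank_eq_two (V := ℂ) (P := ℂ)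
    Complex.finrank_real_complex hc h01 (h1 0) (h1 1) (h1 2) (h2 0) (h2 1) (h2 2) with e | e
  · exact ⟨2, 0, by decide, e⟩
  · exact ⟨2, 1, by decide, e⟩

namespace IsPolygonal

variable {d : X → X → ℝ} {Vt : Set X} (h : IsPolygonal d Vt)
include h

theorem exists_vertex_free (z : X) : ∃ r > 0, ∀ v ∈ Vt, v ≠ z → r < d z v := by
  by_cases hne : (Vt \ {z}).Nonempty
  · obtain ⟨w, hw, hmin⟩ := (h.finite.sdiff (t := {z})).exists_minimalFor (fun v => d z v) _ hne
    have pw : 0 < d z w := h.pos_of_ne (fun e => hw.2 e.symm)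
    refine ⟨d z w / 2, by linarith, fun v hv nv => ?_⟩
    have : d z w ≤ d z v := by
      by_contra hc
      exact hc (hmin ⟨hv, nv⟩ (not_le.1 hc).le)
    linarith
  · exact ⟨1, one_pos, fun v hv nv => absurd ⟨v, hv, nv⟩ hne⟩

/-- Of three geodesics that form an angle in `(0, π)` with `γ(z, ζ)`, two leave this geodesic on
the same side: the sectors they span with it have a direction in common.  Indeed a point of
`γ(z, ζ)` near `z` has a planar neighbourhood, and there a point is determined up to a reflection
by its distances to two points of the geodesic. -/
theorem exists_common_direction {z ζ : X} (q : Fin 3 → X) (h0 : ∀ i, 0 < angle d z ζ (q i))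
    (hπ : ∀ i, angle d z ζ (q i) < Real.pi) :
    ∃ i j, i ≠ j ∧ ∃ u, u ≠ z ∧ ∃ θ, 0 < θ ∧ angle d z ζ u = θ ∧
      (θ < angle d z ζ (q i) ∧ angle d z u (q i) = angle d z ζ (q i) - θ) ∧
      (θ < angle d z ζ (q j) ∧ angle d z u (q j) = angle d z ζ (q j) - θ) := by
  have nζ : ζ ≠ z := (h.ne_of_angle_pos (h0 0)).1
  have nq : ∀ i, q i ≠ z := fun i => (h.ne_of_angle_pos (h0 i)).2
  obtain ⟨R, hR⟩ := h.exists_coneRadius z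
  obtain ⟨r₀, hr₀, hv⟩ := h.exists_vertex_free z
  have hR0 := hR.1
  have pζ := h.pos_of_ne nζ.symm
  obtain ⟨iq, hiq⟩ := Finite.exists_min fun i => d z (q i)
  have pq := h.pos_of_ne (nq iq).symm
  obtain ⟨s, hs, s1, s2, s3, s4⟩ : ∃ s : ℝ, 0 < s ∧ s < R ∧ s ≤ r₀ ∧ s ≤ d z ζ ∧
      s ≤ d z (q iq) :=
    ⟨min (R / 2) (min r₀ (min (d z ζ) (d z (q iq)))), by positivity,
      (min_le_left _ _).trans_lt (by linarith), by simp, by simp, by simp⟩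
  obtain ⟨a, ha, ea, na⟩ := h.exists_mem_seg_ne hs s3
  choose b hb eb nb using fun i => h.exists_mem_seg_ne hs (s4.trans (hiq i))
  have eα : ∀ i, angle d z a (b i) = angle d z ζ (q i) := fun i =>
    h.angle_congr ha (hb i) na (nb i)
  obtain ⟨ic, hic⟩ := Finite.exists_min fun i => Real.cos (angle d z ζ (q i) / 2)
  have pc : ∀ i, 0 < Real.cos (angle d z ζ (q i) / 2) := fun i =>
    Real.cos_pos_of_mem_Ioo ⟨by linarith [h0 i, Real.pi_pos], by linarith [hπ i]⟩
  have pκ : 0 < s * Real.cos (angle d z ζ (q ic) / 2) := mul_pos hs (pc ic)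
  set s' := s * Real.cos (angle d z ζ (q ic) / 2) with hs'
  have s's : s' ≤ s := by
    have := Real.cos_le_one (angle d z ζ (q ic) / 2)
    nlinarith
  -- the reference point `c` on the common side, with its planar chart, and a second one
  obtain ⟨c, hc, ec, nc⟩ := h.exists_mem_seg_ne (p := a) pκ (s's.trans ea.ge)
  have cV : c ∉ Vt := fun hcV => by
    have := hv c hcV nc
    linarith
  obtain ⟨r, hr, Φ, hΦ⟩ := h.chart c cV
  obtain ⟨η, η0, η1, η2⟩ : ∃ η : ℝ, 0 < η ∧ η < r ∧ η < s' :=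
    ⟨min (r / 2) (s' / 2), by positivity, (min_le_left _ _).trans_lt (by linarith),
      (min_le_right _ _).trans_lt (by linarith)⟩
  obtain ⟨c', hc', ec', nc'⟩ := h.exists_mem_seg_ne (z := z) (p := c) (s := s' - η)
    (by linarith) (by linarith)
  have dcc' : d c c' = η := by
    have : d z c' + d c' c = d z c := hc'
    rw [h.comm]; linarith
  have hcζ := h.mem_seg_trans ha hc
  have hcζ' := h.mem_seg_trans hcζ hc'
  obtain ⟨iα, hiα⟩ := Finite.exists_min fun i => angle d z ζ (q i)
  obtain ⟨θ, θ0, θ1, θ2⟩ : ∃ θ : ℝ, 0 < θ ∧ s' * θ < r ∧ θ < angle d z ζ (q iα) := by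
    have := h0 iα
    refine ⟨min (r / (2 * s')) (angle d z ζ (q iα) / 2), by positivity, ?_,
      (min_le_right _ _).trans_lt (by linarith)⟩
    calc s' * min (r / (2 * s')) (angle d z ζ (q iα) / 2) ≤ s' * (r / (2 * s')) :=
          mul_le_mul_of_nonneg_left (min_le_left _ _) pκ.le
      _ = r / 2 := by field_simp
      _ < r := by linarith
  have hθ : ∀ i, θ < angle d z ζ (q i) := fun i => θ2.trans_le (hiα i)
  have hex : ∀ i, ∃ u, u ≠ z ∧ d z u = s' ∧ angle d z ζ u = θ ∧
      angle d z u (q i) = angle d z ζ (q i) - θ := by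
    intro i
    obtain ⟨u, nu, eu, au, bu⟩ := h.exists_angle_between hR na (nb i) (ea ▸ s1)
      ((eb i).trans ea.symm) (by rw [eα]; exact hπ i) θ0 (by rw [eα]; exact hθ i)
    have le : s' ≤ d z u := by
      obtain ⟨c1, c2, -⟩ := cos_half_pos (θ₁ := θ) (θ₂ := angle d z a (b i) - θ) θ0.le
        (by rw [eα]; linarith [hθ i]) (by rw [eα]; linarith [hπ i])
      rw [eu, ea, chordRadius, hs', le_div_iff₀ c1, show θ + (angle d z a (b i) - θ) =
        angle d z ζ (q i) by rw [eα]; ring]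
      have l1 := hic i
      have l2 := Real.cos_le_one ((θ - (angle d z a (b i) - θ)) / 2)
      have : Real.cos (angle d z ζ (q ic) / 2) * Real.cos ((θ - (angle d z a (b i) - θ)) / 2) ≤
          Real.cos (angle d z ζ (q i) / 2) := by nlinarith [pc ic]
      calc _ = s * (Real.cos (angle d z ζ (q ic) / 2) *
            Real.cos ((θ - (angle d z a (b i) - θ)) / 2)) := by ring
        _ ≤ _ := mul_le_mul_of_nonneg_left this hs.le
    obtain ⟨w, hw, ew, nw⟩ := h.exists_mem_seg_ne pκ le
    refine ⟨w, nw, ew, ?_, ?_⟩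
    · rw [← h.angle_congr ha (h.right_mem_seg z w) na nw,
        h.angle_congr (h.right_mem_seg z a) hw na nw, au]
    · rw [← h.angle_congr (h.right_mem_seg z w) (hb i) nw (nb i),
        h.angle_congr hw (h.right_mem_seg z (b i)) nw (nb i), bu, eα]
  choose u nu eu au bu using hex
  have d1 : ∀ i, d c (u i) = 2 * s' * Real.sin (θ / 2) := by
    intro i
    have := h.dist_eq_two_mul_sin hR nc (nu i) (by linarith) ((eu i).trans ec.symm)
    rwa [h.angle_congr hcζ (h.right_mem_seg z (u i)) nc (nu i), au, ec] at this
  have d1' : ∀ i, d c (u i) < r := by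
    intro i
    rw [d1]
    have := Real.sin_le (show 0 ≤ θ / 2 by linarith)
    nlinarith
  have d2 : ∀ i, d c' (u i) ^ 2 = (s' - η) ^ 2 + s' ^ 2 - 2 * (s' - η) * s' * Real.cos θ := by
    intro i
    have := h.cos_law hR nc' (nu i) (by linarith) (by rw [eu]; linarith)
    rwa [h.angle_congr hcζ' (h.right_mem_seg z (u i)) nc' (nu i), au, ec', eu] at this
  have d2' : ∀ i, d c' (u i) =
      Real.sqrt ((s' - η) ^ 2 + s' ^ 2 - 2 * (s' - η) * s' * Real.cos θ) := by
    intro i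
    rw [← d2, Real.sqrt_sq (h.nonneg _ _)]
  have dc : d c c < r := by rw [h.self]; exact hr
  have dc' : d c c' < r := by rw [dcc']; exact η1
  obtain ⟨i, j, hij, e⟩ := exists_eq_of_dist_eq (c := Φ c) (c' := Φ c') (fun e => by
      have := hΦ c c' dc dc'
      rw [e, dist_self, dcc'] at this
      exact η0.ne' this) (fun i => Φ (u i))
    (fun i => by rw [← hΦ _ _ (d1' i) dc, h.comm, d1])
    (fun i => by rw [← hΦ _ _ (d1' i) dc', h.comm, d2'])
  have eij : u i = u j := h.eq_of_eq_zero (by rw [hΦ _ _ (d1' i) (d1' j), e, dist_self])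
  exact ⟨i, j, hij, u i, nu i, θ, θ0, au i, ⟨hθ i, bu i⟩, ⟨hθ j, by rw [eij]; exact bu j⟩⟩

theorem notMem_seg_of_angle_pos {z p u u' : X} (hpos : 0 < angle d z p u) (hu' : u' ∈ seg d z u)
    (nu' : u' ≠ z) : u' ∉ seg d z p := fun hc => by
  rw [← h.angle_congr hc hu' nu' nu', h.angle_self nu'] at hpos
  exact lt_irrefl _ hpos

/-- The points near `z` of a ray inside the sector spanned by `γ(z, p)` and `γ(z, q)` lie on short
geodesics between the two sides of the sector. -/
theorem exists_forall_mem_of_angle_add {z p q u : X} {C : Set X} {ε : ℝ} (hε : 0 < ε)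
    (hC : ∀ a ∈ seg d z p, ∀ b ∈ seg d z q, d z a < ε → d z b < ε → seg d a b ⊆ C)
    (nu : u ≠ z) (h1 : 0 < angle d z p u) (h2 : 0 < angle d z u q)
    (hα : angle d z p u + angle d z u q = angle d z p q) (hπ : angle d z p q < Real.pi) :
    ∃ ρ > 0, ∀ u' ∈ seg d z u, u' ≠ z → d z u' ≤ ρ → u' ∈ C \ (seg d z p ∪ seg d z q) := by
  have np : p ≠ z := (h.ne_of_angle_pos h1).1
  have nq : q ≠ z := (h.ne_of_angle_pos h2).2
  have pp := h.pos_of_ne np.symm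
  have pq := h.pos_of_ne nq.symm
  obtain ⟨R, hR⟩ := h.exists_coneRadius z
  have hR0 := hR.1
  obtain ⟨t, ht, t1, t2, t3, t4⟩ : ∃ t : ℝ, 0 < t ∧ t < R ∧ t < ε ∧ t ≤ d z p ∧ t ≤ d z q :=
    ⟨min (R / 2) (min (ε / 2) (min (d z p) (d z q))), by positivity,
      (min_le_left _ _).trans_lt (by linarith),
      (min_le_right _ _).trans_lt ((min_le_left _ _).trans_lt (by linarith)), by simp, by simp⟩
  obtain ⟨c1, c2, c3⟩ := cos_half_pos h1.le h2.le (hα ▸ hπ)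
  refine ⟨chordRadius t (angle d z p u) (angle d z u q),
    chordRadius_pos ht h1.le h2.le (hα ▸ hπ), fun u' hu' nu' le => ?_⟩
  have pu' := h.pos_of_ne nu'.symm
  -- the chord through `u'` between points of the two sides at equal distance from `z`
  set s := d z u' * Real.cos ((angle d z p u - angle d z u q) / 2) /
    Real.cos ((angle d z p u + angle d z u q) / 2) with hs
  have ps : 0 < s := div_pos (mul_pos pu' c1) c2
  have st : s ≤ t := by
    rw [hs, div_le_iff₀ c2]
    rwa [chordRadius, le_div_iff₀ c1] at le
  obtain ⟨a, ha, ea, na⟩ := h.exists_mem_seg_ne ps (st.trans t3)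
  obtain ⟨b, hb, eb, nb⟩ := h.exists_mem_seg_ne ps (st.trans t4)
  have e1 := h.angle_congr ha hu' na nu'
  have e2 := h.angle_congr hu' hb nu' nb
  have e3 := h.angle_congr ha hb na nb
  have hmem := h.mem_seg_of_angle_add hR na nu' nb (by linarith) (eb.trans ea.symm)
    (by rw [e1, e2, e3, hα]) (by rw [e3]; exact hπ)
    (by rw [e1, e2, ea, chordRadius, hs]; field_simp)
  refine ⟨hC a ha b hb (by linarith) (by linarith) hmem, ?_⟩
  rintro (hc | hc)
  · exact h.notMem_seg_of_angle_pos h1 hu' nu' hc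
  · rw [h.angle_comm nu nq] at h2
    exact h.notMem_seg_of_angle_pos h2 hu' nu' hc

/-- Of three sectors at `z` with a common side, two overlap. -/
theorem exists_mem_of_three_sectors {z ζ : X} (nζ : ζ ≠ z) (p q : Fin 3 → X) (C : Fin 3 → Set X)
    (hζ : ∀ i, ζ ∈ seg d z (p i)) (h0 : ∀ i, 0 < angle d z (p i) (q i))
    (hπ : ∀ i, angle d z (p i) (q i) < Real.pi)
    (hC : ∀ i, ∃ ε > 0, ∀ a ∈ seg d z (p i), ∀ b ∈ seg d z (q i), d z a < ε → d z b < ε →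
      seg d a b ⊆ C i) :
    ∃ i j, i ≠ j ∧ ∃ u, u ∈ C i \ (seg d z (p i) ∪ seg d z (q i)) ∧
      u ∈ C j \ (seg d z (p j) ∪ seg d z (q j)) := by
  have nq : ∀ i, q i ≠ z := fun i => (h.ne_of_angle_pos (h0 i)).2
  have e : ∀ i, angle d z ζ (q i) = angle d z (p i) (q i) := fun i =>
    h.angle_congr (hζ i) (h.right_mem_seg z (q i)) nζ (nq i)
  obtain ⟨i, j, hij, u, nu, θ, hθ, au, ⟨i1, i2⟩, ⟨j1, j2⟩⟩ := h.exists_common_direction q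
    (fun i => by rw [e]; exact h0 i) (fun i => by rw [e]; exact hπ i)
  have key : ∀ i, θ < angle d z ζ (q i) → angle d z u (q i) = angle d z ζ (q i) - θ →
      ∃ ρ > 0, ∀ u' ∈ seg d z u, u' ≠ z → d z u' ≤ ρ →
        u' ∈ C i \ (seg d z (p i) ∪ seg d z (q i)) := by
    intro i i1 i2
    obtain ⟨ε, hε, H⟩ := hC i
    have e' : angle d z (p i) u = θ := by
      rw [← h.angle_congr (hζ i) (h.right_mem_seg z u) nζ nu, au]
    exact h.exists_forall_mem_of_angle_add hε H nu (e'.symm ▸ hθ) (by rw [i2]; linarith)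
      (by rw [e', i2, e]; ring) (hπ i)
  obtain ⟨ρ, hρ, H⟩ := key i i1 i2
  obtain ⟨ρ', hρ', H'⟩ := key j j1 j2
  have pu := h.pos_of_ne nu.symm
  obtain ⟨u', hu', eu', nu'⟩ := h.exists_mem_seg_ne (z := z) (p := u)
    (s := min (min ρ ρ') (d z u)) (by positivity) (min_le_right _ _)
  refine ⟨i, j, hij, u', H u' hu' nu' ?_, H' u' hu' nu' ?_⟩
  · rw [eu']; exact (min_le_left _ _).trans (min_le_left _ _)
  · rw [eu']; exact (min_le_left _ _).trans (min_le_right _ _)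

theorem angle_eq_pi {x z p : X} (nx : x ≠ z) (np : p ≠ z) (hz : z ∈ seg d x p) :
    angle d z x p = Real.pi := by
  obtain ⟨R, hR⟩ := h.exists_coneRadius z
  have hR0 := hR.1
  have p1 := h.pos_of_ne nx.symm
  have p2 := h.pos_of_ne np.symm
  obtain ⟨s, hs, s1, s2, s3⟩ : ∃ s : ℝ, 0 < s ∧ s < R ∧ s ≤ d z x ∧ s ≤ d z p :=
    ⟨min (R / 2) (min (d z x) (d z p)), by positivity,
      (min_le_left _ _).trans_lt (by linarith), by simp, by simp⟩
  obtain ⟨a, ha, ea, na⟩ := h.exists_mem_seg_ne hs s2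
  obtain ⟨b, hb, eb, nb⟩ := h.exists_mem_seg_ne hs s3
  have h1 := (h.mem_seg_of_right hz hb).1
  have h2 := h.mem_seg_of_right (h.mem_seg_comm.1 h1) ha
  have h3 : d b z + d z a = d b a := h2.1
  have h4 := h.dist_eq_two_mul_sin hR na nb (by linarith) (eb.trans ea.symm)
  rw [h.comm a b, ← h3, h.comm b z, ea, eb, h.angle_congr ha hb na nb] at h4
  have h5 : Real.sin (angle d z x p / 2) = Real.sin (Real.pi / 2) := by
    rw [Real.sin_pi_div_two]
    have : 2 * s * Real.sin (angle d z x p / 2) = 2 * s * 1 := by linarith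
    exact mul_left_cancel₀ (by positivity) this
  have a0 := h.angle_nonneg nx np
  have a1 := h.angle_le_pi nx np
  have := Real.strictMonoOn_sin.injOn ⟨by linarith [Real.pi_pos], by linarith⟩
    ⟨by linarith [Real.pi_pos], le_rfl⟩ h5
  linarith

/-- Of three geodesics that form with `γ(z, x)` an angle equal to `π` measured inside the space,
two have an initial piece in common. -/
theorem exists_common_point_of_angle_pi {x z : X} (nx : x ≠ z) (w p : Fin 3 → X)
    (hz : ∀ i, z ∈ seg d x (p i)) (hw : ∀ i, 0 < angle d z x (w i))
    (hp : ∀ i, 0 < angle d z (w i) (p i))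
    (hs : ∀ i, angle d z x (w i) + angle d z (w i) (p i) = Real.pi) :
    ∃ i j, i ≠ j ∧ ∃ e, e ≠ z ∧ e ∈ seg d z (p i) ∧ e ∈ seg d z (p j) := by
  have nw : ∀ i, w i ≠ z := fun i => (h.ne_of_angle_pos (hw i)).2
  have np : ∀ i, p i ≠ z := fun i => (h.ne_of_angle_pos (hp i)).2
  obtain ⟨i, j, hij, u, nu, θ, hθ, au, ⟨i1, i2⟩, ⟨j1, j2⟩⟩ := h.exists_common_direction w hw
    (fun i => by linarith [hs i, hp i])
  have hθπ : θ < Real.pi := i1.trans (by linarith [hs i, hp i])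
  obtain ⟨R, hR⟩ := h.exists_coneRadius z
  obtain ⟨r₀, hr₀, hv⟩ := h.exists_vertex_free z
  have hR0 := hR.1
  have px := h.pos_of_ne nx.symm
  have pu := h.pos_of_ne nu.symm
  -- a direction `y` between `x` and the common direction `u` of two of the sectors
  obtain ⟨y, ny, ay, yu⟩ : ∃ y, y ≠ z ∧ angle d z x y = θ / 2 ∧ angle d z y u = θ / 2 := by
    obtain ⟨s, hs, s1, s2, s3⟩ : ∃ s : ℝ, 0 < s ∧ s < R ∧ s ≤ d z x ∧ s ≤ d z u :=
      ⟨min (R / 2) (min (d z x) (d z u)), by positivity,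
        (min_le_left _ _).trans_lt (by linarith), by simp, by simp⟩
    obtain ⟨a, ha, ea, na⟩ := h.exists_mem_seg_ne hs s2
    obtain ⟨b, hb, eb, nb⟩ := h.exists_mem_seg_ne hs s3
    have eab := (h.angle_congr ha hb na nb).trans au
    obtain ⟨y, ny, -, h1, h2⟩ := h.exists_angle_between hR na nb (by linarith)
      (eb.trans ea.symm) (eab ▸ hθπ) (θ := θ / 2) (by linarith) (by linarith)
    refine ⟨y, ny, ?_, ?_⟩
    · rw [← h.angle_congr ha (h.right_mem_seg z y) na ny, h1]
    · rw [← h.angle_congr (h.right_mem_seg z y) hb ny nb, h2, eab]; ring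
  have key : ∀ i, θ < angle d z x (w i) → angle d z u (w i) = angle d z x (w i) - θ →
      angle d z u (p i) = Real.pi - θ ∧ angle d z y (p i) = Real.pi - θ / 2 := by
    intro i i1 i2
    have e := h.angle_eq_pi nx (np i) (hz i)
    have t1 := h.angle_triangle nu (nw i) (np i)
    have t2 := h.angle_triangle nx nu (np i)
    have t3 := h.angle_triangle ny nu (np i)
    have t4 := h.angle_triangle nx ny (np i)
    have := hs i
    constructor <;> linarith
  obtain ⟨ki, ki'⟩ := key i i1 i2
  obtain ⟨kj, kj'⟩ := key j j1 j2
  have py := h.pos_of_ne ny.symm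
  have ppi := h.pos_of_ne (np i).symm
  have ppj := h.pos_of_ne (np j).symm
  obtain ⟨s, hs, s1, s2, s3, s4, s5, s6⟩ : ∃ s : ℝ, 0 < s ∧ s < R ∧ 3 * s ≤ r₀ ∧ s ≤ d z y ∧
      s ≤ d z u ∧ s ≤ d z (p i) ∧ s ≤ d z (p j) :=
    ⟨min (R / 2) (min (r₀ / 3) (min (d z y) (min (d z u) (min (d z (p i)) (d z (p j)))))),
      by positivity, (min_le_left _ _).trans_lt (by linarith),
      by rw [← le_div_iff₀' (by norm_num)]; simp, by simp, by simp, by simp, by simp⟩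
  obtain ⟨a, ha, ea, na⟩ := h.exists_mem_seg_ne hs s3
  obtain ⟨b, hb, eb, nb⟩ := h.exists_mem_seg_ne hs s5
  obtain ⟨b', hb', eb', nb'⟩ := h.exists_mem_seg_ne hs s6
  have hsum : θ / 2 + (Real.pi - θ) < Real.pi := by linarith
  have hρ := chordRadius_pos hs (θ₁ := θ / 2) (θ₂ := Real.pi - θ) (by linarith) (by linarith) hsum
  have hρ' := chordRadius_le hs (θ₁ := θ / 2) (θ₂ := Real.pi - θ) (by linarith) (by linarith) hsum
  obtain ⟨m, hm, em, nm⟩ := h.exists_mem_seg_ne hρ (hρ'.trans s4)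
  have am : angle d z a m = θ / 2 := (h.angle_congr ha hm na nm).trans yu
  -- both chords pass through `m`, so they coincide
  have chord : ∀ k b, angle d z u (p k) = Real.pi - θ → angle d z y (p k) = Real.pi - θ / 2 →
      b ∈ seg d z (p k) → d z b = s → b ≠ z →
      m ∈ seg d a b ∧ d a b = 2 * s * Real.sin ((Real.pi - θ / 2) / 2) := by
    intro k b k1 k2 hb eb nb
    have e1 : angle d z m b = Real.pi - θ := (h.angle_congr hm hb nm nb).trans k1
    have e2 : angle d z a b = Real.pi - θ / 2 := (h.angle_congr ha hb na nb).trans k2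
    refine ⟨h.mem_seg_of_angle_add hR na nm nb (by linarith) (eb.trans ea.symm)
      (by rw [am, e1, e2]; ring) (by rw [e2]; linarith) (by rw [am, e1, ea, em]), ?_⟩
    rw [h.dist_eq_two_mul_sin hR na nb (by linarith) (eb.trans ea.symm), e2, ea]
  obtain ⟨c1, c2⟩ := chord i b ki ki' hb eb nb
  obtain ⟨c3, c4⟩ := chord j b' kj kj' hb' eb' nb'
  have lsin : Real.sin ((Real.pi - θ / 2) / 2) < 1 := by
    rw [← Real.sin_pi_div_two]
    exact Real.strictMonoOn_sin ⟨by linarith [Real.pi_pos], by linarith⟩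
      ⟨by linarith [Real.pi_pos], le_rfl⟩ (by linarith)
  have lab : d a b < 2 * s := by rw [c2]; nlinarith
  have hbb' : b = b' := by
    refine h.eq_of_mem_seg_of_mem_seg (c2.trans c4.symm) c1 c3 ?_ ?_
    · rintro rfl
      rw [h.angle_self nm] at am
      linarith
    · intro v hvV hvs
      by_cases hvz : v = z
      · subst hvz
        have : d a v + d v b = d a b := hvs
        rw [h.comm a v, ea, eb] at this
        linarith
      · have := hv v hvV hvz
        have t := h.tri z a v
        have := h.d_le_of_mem_seg hvs
        linarith
  exact ⟨i, j, hij, b, nb, hb, hbb' ▸ hb'⟩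

end IsPolygonal
end MetricGeometry

/-! ### Counting sectors -/

namespace MetricGeometry

variable {X : Type*}

theorem finite_and_ncard_le_of_forall_finset {ι : Type*} {S : Set ι} {N : ℕ}
    (H : ∀ F : Finset ι, ↑F ⊆ S → F.card ≤ N) : S.Finite ∧ S.ncard ≤ N := by
  have hS : S.Finite := by
    by_contra hinf
    obtain ⟨F, hF, hcard⟩ := Set.Infinite.exists_subset_card_eq hinf (N + 1)
    have := H F hF
    omega
  refine ⟨hS, ?_⟩
  rw [Set.ncard_eq_toFinset_card S hS]
  exact H _ (by simp)

namespace IsPolygonal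

variable {d : X → X → ℝ} {Vt : Set X}

/-- A family of sectors with pairwise disjoint interiors, all of which lie behind their apex as
seen from `x`: the sector of index `c` has apex `z c`, its sides are the geodesics from `z c` to
`p c` and to `q c`, and `C c` is the set of its points. -/
structure IsSectorFamily (d : X → X → ℝ) (x : X) {ι : Type*} (S : Set ι) (z p q : ι → X)
    (C : ι → Set X) : Prop where
  angle_pos : ∀ c ∈ S, 0 < angle d (z c) (p c) (q c)
  angle_lt : ∀ c ∈ S, angle d (z c) (p c) (q c) < Real.pi
  seg_subset : ∀ c ∈ S, ∃ ε > 0, ∀ a ∈ seg d (z c) (p c), ∀ b ∈ seg d (z c) (q c),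
    d (z c) a < ε → d (z c) b < ε → seg d a b ⊆ C c
  disjoint : ∀ c ∈ S, ∀ c' ∈ S, c ≠ c' →
    Disjoint (C c \ (seg d (z c) (p c) ∪ seg d (z c) (q c)))
      (C c' \ (seg d (z c') (p c') ∪ seg d (z c') (q c')))
  left_mem : ∀ c ∈ S, z c ∈ seg d x (p c)
  right_mem : ∀ c ∈ S, z c ∈ seg d x (q c)

variable (h : IsPolygonal d Vt) {x : X} {ι : Type*} {S : Set ι} {z p q : ι → X} {C : ι → Set X}
  (hS : IsSectorFamily d x S z p q C)

include h hS

theorem apex_mem_vertices {c : ι} (hc : c ∈ S) (hx : x ≠ z c) : z c ∈ Vt := by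
  by_contra hV
  obtain ⟨n1, n2⟩ := h.ne_of_angle_pos (hS.angle_pos c hc)
  exact (hS.angle_pos c hc).ne'
    (h.angle_eq_zero_of_mem_seg hV hx n1 n2 (hS.left_mem c hc) (hS.right_mem c hc))

/-- At most two sectors with a given apex have a given initial direction of their first side. -/
theorem card_le_two {F : Finset ι} (hF : ↑F ⊆ S) {y ζ : X} (nζ : ζ ≠ y) (hz : ∀ c ∈ F, z c = y)
    (hζ : ∀ c ∈ F, ζ ∈ seg d (z c) (p c)) : F.card ≤ 2 := by
  by_contra! hcard
  obtain ⟨a, ha, b, hb, c, hc, hab, hac, hbc⟩ := Finset.two_lt_card.1 hcard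
  let f : Fin 3 → ι := ![a, b, c]
  have hf : ∀ i, f i ∈ F := by intro i; fin_cases i <;> assumption
  have hinj : ∀ i j, i ≠ j → f i ≠ f j := by
    intro i j hij
    fin_cases i <;> fin_cases j <;> first | exact absurd rfl hij | skip
    exacts [hab, hac, hab.symm, hbc, hac.symm, hbc.symm]
  have hzf : ∀ i, z (f i) = y := fun i => hz _ (hf i)
  obtain ⟨i, j, hij, u, hu, hu'⟩ := h.exists_mem_of_three_sectors nζ (fun i => p (f i))
    (fun i => q (f i)) (fun i => C (f i)) (fun i => by have := hζ _ (hf i); rwa [hzf] at this)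
    (fun i => by have := hS.angle_pos _ (hF (hf i)); rwa [hzf] at this)
    (fun i => by have := hS.angle_lt _ (hF (hf i)); rwa [hzf] at this)
    (fun i => by have := hS.seg_subset _ (hF (hf i)); rwa [hzf] at this)
  have := hS.disjoint _ (hF (hf i)) _ (hF (hf j)) (hinj i j hij)
  rw [hzf, hzf] at this
  exact Set.disjoint_left.1 this hu hu'

/-- A vertex `v` is the first one on the side of sectors of one apex only: this apex is the last
vertex before `v` on the geodesic from `x` to `v`, or `x` itself. -/
theorem apex_eq_of_first_vertex {v : X} {c c' : ι} (hc : c ∈ S) (hc' : c' ∈ S)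
    (hv : v ∈ seg d (z c) (p c)) (hv' : v ∈ seg d (z c') (p c'))
    (nv : v ≠ z c) (nv' : v ≠ z c')
    (hmin : ∀ w ∈ Vt, w ≠ z c → w ∈ seg d (z c) (p c) → d (z c) v ≤ d (z c) w)
    (hmin' : ∀ w ∈ Vt, w ≠ z c' → w ∈ seg d (z c') (p c') → d (z c') v ≤ d (z c') w) :
    z c = z c' := by
  have key : ∀ {c c' : ι}, c ∈ S → c' ∈ S → v ∈ seg d (z c) (p c) → v ∈ seg d (z c') (p c') →
      v ≠ z c' →
      (∀ w ∈ Vt, w ≠ z c → w ∈ seg d (z c) (p c) → d (z c) v ≤ d (z c) w) →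
      d x (z c) ≤ d x (z c') → z c = z c' := by
    intro c c' hc hc' hv hv' nv' hmin hle
    have m1 := (h.mem_seg_of_right (hS.left_mem c hc) hv).1
    have m2 := (h.mem_seg_of_right (hS.left_mem c' hc') hv').1
    by_contra hne
    have hx : x ≠ z c' := by
      intro e
      rw [← e, h.self] at hle
      exact hne ((h.eq_of_eq_zero (le_antisymm hle (h.nonneg _ _))).symm.trans e)
    have hV := h.apex_mem_vertices hS hc' hx
    have m3 : z c' ∈ seg d (z c) v := h.mem_seg_right m2 (h.mem_seg_of_le m2 m1 hle)
    have := hmin _ hV (Ne.symm hne) (h.mem_seg_trans hv m3)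
    have m4 : d (z c) (z c') + d (z c') v = d (z c) v := m3
    exact nv' (h.eq_of_eq_zero (le_antisymm (by linarith) (h.nonneg (z c') v))).symm
  rcases le_total (d x (z c)) (d x (z c')) with hle | hle
  · exact key hc hc' hv hv' nv' hmin hle
  · exact (key hc' hc hv' hv nv hmin' hle).symm

open Classical in
/-- The sectors whose first side passes through a vertex are at most twice as many as the
vertices. -/
theorem card_le_of_vertex_on_side {F : Finset ι} (hF : ↑F ⊆ S)
    (hv : ∀ c ∈ F, ∃ v ∈ Vt, v ≠ z c ∧ v ∈ seg d (z c) (p c)) : F.card ≤ 2 * Vt.ncard := by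
  have hex : ∀ c : ι, ∃ v, c ∈ F → v ∈ Vt ∧ v ≠ z c ∧ v ∈ seg d (z c) (p c) ∧
      ∀ w ∈ Vt, w ≠ z c → w ∈ seg d (z c) (p c) → d (z c) v ≤ d (z c) w := by
    intro c
    by_cases hc : c ∈ F
    · obtain ⟨v, h1, h2, h3⟩ := hv c hc
      have hfin : {v | v ∈ Vt ∧ v ≠ z c ∧ v ∈ seg d (z c) (p c)}.Finite :=
        h.finite.subset fun v hv => hv.1
      obtain ⟨w, hw, hmin⟩ := hfin.exists_minimalFor (fun v => d (z c) v) _ ⟨v, h1, h2, h3⟩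
      refine ⟨w, fun _ => ⟨hw.1, hw.2.1, hw.2.2, fun u h1 h2 h3 => ?_⟩⟩
      by_contra hlt
      exact hlt (hmin ⟨h1, h2, h3⟩ (not_le.1 hlt).le)
    · exact ⟨z c, fun hc' => absurd hc' hc⟩
  choose v hv using hex
  rw [Set.ncard_eq_toFinset_card Vt h.finite]
  refine Finset.card_le_mul_card_image_of_maps_to (f := v) (fun c hc => by simp [(hv c hc).1]) 2
    fun y hy => ?_
  rcases (F.filter fun c => v c = y).eq_empty_or_nonempty with he | ⟨c₀, hc₀⟩
  · simp [he]
  obtain ⟨f₀, e₀⟩ := Finset.mem_filter.1 hc₀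
  obtain ⟨-, a2, a3, a4⟩ := hv c₀ f₀
  rw [e₀] at a2 a3 a4
  refine h.card_le_two hS (y := z c₀) (ζ := y)
    (fun c hc => hF (Finset.mem_filter.1 hc).1) a2 ?_ ?_
  · intro c hc
    obtain ⟨f, e⟩ := Finset.mem_filter.1 hc
    obtain ⟨-, b2, b3, b4⟩ := hv c f
    rw [e] at b2 b3 b4
    exact h.apex_eq_of_first_vertex hS (hF f) (hF f₀) b3 a3 b2 a2 b4 a4
  · intro c hc
    obtain ⟨f, e⟩ := Finset.mem_filter.1 hc
    obtain ⟨-, -, b3, -⟩ := hv c f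
    rwa [e] at b3

open Classical in
/-- The sectors whose first side forms an angle equal to `π` with `γ(z, x)` are at most four times
as many as the vertices: their apexes are vertices, and at each of them there are at most
two directions of this kind. -/
theorem card_le_of_angle_pi {F : Finset ι} (hF : ↑F ⊆ S)
    (hw : ∀ c ∈ F, ∃ w, 0 < angle d (z c) x w ∧ 0 < angle d (z c) w (p c) ∧
      angle d (z c) x w + angle d (z c) w (p c) = Real.pi) : F.card ≤ 4 * Vt.ncard := by
  have hx : ∀ c ∈ F, x ≠ z c := fun c hc => by
    obtain ⟨w, hw, -⟩ := hw c hc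
    exact (h.ne_of_angle_pos hw).1
  rw [Set.ncard_eq_toFinset_card Vt h.finite]
  refine Finset.card_le_mul_card_image_of_maps_to (f := z)
    (fun c hc => by simp [h.apex_mem_vertices hS (hF hc) (hx c hc)]) 4 fun y hy => ?_
  set G := F.filter fun c => z c = y with hG
  have hGF : ∀ c ∈ G, c ∈ F ∧ z c = y := fun c hc => Finset.mem_filter.1 hc
  let r : ι → ι → Prop := fun c c' => ∃ e, e ≠ y ∧ e ∈ seg d y (p c) ∧ e ∈ seg d y (p c')
  have hclass : ∀ c, (G.filter (r c)).card ≤ 2 := by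
    intro c
    rcases (G.filter (r c)).eq_empty_or_nonempty with he | hne
    · simp [he]
    have hex : ∀ c' : ι, ∃ e, c' ∈ G.filter (r c) →
        e ≠ y ∧ e ∈ seg d y (p c) ∧ e ∈ seg d y (p c') := by
      intro c'
      by_cases hc' : c' ∈ G.filter (r c)
      · obtain ⟨e, he⟩ := (Finset.mem_filter.1 hc').2
        exact ⟨e, fun _ => he⟩
      · exact ⟨y, fun hc => absurd hc hc'⟩
    choose e he using hex
    obtain ⟨c₀, h₀, hmin⟩ := Finset.exists_min_image _ (fun c' => d y (e c')) hne
    refine h.card_le_two hS (y := y) (ζ := e c₀)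
      (fun c hc => hF (hGF c (Finset.mem_filter.1 hc).1).1) (he c₀ h₀).1
      (fun c hc => (hGF c (Finset.mem_filter.1 hc).1).2) fun c' hc' => ?_
    rw [(hGF c' (Finset.mem_filter.1 hc').1).2]
    exact h.mem_seg_trans (he c' hc').2.2
      (h.mem_seg_of_le (he c' hc').2.1 (he c₀ h₀).2.1 (hmin c' hc'))
  have hthree : ∀ f : Fin 3 → ι, (∀ i, f i ∈ G) → ∃ i j, i ≠ j ∧ r (f i) (f j) := by
    intro f hf
    have hzf : ∀ i, z (f i) = y := fun i => (hGF _ (hf i)).2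
    choose w w1 w2 w3 using fun i => hw (f i) (hGF _ (hf i)).1
    have hxy : x ≠ y := by rw [← hzf 0]; exact hx _ (hGF _ (hf 0)).1
    simp only [hzf] at w1 w2 w3
    exact h.exists_common_point_of_angle_pi hxy w (fun i => p (f i))
      (fun i => by have := hS.left_mem _ (hF (hGF _ (hf i)).1); rwa [hzf] at this) w1 w2 w3
  have hsymm : ∀ c c', r c c' → r c' c := fun c c' ⟨e, h1, h2, h3⟩ => ⟨e, h1, h3, h2⟩
  rcases G.eq_empty_or_nonempty with he | ⟨c₁, hc₁⟩
  · simp [he]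
  by_cases hall : ∀ c ∈ G, r c₁ c
  · have := hclass c₁
    rw [Finset.filter_true_of_mem hall] at this
    omega
  push Not at hall
  obtain ⟨c₂, hc₂, h12⟩ := hall
  have hsub : G ⊆ G.filter (r c₁) ∪ G.filter (r c₂) := by
    intro c hc
    obtain ⟨i, j, hij, hr⟩ := hthree ![c₁, c₂, c] (by intro i; fin_cases i <;> assumption)
    have : r c₁ c ∨ r c₂ c := by
      fin_cases i <;> fin_cases j <;> simp at hr hij
      · exact absurd hr h12
      · exact Or.inl hr
      · exact absurd (hsymm _ _ hr) h12
      · exact Or.inr hr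
      · exact Or.inl (hsymm _ _ hr)
      · exact Or.inr (hsymm _ _ hr)
    simpa [hc] using this
  calc G.card ≤ _ := Finset.card_le_card hsub
    _ ≤ _ := Finset.card_union_le _ _
    _ ≤ 4 := by have := hclass c₁; have := hclass c₂; omega

open Classical in
/-- A sector family all of whose first sides are admissible has at most six times as many members
as there are vertices. -/
theorem finite_and_ncard_le
    (hside : ∀ c ∈ S, (∃ v ∈ Vt, v ≠ z c ∧ v ∈ seg d (z c) (p c)) ∨
      ∃ w, 0 < angle d (z c) x w ∧ 0 < angle d (z c) w (p c) ∧
        angle d (z c) x w + angle d (z c) w (p c) = Real.pi) :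
    S.Finite ∧ S.ncard ≤ 6 * Vt.ncard := by
  refine finite_and_ncard_le_of_forall_finset fun F hF => ?_
  let P : ι → Prop := fun c => ∃ v ∈ Vt, v ≠ z c ∧ v ∈ seg d (z c) (p c)
  have h1 := h.card_le_of_vertex_on_side hS (F := F.filter P)
    (fun c hc => hF (Finset.mem_filter.1 hc).1) fun c hc => (Finset.mem_filter.1 hc).2
  have h2 := h.card_le_of_angle_pi hS (F := F.filter fun c => ¬ P c)
    (fun c hc => hF (Finset.mem_filter.1 hc).1) fun c hc =>
      (hside c (hF (Finset.mem_filter.1 hc).1)).resolve_left (Finset.mem_filter.1 hc).2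
  have := Finset.card_filter_add_card_filter_not (s := F) P
  omega

end IsPolygonal
end MetricGeometry

/-! ### Cells in the plane -/

namespace TriComplex

open MetricGeometry

variable {V : Type*} [Fintype V] [DecidableEq V] {K : TriComplex V}

/-- A triangle with given sides, placed with one side on the real axis. -/
theorem exists_complex_triangle {a b c : ℝ} (hc : 0 < c) (hb : 0 < b) (ha : 0 < a)
    (h1 : c < b + a) (h2 : b < c + a) (h3 : a < c + b) :
    ∃ τ : ℂ, 0 < τ.im ∧ dist 0 τ = b ∧ dist (c : ℂ) τ = a := by
  set x : ℝ := (b ^ 2 + c ^ 2 - a ^ 2) / (2 * c) with hx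
  have hxc : 2 * c * x = b ^ 2 + c ^ 2 - a ^ 2 := by rw [hx]; field_simp
  have hxb : 0 < b ^ 2 - x ^ 2 := by
    have e : (2 * c) ^ 2 * (b ^ 2 - x ^ 2) =
        (b + c + a) * (b + c - a) * ((a + b - c) * (a + c - b)) := by
      have : (2 * c) ^ 2 * x ^ 2 = (b ^ 2 + c ^ 2 - a ^ 2) ^ 2 := by rw [← hxc]; ring
      rw [mul_sub, this]; ring
    have : 0 < (2 * c) ^ 2 * (b ^ 2 - x ^ 2) := by
      rw [e]
      exact mul_pos (mul_pos (by linarith) (by linarith)) (mul_pos (by linarith) (by linarith))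
    exact pos_of_mul_pos_right this (by positivity)
  have hy : Real.sqrt (b ^ 2 - x ^ 2) ^ 2 = b ^ 2 - x ^ 2 := Real.sq_sqrt hxb.le
  refine ⟨⟨x, Real.sqrt (b ^ 2 - x ^ 2)⟩, Real.sqrt_pos.2 hxb, ?_, ?_⟩
  · rw [Complex.dist_eq_re_im, Real.sqrt_eq_iff_mul_self_eq (by positivity) hb.le]
    simp only [Complex.zero_re, Complex.zero_im, zero_sub, neg_sq, hy]
    ring
  · rw [Complex.dist_eq_re_im, Real.sqrt_eq_iff_mul_self_eq (by positivity) ha.le]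
    simp only [Complex.ofReal_re, Complex.ofReal_im, zero_sub, neg_sq, hy]
    linarith

variable (K) in
/-- `P` places the vertices of the cell `s` in the plane, at their distances in `K`. -/
def IsPlacement (s : Finset V) (P : V → ℂ) : Prop :=
  ∀ u ∈ s, ∀ v ∈ s, dist (P u) (P v) = K.len u v

/-- The point of the plane with the same barycentric coordinates as `x`, with respect to the
positions `P` of the vertices. -/
noncomputable def develop (P : V → ℂ) (x : K.Pt) : ℂ := ∑ v, x.1 v • P v

theorem develop_im (P : V → ℂ) (x : K.Pt) : (develop P x).im = ∑ v, x.1 v * (P v).im := by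
  simp [develop]

omit [Fintype V] in
theorem IsPlacement.mono {s t : Finset V} {P : V → ℂ} (h : IsPlacement K t P) (hst : s ⊆ t) :
    IsPlacement K s P := fun u hu v hv => h u (hst hu) v (hst hv)

omit [Fintype V] in
theorem isPlacement_pair {u v : V} {P : V → ℂ} (h : dist (P u) (P v) = K.len u v) :
    IsPlacement K {u, v} P := by
  intro a ha b hb
  simp only [Finset.mem_insert, Finset.mem_singleton] at ha hb
  rcases ha with rfl | rfl <;> rcases hb with rfl | rfl
  · simp [K.len_self]
  · exact h
  · rw [dist_comm, h, K.len_comm]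
  · simp [K.len_self]

omit [Fintype V] in
theorem isPlacement_triple {u v w : V} {P : V → ℂ} (h : dist (P u) (P v) = K.len u v)
    (h' : dist (P u) (P w) = K.len u w) (h'' : dist (P v) (P w) = K.len v w) :
    IsPlacement K {u, v, w} P := by
  intro a ha b hb
  simp only [Finset.mem_insert, Finset.mem_singleton] at ha hb
  rcases ha with rfl | rfl | rfl <;> rcases hb with rfl | rfl | rfl
  · simp [K.len_self]
  · exact h
  · exact h'
  · rw [dist_comm, h, K.len_comm]
  · simp [K.len_self]
  · exact h''
  · rw [dist_comm, h', K.len_comm]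
  · rw [dist_comm, h'', K.len_comm]
  · simp [K.len_self]

/-- Inside a cell, the distance computed from the edge lengths is that of the developed points. -/
theorem IsPlacement.cellDist_eq {s : Finset V} {P : V → ℂ} (hP : IsPlacement K s P) {x y : K.Pt}
    (hx : x ∈ K.cell s) (hy : y ∈ K.cell s) :
    K.cellDist x y = dist (develop P x) (develop P y) := by
  have h1 := EuclideanGeometry.dist_affineCombination (V := ℂ) (P := ℂ) (s := Finset.univ) P
    x.2.2.1 y.2.2.1
  rw [Finset.affineCombination_eq_linear_combination _ _ _ x.2.2.1,
    Finset.affineCombination_eq_linear_combination _ _ _ y.2.2.1] at h1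
  unfold cellDist
  rw [← Real.sqrt_mul_self (dist_nonneg (x := develop P x) (y := develop P y))]
  congr 1
  refine Eq.trans ?_ h1.symm
  rw [neg_mul, neg_div, neg_inj, mul_comm, mul_one_div]
  congr 1
  refine Finset.sum_congr rfl fun u _ => Finset.sum_congr rfl fun v _ => ?_
  simp only [Pi.sub_apply]
  by_cases hu : u ∈ s
  · by_cases hv : v ∈ s
    · rw [hP u hu v hv, sq]
    · have h1 : x.1 v = 0 := by_contra fun e => hv (hx v e)
      have h2 : y.1 v = 0 := by_contra fun e => hv (hy v e)
      rw [h1, h2]; ring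
  · have h1 : x.1 u = 0 := by_contra fun e => hu (hx u e)
    have h2 : y.1 u = 0 := by_contra fun e => hu (hy u e)
    rw [h1, h2]; ring

omit [Fintype V] in
theorem exists_face_eq {f : Finset V} (hf : f ∈ K.faces) {v : V} (hv : v ∈ f) :
    ∃ a b, K.graph.Adj a b ∧ K.graph.Adj a v ∧ K.graph.Adj b v ∧ f = {a, b, v} := by
  obtain ⟨a, b, c, h1, h2, h3, rfl⟩ := SimpleGraph.is3Clique_iff.1 (K.isNClique_of_mem_faces f hf)
  simp only [Finset.mem_insert, Finset.mem_singleton] at hv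
  rcases hv with rfl | rfl | rfl
  · exact ⟨b, c, h3, h1.symm, h2.symm, by ext; simp; tauto⟩
  · exact ⟨a, c, h2, h1, h3.symm, by ext; simp; tauto⟩
  · exact ⟨a, b, h1, h2, h3, rfl⟩

omit [Fintype V] in
/-- The third vertex of a 2-cell, placed above the edge `{a, b}` on the real axis. -/
theorem exists_third_vertex {a b v : V} (hf : ({a, b, v} : Finset V) ∈ K.faces)
    (hab : K.graph.Adj a b) (hav : K.graph.Adj a v) (hbv : K.graph.Adj b v) :
    ∃ τ : ℂ, 0 < τ.im ∧ dist 0 τ = K.len a v ∧ dist (K.len a b : ℂ) τ = K.len b v := by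
  have e1 : ({a, v, b} : Finset V) = {a, b, v} := by ext; simp; tauto
  have e2 : ({b, a, v} : Finset V) = {a, b, v} := by ext; simp; tauto
  have t1 := K.len_lt_add a b v hf
  have t2 := K.len_lt_add a v b (e1 ▸ hf)
  have t3 := K.len_lt_add b a v (e2 ▸ hf)
  rw [K.len_comm v b] at t2
  rw [K.len_comm b a] at t3
  exact exists_complex_triangle (K.len_pos _ _ hab) (K.len_pos _ _ hav) (K.len_pos _ _ hbv)
    t2 t1 t3

omit [Fintype V] in
/-- A cell can be placed in the plane with a given vertex above the real axis and the others on
it. -/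
theorem exists_placement {s : Finset V} (hs : K.IsCell s) {v : V} (hv : v ∈ s) :
    ∃ P : V → ℂ, IsPlacement K s P ∧ 0 < (P v).im ∧ ∀ u ∈ s, u ≠ v → (P u).im = 0 := by
  have pair : ∀ u, K.graph.Adj u v → ∃ P : V → ℂ, IsPlacement K {u, v} P ∧ 0 < (P v).im ∧
      ∀ w ∈ ({u, v} : Finset V), w ≠ v → (P w).im = 0 := by
    intro u huv
    have hl := K.len_pos _ _ huv
    refine ⟨fun w => if w = v then (K.len u v : ℂ) * Complex.I else 0, ?_, ?_, ?_⟩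
    · refine isPlacement_pair ?_
      simp [huv.ne, abs_of_pos hl]
    · simpa using hl
    · intro w _ hw; simp [hw]
  rcases hs with ⟨w, rfl⟩ | ⟨u, w, huw, rfl⟩ | hf
  · obtain rfl := Finset.mem_singleton.1 hv
    refine ⟨fun _ => Complex.I, ?_, by simp, ?_⟩
    · intro a ha b hb
      rw [Finset.mem_singleton.1 ha, Finset.mem_singleton.1 hb]
      simp [K.len_self]
    · intro u hu hne; exact absurd (Finset.mem_singleton.1 hu) hne
  · simp only [Finset.mem_insert, Finset.mem_singleton] at hv
    rcases hv with rfl | rfl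
    · rw [Finset.pair_comm]; exact pair _ huw.symm
    · exact pair _ huw
  · obtain ⟨a, b, hab, hav, hbv, rfl⟩ := exists_face_eq hf hv
    obtain ⟨τ, h0, h1, h2⟩ := exists_third_vertex hf hab hav hbv
    have hl := K.len_pos _ _ hab
    refine ⟨fun w => if w = v then τ else if w = b then (K.len a b : ℂ) else 0, ?_, ?_, ?_⟩
    · refine isPlacement_triple ?_ ?_ ?_
      · simp [hav.ne, hbv.ne, hab.ne, abs_of_pos hl]
      · simpa [hav.ne, hab.ne] using h1
      · simpa [hbv.ne] using h2
    · simpa using h0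
    · intro w _ hw
      simp only [hw, if_false]
      split_ifs <;> simp

theorem cellDist_nonneg (x y : K.Pt) : 0 ≤ K.cellDist x y := Real.sqrt_nonneg _

theorem cellDist_comm (x y : K.Pt) : K.cellDist x y = K.cellDist y x := by
  unfold cellDist
  congr 2
  refine Finset.sum_congr rfl fun u _ => Finset.sum_congr rfl fun w _ => ?_
  ring

/-- Inside a cell the barycentric coordinates are Lipschitz functions. -/
theorem exists_coord_le_cellDist (K : TriComplex V) : ∃ C > 0, ∀ s, K.IsCell s →
    ∀ x ∈ K.cell s, ∀ y ∈ K.cell s, ∀ v, |x.1 v - y.1 v| ≤ C * K.cellDist x y := by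
  have key : ∀ sv : Finset V × V, ∃ C : ℝ, 0 ≤ C ∧ (K.IsCell sv.1 → ∀ x ∈ K.cell sv.1,
      ∀ y ∈ K.cell sv.1, |x.1 sv.2 - y.1 sv.2| ≤ C * K.cellDist x y) := by
    rintro ⟨s, v⟩
    by_cases hs : K.IsCell s
    · by_cases hv : v ∈ s
      · obtain ⟨P, hP, h0, h1⟩ := exists_placement hs hv
        refine ⟨((P v).im)⁻¹, by positivity, fun _ x hx y hy => ?_⟩
        have im : ∀ z ∈ K.cell s, (develop P z).im = z.1 v * (P v).im := by
          intro z hz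
          rw [develop_im]
          refine Finset.sum_eq_single v (fun u _ huv => ?_) (by simp)
          by_cases hu : u ∈ s
          · rw [h1 u hu huv, mul_zero]
          · rw [by_contra fun e => hu (hz u e), zero_mul]
        rw [inv_mul_eq_div, le_div_iff₀ h0, hP.cellDist_eq hx hy,
          show |x.1 v - y.1 v| * (P v).im = |(x.1 v - y.1 v) * (P v).im| by
            rw [abs_mul, abs_of_pos h0], sub_mul, ← im x hx, ← im y hy, ← Complex.sub_im, Complex.dist_eq]
        exact Complex.abs_im_le_norm _
      · refine ⟨0, le_rfl, fun _ x hx y hy => ?_⟩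
        have h1 : x.1 v = 0 := by_contra fun e => hv (hx v e)
        have h2 : y.1 v = 0 := by_contra fun e => hv (hy v e)
        simp [h1, h2]
    · exact ⟨0, le_rfl, fun h => absurd h hs⟩
  choose C h0 hC using key
  refine ⟨∑ sv, C sv + 1, by have := Finset.sum_nonneg fun i (_ : i ∈ Finset.univ) => h0 i; linarith,
    fun s hs x hx y hy v => (hC (s, v) hs x hx y hy).trans ?_⟩
  refine mul_le_mul_of_nonneg_right ?_ (cellDist_nonneg x y)
  have := Finset.single_le_sum (fun i _ => h0 i) (Finset.mem_univ (s, v))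
  linarith

/-! ### The intrinsic distance -/

theorem d_nonneg (x y : K.Pt) : 0 ≤ K.d x y := by
  refine Real.sInf_nonneg ?_
  rintro L ⟨k, p, -, rfl⟩
  exact Finset.sum_nonneg fun i _ => cellDist_nonneg _ _

theorem d_le_of_isPath {x y : K.Pt} {k : ℕ} {p : ℕ → K.Pt} (hp : K.IsPath x y k p) :
    K.d x y ≤ ∑ i ∈ Finset.range k, K.cellDist (p i) (p (i + 1)) := by
  refine csInf_le ⟨0, ?_⟩ ⟨k, p, hp, rfl⟩
  rintro L ⟨k, p, -, rfl⟩
  exact Finset.sum_nonneg fun i _ => cellDist_nonneg _ _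

theorem d_le_cellDist {s : Finset V} (hs : K.IsCell s) {x y : K.Pt} (hx : x ∈ K.cell s)
    (hy : y ∈ K.cell s) : K.d x y ≤ K.cellDist x y := by
  have := d_le_of_isPath (x := x) (y := y) (k := 1) (p := fun i => if i = 0 then x else y)
    ⟨by simp, by simp, fun i hi => ⟨s, hs, by simp [Nat.lt_one_iff.1 hi, hx], by simp [hy]⟩⟩
  simpa using this

theorem exists_isPath_lt (hK : K.IsCAT0Complex) {x y : K.Pt} {L : ℝ} (hL : K.d x y < L) :
    ∃ k p, K.IsPath x y k p ∧ ∑ i ∈ Finset.range k, K.cellDist (p i) (p (i + 1)) < L := by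
  obtain ⟨k, p, hp⟩ := hK.1 x y
  have hne : {L | ∃ k p, K.IsPath x y k p ∧
      L = ∑ i ∈ Finset.range k, K.cellDist (p i) (p (i + 1))}.Nonempty := ⟨_, k, p, hp, rfl⟩
  obtain ⟨L', ⟨k, p, hp, rfl⟩, hlt⟩ := exists_lt_of_csInf_lt hne hL
  exact ⟨k, p, hp, hlt⟩

theorem IsPath.trans {x y z : K.Pt} {k l : ℕ} {p q : ℕ → K.Pt} (hp : K.IsPath x y k p)
    (hq : K.IsPath y z l q) : ∃ r, K.IsPath x z (k + l) r ∧
      ∑ i ∈ Finset.range (k + l), K.cellDist (r i) (r (i + 1)) =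
        ∑ i ∈ Finset.range k, K.cellDist (p i) (p (i + 1)) +
        ∑ i ∈ Finset.range l, K.cellDist (q i) (q (i + 1)) := by
  obtain ⟨p0, pk, hp⟩ := hp
  obtain ⟨q0, ql, hq⟩ := hq
  set r : ℕ → K.Pt := fun i => if i ≤ k then p i else q (i - k) with hr
  have r1 : ∀ i ≤ k, r i = p i := fun i hi => by simp [hr, hi]
  have r2 : ∀ i, r (k + i) = q i := by
    intro i
    rcases Nat.eq_zero_or_pos i with rfl | hi
    · rw [add_zero, r1 k le_rfl, pk, q0]
    · simp [hr, hi.ne']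
  refine ⟨r, ⟨by rw [r1 0 (Nat.zero_le _), p0], by rw [r2, ql], fun i hi => ?_⟩, ?_⟩
  · rcases lt_or_ge i k with h | h
    · rw [r1 i h.le, r1 (i + 1) h]; exact hp i h
    · obtain ⟨j, rfl⟩ := Nat.exists_eq_add_of_le h
      rw [add_assoc, r2, r2]; exact hq j (by omega)
  · rw [Finset.sum_range_add]
    congr 1
    · refine Finset.sum_congr rfl fun i hi => ?_
      have := Finset.mem_range.1 hi
      rw [r1 i this.le, r1 (i + 1) this]
    · refine Finset.sum_congr rfl fun i _ => ?_
      rw [add_assoc, r2, r2]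

theorem isCAT0Metric_d (hK : K.IsCAT0Complex) : IsCAT0Metric K.d where
  self x := by
    refine le_antisymm ?_ (d_nonneg x x)
    simpa using d_le_of_isPath (x := x) (y := x) (k := 0) (p := fun _ => x) ⟨rfl, rfl, by simp⟩
  comm x y := by
    obtain ⟨γ, l, h0, h1, h2, h3⟩ := hK.2.1 x y
    have e1 := h3 0 ⟨le_rfl, h0⟩ l ⟨h0, le_rfl⟩
    have e2 := h3 l ⟨h0, le_rfl⟩ 0 ⟨le_rfl, h0⟩
    rw [h1, h2] at e1 e2
    rw [e1, e2, abs_sub_comm]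
  tri x y z := by
    refine le_of_forall_pos_le_add fun ε hε => ?_
    obtain ⟨k, p, hp, lp⟩ := exists_isPath_lt hK (show K.d x y < K.d x y + ε / 2 by linarith)
    obtain ⟨l, q, hq, lq⟩ := exists_isPath_lt hK (show K.d y z < K.d y z + ε / 2 by linarith)
    obtain ⟨r, hr, e⟩ := hp.trans hq
    have := d_le_of_isPath hr
    linarith
  cat0 := hK.2

theorem IsPath.abs_coord_sub_le {C : ℝ} (hC : ∀ s, K.IsCell s → ∀ x ∈ K.cell s, ∀ y ∈ K.cell s, ∀ v,
      |x.1 v - y.1 v| ≤ C * K.cellDist x y) {x y : K.Pt} {k : ℕ} {p : ℕ → K.Pt}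
    (hp : K.IsPath x y k p) (v : V) {i : ℕ} (hi : i ≤ k) :
    |(p i).1 v - x.1 v| ≤ C * ∑ j ∈ Finset.range i, K.cellDist (p j) (p (j + 1)) := by
  induction i with
  | zero => simp [hp.1]
  | succ i ih =>
    obtain ⟨s, hs, h1, h2⟩ := hp.2.2 i hi
    have hstep := hC s hs _ h2 _ h1 v
    rw [cellDist_comm] at hstep
    rw [Finset.sum_range_succ, mul_add]
    have t := abs_sub_le ((p (i + 1)).1 v) ((p i).1 v) (x.1 v)
    have := ih (by omega)
    linarith

theorem sum_cellDist_le {p : ℕ → K.Pt} {i k : ℕ} (hi : i ≤ k) :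
    ∑ j ∈ Finset.range i, K.cellDist (p j) (p (j + 1)) ≤
      ∑ j ∈ Finset.range k, K.cellDist (p j) (p (j + 1)) :=
  Finset.sum_le_sum_of_subset_of_nonneg (Finset.range_mono hi) fun _ _ _ => cellDist_nonneg _ _

theorem abs_coord_sub_le_d (hK : K.IsCAT0Complex) {C : ℝ} (hC0 : 0 < C)
    (hC : ∀ s, K.IsCell s → ∀ x ∈ K.cell s, ∀ y ∈ K.cell s, ∀ v,
      |x.1 v - y.1 v| ≤ C * K.cellDist x y) (x y : K.Pt) (v : V) :
    |x.1 v - y.1 v| ≤ C * K.d x y := by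
  rw [← div_le_iff₀' hC0]
  refine le_of_forall_gt_imp_ge_of_dense fun L hL => ?_
  obtain ⟨k, p, hp, lp⟩ := exists_isPath_lt hK hL
  have := hp.abs_coord_sub_le hC v le_rfl
  rw [hp.2.1, abs_sub_comm] at this
  rw [div_le_iff₀' hC0]
  exact this.trans (mul_le_mul_of_nonneg_left lp.le hC0.le)

end TriComplex

/-! ### Homotheties of the star of a point -/

namespace TriComplex

open MetricGeometry

variable {V : Type*} [Fintype V] [DecidableEq V] {K : TriComplex V}

/-- Short paths that start near `z` stay in the open star of `z`, also after they are stretched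
away from `z` by a moderate factor `t`. -/
theorem exists_star_radius (hK : K.IsCAT0Complex) (z : K.Pt) : ∃ ρ > 0, ∀ a b k p,
    K.IsPath a b k p → ∀ t > 0,
      t * (K.d z a + ∑ i ∈ Finset.range k, K.cellDist (p i) (p (i + 1))) < ρ →
      ∀ i ≤ k, ∀ v, z.1 v ≠ 0 → 0 < z.1 v + t * ((p i).1 v - z.1 v) := by
  obtain ⟨C, hC0, hC⟩ := exists_coord_le_cellDist K
  obtain ⟨δ, hδ, hz⟩ : ∃ δ > 0, ∀ v, z.1 v ≠ 0 → δ ≤ z.1 v := by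
    obtain ⟨w, hw⟩ : ∃ w, z.1 w ≠ 0 := by
      by_contra! h
      have := z.2.2.1
      simp [h] at this
    obtain ⟨u, hu, hmin⟩ := Finset.exists_min_image (Finset.univ.filter fun v => z.1 v ≠ 0)
      (fun v => z.1 v) ⟨w, by simp [hw]⟩
    exact ⟨z.1 u, lt_of_le_of_ne (z.2.1 u) (Ne.symm (Finset.mem_filter.1 hu).2),
      fun v hv => hmin v (by simp [hv])⟩
  refine ⟨δ / C, by positivity, fun a b k p hp t ht hL i hi v hv => ?_⟩
  rw [lt_div_iff₀ hC0] at hL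
  have h1 := abs_coord_sub_le_d hK hC0 hC z a v
  have h2 := hp.abs_coord_sub_le hC v hi
  have h3 := mul_le_mul_of_nonneg_left (sum_cellDist_le (p := p) hi) hC0.le
  have h4 := hz v hv
  have h5 := abs_le.1 h1
  have h6 := abs_le.1 h2
  have : -(C * (K.d z a + ∑ i ∈ Finset.range k, K.cellDist (p i) (p (i + 1)))) ≤
      (p i).1 v - z.1 v := by
    rw [mul_add]; linarith [h5.2, h6.1]
  have := mul_le_mul_of_nonneg_left this ht.le
  linarith

/-- The homothetic image with centre `z` and ratio `t` of a point of the open star of `z`. -/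
theorem exists_homothety {z a : K.Pt} {t : ℝ} (ht : 0 < t) (h1 : ∀ v, z.1 v ≠ 0 → 0 < a.1 v)
    (h2 : ∀ v, z.1 v ≠ 0 → 0 < z.1 v + t * (a.1 v - z.1 v)) :
    ∃ a' : K.Pt, ∀ v, a'.1 v = z.1 v + t * (a.1 v - z.1 v) := by
  obtain ⟨h3, h4, s, hs, h5⟩ := a.2
  refine ⟨⟨fun v => z.1 v + t * (a.1 v - z.1 v), fun v => ?_, ?_, s, hs, fun v hv => ?_⟩,
    fun v => rfl⟩
  · by_cases hv : z.1 v = 0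
    · have := mul_nonneg ht.le (h3 v)
      simpa [hv] using this
    · exact (h2 v hv).le
  · rw [Finset.sum_add_distrib, ← Finset.mul_sum, Finset.sum_sub_distrib, z.2.2.1, h4]; ring
  · by_cases hz : z.1 v = 0
    · refine h5 v fun ha => hv ?_
      simp [hz, ha]
    · exact h5 v (h1 v hz).ne'

theorem mem_cell_of_star {z a : K.Pt} (h : ∀ v, z.1 v ≠ 0 → 0 < a.1 v) {s : Finset V}
    (ha : a ∈ K.cell s) : z ∈ K.cell s := fun v hv => ha v (h v hv).ne'

theorem mem_cell_of_homothety {z a a' : K.Pt} {t : ℝ}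
    (ha' : ∀ v, a'.1 v = z.1 v + t * (a.1 v - z.1 v)) {s : Finset V} (ha : a ∈ K.cell s)
    (hz : z ∈ K.cell s) : a' ∈ K.cell s := by
  intro v hv
  by_contra hvs
  have h1 : a.1 v = 0 := by_contra fun e => hvs (ha v e)
  have h2 : z.1 v = 0 := by_contra fun e => hvs (hz v e)
  rw [ha', h1, h2] at hv
  simp at hv

theorem cellDist_homothety {z a b a' b' : K.Pt} {t : ℝ} (ht : 0 ≤ t)
    (ha' : ∀ v, a'.1 v = z.1 v + t * (a.1 v - z.1 v))
    (hb' : ∀ v, b'.1 v = z.1 v + t * (b.1 v - z.1 v)) :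
    K.cellDist a' b' = t * K.cellDist a b := by
  unfold cellDist
  rw [← Real.sqrt_sq ht, ← Real.sqrt_mul (sq_nonneg t)]
  congr 1
  have : ∑ u, ∑ v, (a'.1 u - b'.1 u) * (a'.1 v - b'.1 v) * K.len u v ^ 2 =
      t ^ 2 * ∑ u, ∑ v, (a.1 u - b.1 u) * (a.1 v - b.1 v) * K.len u v ^ 2 := by
    rw [Finset.mul_sum]
    refine Finset.sum_congr rfl fun u _ => ?_
    rw [Finset.mul_sum]
    refine Finset.sum_congr rfl fun v _ => ?_
    rw [ha', hb', ha', hb']; ring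
  rw [this]; ring

theorem d_le_of_homothety_path {z a b a' b' : K.Pt} {t : ℝ} (ht : 0 < t) {k : ℕ} {p : ℕ → K.Pt}
    (hp : K.IsPath a b k p) (h1 : ∀ i ≤ k, ∀ v, z.1 v ≠ 0 → 0 < (p i).1 v)
    (h2 : ∀ i ≤ k, ∀ v, z.1 v ≠ 0 → 0 < z.1 v + t * ((p i).1 v - z.1 v))
    (ha' : ∀ v, a'.1 v = z.1 v + t * (a.1 v - z.1 v))
    (hb' : ∀ v, b'.1 v = z.1 v + t * (b.1 v - z.1 v)) :
    K.d a' b' ≤ t * ∑ i ∈ Finset.range k, K.cellDist (p i) (p (i + 1)) := by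
  have hex : ∀ i, ∃ q : K.Pt, i ≤ k → ∀ v, q.1 v = z.1 v + t * ((p i).1 v - z.1 v) := by
    intro i
    by_cases hi : i ≤ k
    · obtain ⟨q, hq⟩ := exists_homothety ht (h1 i hi) (h2 i hi)
      exact ⟨q, fun _ => hq⟩
    · exact ⟨z, fun h => absurd h hi⟩
  choose q hq using hex
  have hpath : K.IsPath a' b' k q := by
    refine ⟨Subtype.ext (funext fun v => ?_), Subtype.ext (funext fun v => ?_), fun i hi => ?_⟩
    · rw [hq 0 (Nat.zero_le _), hp.1, ha']
    · rw [hq k le_rfl, hp.2.1, hb']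
    · obtain ⟨s, hs, m1, m2⟩ := hp.2.2 i hi
      have hz := mem_cell_of_star (h1 i hi.le) m1
      exact ⟨s, hs, mem_cell_of_homothety (hq i hi.le) m1 hz,
        mem_cell_of_homothety (hq (i + 1) hi) m2 hz⟩
  refine (d_le_of_isPath hpath).trans (le_of_eq ?_)
  rw [Finset.mul_sum]
  refine Finset.sum_congr rfl fun i hi => ?_
  have hi := Finset.mem_range.1 hi
  exact cellDist_homothety ht.le (hq i hi.le) (hq (i + 1) hi)

omit [Fintype V] in
theorem IsCell.nonempty {s : Finset V} (hs : K.IsCell s) : s.Nonempty := by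
  rcases hs with ⟨v, rfl⟩ | ⟨u, v, -, rfl⟩ | hf
  · exact ⟨v, by simp⟩
  · exact ⟨v, by simp⟩
  · rw [← Finset.card_pos, (K.isNClique_of_mem_faces s hf).card_eq]; norm_num

/-- Every point has a neighbourhood which is a Euclidean cone. -/
theorem exists_conical (hK : K.IsCAT0Complex) (z : K.Pt) :
    ∃ R > 0, ∀ t ∈ Set.Ioc (0 : ℝ) 1, ∀ a b a' b', K.d z a < R → K.d z b < R →
    a' ∈ seg K.d z a → K.d z a' = t * K.d z a → b' ∈ seg K.d z b → K.d z b' = t * K.d z b →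
    K.d a' b' = t * K.d a b := by
  have hd := isCAT0Metric_d hK
  obtain ⟨ρ, hρ, H⟩ := exists_star_radius hK z
  -- homotheties with centre `z` multiply distances by at most their ratio
  have scale : ∀ a b a' b' : K.Pt, ∀ t > 0, K.d z a + K.d a b < ρ →
      t * (K.d z a + K.d a b) < ρ → (∀ v, a'.1 v = z.1 v + t * (a.1 v - z.1 v)) →
      (∀ v, b'.1 v = z.1 v + t * (b.1 v - z.1 v)) → K.d a' b' ≤ t * K.d a b := by
    intro a b a' b' t ht l1 l2 ha' hb'
    rw [← div_le_iff₀' ht]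
    refine le_of_forall_gt_imp_ge_of_dense fun L hL => ?_
    have l2' : K.d z a + K.d a b < ρ / t := by rw [lt_div_iff₀' ht]; exact l2
    obtain ⟨k, p, hp, lp⟩ := exists_isPath_lt hK
      (show K.d a b < min L (min (ρ - K.d z a) (ρ / t - K.d z a)) from
        lt_min hL (lt_min (by linarith) (by linarith)))
    have b1 := lp.trans_le ((min_le_right _ _).trans (min_le_left _ _))
    have b2 := lp.trans_le ((min_le_right _ _).trans (min_le_right _ _))
    have b2' : t * (K.d z a + ∑ i ∈ Finset.range k, K.cellDist (p i) (p (i + 1))) < ρ := by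
      rw [← lt_div_iff₀' ht]; linarith
    have h1 := H a b k p hp 1 one_pos (by linarith)
    have := d_le_of_homothety_path ht hp (fun i hi v hv => by simpa using h1 i hi v hv)
      (H a b k p hp t ht b2') ha' hb'
    rw [div_le_iff₀' ht]
    exact this.trans (mul_le_mul_of_nonneg_left (lp.le.trans (min_le_left _ _)) ht.le)
  have star : ∀ a, K.d z a < ρ → ∀ v, z.1 v ≠ 0 → 0 < a.1 v := by
    intro a ha v hv
    obtain ⟨k, p, hp, lp⟩ := exists_isPath_lt hK ha
    have := H z a k p hp 1 one_pos (by rw [hd.self]; linarith) k le_rfl v hv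
    rw [hp.2.1] at this
    linarith
  have radial : ∀ a, K.d z a < ρ → K.cellDist z a ≤ K.d z a := by
    intro a ha
    refine le_of_forall_gt_imp_ge_of_dense fun L hL => ?_
    obtain ⟨k, p, hp, lp⟩ := exists_isPath_lt hK (show K.d z a < min L ρ from lt_min hL ha)
    have hst := H z a k p hp 1 one_pos (by rw [hd.self]; linarith [lp.trans_le (min_le_right _ _)])
    have key : ∀ i ≤ k, K.cellDist z (p i) ≤
        ∑ j ∈ Finset.range i, K.cellDist (p j) (p (j + 1)) := by
      intro i
      induction i with
      | zero => intro _; rw [hp.1]; simp [cellDist]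
      | succ i ih =>
        intro hi
        obtain ⟨s, hs, m1, m2⟩ := hp.2.2 i hi
        have mz := mem_cell_of_star (fun v hv => by simpa using hst i (by omega) v hv) m1
        obtain ⟨v, hv⟩ := hs.nonempty
        obtain ⟨P, hP, -⟩ := exists_placement hs hv
        have h1 := ih (by omega)
        rw [Finset.sum_range_succ]
        rw [hP.cellDist_eq mz m1] at h1
        rw [hP.cellDist_eq mz m2, hP.cellDist_eq m1 m2]
        have := dist_triangle (develop P z) (develop P (p i)) (develop P (p (i + 1)))
        linarith
    have := key k le_rfl
    rw [hp.2.1] at this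
    exact this.trans (lp.le.trans (min_le_left _ _))
  have hom : ∀ t ∈ Set.Ioc (0 : ℝ) 1, ∀ a a', K.d z a < ρ / 8 → a' ∈ seg K.d z a →
      K.d z a' = t * K.d z a → ∀ v, a'.1 v = z.1 v + t * (a.1 v - z.1 v) := by
    rintro t ⟨t0, t1⟩ a a' ha ha' ea'
    have sa := star a (by linarith)
    obtain ⟨c, hc⟩ := exists_homothety (z := z) (a := a) t0 sa (fun v hv => by
      have h1 := sa v hv
      have h2 := lt_of_le_of_ne (z.2.1 v) (Ne.symm hv)
      nlinarith)
    have hz : ∀ v, z.1 v = z.1 v + t * (z.1 v - z.1 v) := fun v => by ring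
    have hz' : ∀ v, z.1 v = z.1 v + t⁻¹ * (z.1 v - z.1 v) := fun v => by ring
    have hc' : ∀ v, a.1 v = z.1 v + t⁻¹ * (c.1 v - z.1 v) := fun v => by
      rw [hc]; field_simp; ring
    have n := hd.nonneg z a
    have c1 : K.d z c ≤ t * K.d z a :=
      scale z a z c t t0 (by rw [hd.self]; linarith) (by rw [hd.self]; nlinarith) hz hc
    have c2 : K.d z a ≤ t⁻¹ * K.d z c := by
      refine scale z c z a t⁻¹ (by positivity) (by rw [hd.self]; nlinarith) ?_ hz' hc'
      rw [hd.self, zero_add, inv_mul_lt_iff₀ t0]; nlinarith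
    have c3 : K.d z c = t * K.d z a := by
      refine le_antisymm c1 ?_
      rwa [le_inv_mul_iff₀ t0] at c2
    obtain ⟨s, hs, hsa⟩ := a.2.2.2
    have ma : a ∈ K.cell s := hsa
    have mz := mem_cell_of_star sa ma
    have mc := mem_cell_of_homothety hc ma mz
    have c4 : K.cellDist c a = (1 - t) * K.cellDist z a := by
      have e1 : ∀ v, c.1 v = a.1 v + (1 - t) * (z.1 v - a.1 v) := fun v => by rw [hc]; ring
      have e2 : ∀ v, a.1 v = a.1 v + (1 - t) * (a.1 v - a.1 v) := fun v => by ring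
      exact cellDist_homothety (by linarith) e1 e2
    have c5 := d_le_cellDist hs mc ma
    have c6 := mul_le_mul_of_nonneg_left (radial a (by linarith)) (sub_nonneg.2 t1)
    have c7 := hd.tri z c a
    have mem : c ∈ seg K.d z a := by
      change K.d z c + K.d c a = K.d z a
      linarith
    rw [hd.eq_of_mem_seg ha' mem (ea'.trans c3.symm)]
    exact hc
  refine ⟨ρ / 8, by positivity, fun t ht a b a' b' la lb ha' ea' hb' eb' => ?_⟩
  have h1 := hom t ht a a' la ha' ea'
  have h2 := hom t ht b b' lb hb' eb'
  obtain ⟨t0, t1⟩ := ht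
  have i1 : ∀ v, a.1 v = z.1 v + t⁻¹ * (a'.1 v - z.1 v) := fun v => by
    rw [h1]; field_simp; ring
  have i2 : ∀ v, b.1 v = z.1 v + t⁻¹ * (b'.1 v - z.1 v) := fun v => by
    rw [h2]; field_simp; ring
  have n1 := hd.nonneg z a
  have n2 := hd.nonneg z b
  have n3 := hd.nonneg z a'
  have n4 := hd.nonneg a' b'
  have tr := hd.tri a z b
  rw [hd.comm a z] at tr
  have tr' := hd.tri a' z b'
  rw [hd.comm a' z, ea', eb'] at tr'
  have s1 := scale a b a' b' t t0 (by linarith) (by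
    have := hd.nonneg a b
    nlinarith) h1 h2
  have key : K.d z a' + K.d a' b' ≤ t * (3 * (ρ / 8)) := by
    rw [ea']; nlinarith
  have s2 := scale a' b' a b t⁻¹ (by positivity) (by nlinarith) (by
    rw [inv_mul_lt_iff₀ t0]; nlinarith) i1 i2
  refine le_antisymm s1 ?_
  rwa [le_inv_mul_iff₀ t0] at s2

end TriComplex

/-! ### Edges of a planar complex -/

namespace TriComplex

open MetricGeometry

/-- A polygonal set looks like a straight line near one of its points, and this point can be
chosen outside a closed set that has only finitely many points in common with it. -/
theorem exists_locally_line
    {F : Finset (EuclideanSpace ℝ (Fin 2) × EuclideanSpace ℝ (Fin 2))}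
    {E W N : Set (EuclideanSpace ℝ (Fin 2))} (hE : E = ⋃ s ∈ F, segment ℝ s.1 s.2)
    (hinf : E.Infinite) (hW : IsClosed W) (hN : N.Finite) (hWN : W ∩ E ⊆ N) :
    ∃ g ∈ E, ∃ r > 0, ∃ a b c : ℝ, ∀ y ∈ Metric.ball g r,
      (y ∈ E ∪ W ↔ a * y 0 + b * y 1 + c = 0) := by
  classical
  obtain ⟨⟨A, B⟩, hAB, hne⟩ : ∃ s ∈ F, s.1 ≠ s.2 := by
    by_contra! hall
    refine hinf ((F.finite_toSet.image Prod.fst).subset ?_)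
    intro y hy
    rw [hE] at hy
    simp only [Set.mem_iUnion] at hy
    obtain ⟨s, hs, hy⟩ := hy
    rw [hall s hs, segment_same] at hy
    exact ⟨s, hs, by rw [hall s hs]; exact hy.symm⟩
  simp only at hne
  set a := -(B 1 - A 1) with ha
  set b := B 0 - A 0 with hb
  set c := -(a * A 0 + b * A 1) with hc
  set L : EuclideanSpace ℝ (Fin 2) → ℝ := fun y => a * y 0 + b * y 1 + c with hL
  have Laff : ∀ (P Q : EuclideanSpace ℝ (Fin 2)) (s t : ℝ), s + t = 1 →
      L (s • P + t • Q) = s * L P + t * L Q := by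
    intro P Q s t hst
    simp only [hL, PiLp.add_apply, PiLp.smul_apply, smul_eq_mul]
    linear_combination -c * hst
  have LA : L A = 0 := by simp only [hL, hc]; ring
  have LB : L B = 0 := by simp only [hL, hc, ha, hb]; ring
  have hline : ∀ y, L y = 0 → ∃ t : ℝ, y = (1 - t) • A + t • B := by
    intro y hy
    simp only [hL, hc, ha, hb] at hy
    by_cases h0 : B 0 - A 0 = 0
    · have h1 : B 1 - A 1 ≠ 0 := by
        intro h1
        refine hne (PiLp.ext fun i => ?_)
        fin_cases i
        · exact (sub_eq_zero.1 h0).symm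
        · exact (sub_eq_zero.1 h1).symm
      refine ⟨(y 1 - A 1) / (B 1 - A 1), PiLp.ext fun i => ?_⟩
      fin_cases i
      · simp only [Fin.zero_eta, PiLp.add_apply, PiLp.smul_apply, smul_eq_mul]
        have : y 0 = A 0 := by
          have : (B 1 - A 1) * (y 0 - A 0) = 0 := by rw [h0] at hy; linarith
          linarith [(mul_eq_zero.1 this).resolve_left h1]
        rw [show B 0 = A 0 by linarith, this]; ring
      · simp only [Fin.mk_one, PiLp.add_apply, PiLp.smul_apply, smul_eq_mul]
        field_simp; ring
    · refine ⟨(y 0 - A 0) / (B 0 - A 0), PiLp.ext fun i => ?_⟩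
      fin_cases i
      · simp only [Fin.zero_eta, PiLp.add_apply, PiLp.smul_apply, smul_eq_mul]
        field_simp; ring
      · simp only [Fin.mk_one, PiLp.add_apply, PiLp.smul_apply, smul_eq_mul]
        field_simp
        linarith
  -- the segments that do not lie on the line through `A` and `B`
  set G := F.filter fun s => ¬ (L s.1 = 0 ∧ L s.2 = 0) with hG
  have hGfin : ∀ s ∈ G, (segment ℝ s.1 s.2 ∩ {y | L y = 0}).Finite := by
    intro s hs
    refine Set.Subsingleton.finite ?_
    rintro y ⟨⟨p, q, hp, hq, hpq, rfl⟩, hy⟩ y' ⟨⟨p', q', hp', hq', hpq', rfl⟩, hy'⟩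
    simp only [Set.mem_ofPred_eq] at hy hy'
    rw [Laff _ _ _ _ hpq] at hy
    rw [Laff _ _ _ _ hpq'] at hy'
    have h1 : p = 1 - q := by linarith
    have h2 : p' = 1 - q' := by linarith
    subst h1 h2
    have h3 : (q - q') * (L s.2 - L s.1) = 0 := by linarith
    rcases mul_eq_zero.1 h3 with h4 | h4
    · rw [show q = q' by linarith]
    · refine absurd ⟨?_, ?_⟩ (Finset.mem_filter.1 hs).2
      · rw [show L s.2 = L s.1 by linarith] at hy; linarith
      · rw [show L s.1 = L s.2 by linarith] at hy; linarith
  set M : Set (EuclideanSpace ℝ (Fin 2)) :=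
    N ∪ ⋃ s ∈ G, (segment ℝ s.1 s.2 ∩ {y | L y = 0}) with hM
  have hMfin : M.Finite := hN.union (G.finite_toSet.biUnion hGfin)
  have hinj : Set.InjOn (fun t : ℝ => (1 - t) • A + t • B) (Set.Ioo 0 1) := by
    intro t _ t' _ e
    have e' : (t - t') • (B - A) = 0 := by
      have := sub_eq_zero.2 e
      simp only at this
      rw [← this]; module
    rcases smul_eq_zero.1 e' with h | h
    · linarith
    · exact absurd (sub_eq_zero.1 h).symm hne
  obtain ⟨t, ht, htM⟩ : ∃ t ∈ Set.Ioo (0 : ℝ) 1, (1 - t) • A + t • B ∉ M := by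
    by_contra! hall
    exact (Set.Ioo_infinite (zero_lt_one' ℝ)) (Set.Finite.of_finite_image
      (hMfin.subset (by rintro _ ⟨t, ht, rfl⟩; exact hall t ht)) hinj)
  set g := (1 - t) • A + t • B with hg
  have hLg : L g = 0 := by rw [hg, Laff _ _ _ _ (by ring), LA, LB]; ring
  have hABE : segment ℝ A B ⊆ E := by
    rw [hE]; exact Set.subset_biUnion_of_mem (u := fun s => segment ℝ s.1 s.2) hAB
  have hgE : g ∈ E := hABE ⟨1 - t, t, by linarith [ht.2], ht.1.le, by ring, rfl⟩
  have hclosed : IsClosed (W ∪ ⋃ s ∈ G, segment ℝ s.1 s.2) := by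
    refine hW.union (Set.Finite.isClosed_biUnion G.finite_toSet fun s _ => ?_)
    rw [segment_eq_image_lineMap]
    exact (isCompact_Icc.image (AffineMap.lineMap_continuous)).isClosed
  have hgn : g ∉ W ∪ ⋃ s ∈ G, segment ℝ s.1 s.2 := by
    rintro (h1 | h1)
    · exact htM (Or.inl (hWN ⟨h1, hgE⟩))
    · simp only [Set.mem_iUnion] at h1
      obtain ⟨s, hs, h1⟩ := h1
      refine htM (Or.inr ?_)
      simp only [Set.mem_iUnion]
      exact ⟨s, hs, h1, hLg⟩
  obtain ⟨r, hr, hball⟩ := Metric.isOpen_iff.1 hclosed.isOpen_compl g hgn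
  have hdAB : 0 < dist A B := dist_pos.2 hne
  refine ⟨g, hgE, min r (min t (1 - t) * dist A B), lt_min hr
    (mul_pos (lt_min ht.1 (by linarith [ht.2])) hdAB), a, b, c, fun y hy => ⟨fun h => ?_, fun h => ?_⟩⟩
  · have hy1 := hball (Metric.ball_subset_ball (min_le_left _ _) hy)
    rcases h with h | h
    · rw [hE] at h
      simp only [Set.mem_iUnion] at h
      obtain ⟨s, hs, h⟩ := h
      have : L s.1 = 0 ∧ L s.2 = 0 := by
        by_contra hn
        refine hy1 (Or.inr ?_)
        simp only [Set.mem_iUnion]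
        exact ⟨s, Finset.mem_filter.2 ⟨hs, hn⟩, h⟩
      obtain ⟨p, q, hp, hq, hpq, rfl⟩ := h
      change L _ = 0
      rw [Laff _ _ _ _ hpq, this.1, this.2]; ring
    · exact absurd (Or.inl h) hy1
  · obtain ⟨τ, rfl⟩ := hline y h
    have hy2 := Metric.ball_subset_ball (min_le_right _ _) hy
    rw [Metric.mem_ball, dist_eq_norm, hg, show (1 - τ) • A + τ • B - ((1 - t) • A + t • B) =
      (t - τ) • (A - B) by module, norm_smul, Real.norm_eq_abs, ← dist_eq_norm A B] at hy2
    have h3 := abs_lt.1 (lt_of_mul_lt_mul_right hy2 hdAB.le)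
    have h4 := min_le_left t (1 - t)
    have h5 := min_le_right t (1 - t)
    exact Or.inl (hABE ⟨1 - τ, τ, by linarith [h3.1], by linarith [h3.2], by ring, rfl⟩)

variable {V : Type*} [Fintype V] [DecidableEq V] {K : TriComplex V}

theorem exists_edge_point {u v : V} (huv : K.graph.Adj u v) {t : ℝ} (h0 : 0 ≤ t) (h1 : t ≤ 1) :
    ∃ m : K.Pt, m.1 u = 1 - t ∧ m.1 v = t ∧ m ∈ K.cell {u, v} := by
  have hne := huv.ne
  have hmem : ∀ w, (Pi.single u (1 - t) + Pi.single v t : V → ℝ) w ≠ 0 → w ∈ ({u, v} : Finset V) := by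
    intro w hw
    by_contra hc
    simp only [Finset.mem_insert, Finset.mem_singleton, not_or] at hc
    simp [hc.1, hc.2] at hw
  refine ⟨⟨Pi.single u (1 - t) + Pi.single v t, fun w => ?_, ?_, {u, v},
    Or.inr (Or.inl ⟨u, v, huv, rfl⟩), hmem⟩, ?_, ?_, fun w hw => hmem w hw⟩
  · by_cases hu : w = u
    · subst hu; simp [hne, h1]
    · by_cases hv : w = v
      · subst hv; simp [hne.symm, h0]
      · simp [hu, hv]
  · simp [Finset.sum_add_distrib]
  · simp [hne]
  · simp [hne.symm]

theorem isCompact_cell {s : Finset V} (hs : K.IsCell s) : IsCompact (K.cell s) := by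
  rw [Subtype.isCompact_iff]
  have : ((↑) '' K.cell s : Set (V → ℝ)) = stdSimplex ℝ V ∩ {w | ∀ v, v ∉ s → w v = 0} := by
    ext w
    constructor
    · rintro ⟨x, hx, rfl⟩
      exact ⟨⟨x.2.1, x.2.2.1⟩, fun v hv => by_contra fun e => hv (hx v e)⟩
    · rintro ⟨⟨h1, h2⟩, h3⟩
      have h4 : ∀ v, w v ≠ 0 → v ∈ s := fun v hv => by_contra fun e => hv (h3 v e)
      exact ⟨⟨w, h1, h2, s, hs, h4⟩, h4, rfl⟩
  rw [this]
  refine (isCompact_stdSimplex ℝ V).inter_right ?_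
  rw [show {w : V → ℝ | ∀ v, v ∉ s → w v = 0} = ⋂ v, ⋂ (_ : v ∉ s), {w | w v = 0} by ext; simp]
  exact isClosed_iInter fun v => isClosed_iInter fun _ =>
    isClosed_eq (continuous_apply v) continuous_const

theorem faceBoundary_subset_skeleton {f : Finset V} (hf : f ∈ K.faces) :
    K.faceBoundary f ⊆ K.skeleton := by
  rintro x ⟨hx, v, hv, hv0⟩
  obtain ⟨a, b, hab, -, -, rfl⟩ := exists_face_eq hf hv
  refine Or.inr ⟨a, b, hab, fun w hw => ?_⟩
  have := hx w hw
  simp only [Finset.mem_insert, Finset.mem_singleton] at this ⊢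
  rcases this with h | h | rfl
  · exact Or.inl h
  · exact Or.inr h
  · exact absurd hv0 hw

theorem vert_mem_cell {v : V} {s : Finset V} : K.vert v ∈ K.cell s ↔ v ∈ s := by
  constructor
  · intro h; exact h v (by simp [vert])
  · intro h w hw
    by_cases e : w = v
    · exact e ▸ h
    · simp [vert, e] at hw

theorem eq_vert {x : K.Pt} {v : V} (hx : x ∈ K.cell {v}) : x = K.vert v := by
  have h0 : ∀ w, w ≠ v → x.1 w = 0 := fun w hw =>
    by_contra fun e => hw (Finset.mem_singleton.1 (hx w e))
  have h1 : x.1 v = 1 := by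
    exact (Finset.sum_eq_single v (fun w _ hw => h0 w hw) (by simp)).symm.trans x.2.2.1
  refine Subtype.ext (funext fun w => ?_)
  by_cases hw : w = v
  · subst hw; simp [vert, h1]
  · simp [vert, hw, h0 w hw]

/-- In a planar complex every edge lies in at most two 2-cells: near a suitable point of the drawn
edge the complement of the drawing consists of two half-discs only. -/
theorem exists_eq_of_three_faces (hK : K.IsPlanar) {u v : V} (huv : K.graph.Adj u v)
    (f : Fin 3 → Finset V) (hf : ∀ i, f i ∈ K.faces) (hsub : ∀ i, {u, v} ⊆ f i) :
    ∃ i j, i ≠ j ∧ f i = f j := by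
  obtain ⟨-, φ, ⟨hcont, hinj, hpoly⟩, hface, -⟩ := hK
  have hcell : K.cell {u, v} ⊆ K.skeleton := fun x hx => Or.inr ⟨u, v, huv, hx⟩
  obtain ⟨F, hF⟩ := hpoly u v huv
  set E := φ '' K.cell {u, v} with hE
  set T : Set (Finset V) := {s | ((∃ w, s = {w}) ∨ ∃ a b, K.graph.Adj a b ∧ s = {a, b}) ∧
    s ≠ {u, v}} with hT
  have hTskel : ∀ s ∈ T, K.cell s ⊆ K.skeleton := by
    rintro s ⟨⟨w, rfl⟩ | ⟨a, b, hab, rfl⟩, -⟩ x hx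
    · exact Or.inl ⟨w, hx⟩
    · exact Or.inr ⟨a, b, hab, hx⟩
  have hTcell : ∀ s ∈ T, K.IsCell s := by
    rintro s ⟨⟨w, rfl⟩ | ⟨a, b, hab, rfl⟩, -⟩
    · exact Or.inl ⟨w, rfl⟩
    · exact Or.inr (Or.inl ⟨a, b, hab, rfl⟩)
  set W := ⋃ s ∈ T, φ '' K.cell s with hW
  have hWcl : IsClosed W := by
    refine Set.Finite.isClosed_biUnion (Set.toFinite T) fun s hs => ?_
    exact ((isCompact_cell (hTcell s hs)).image_of_continuousOn
      (hcont.mono (hTskel s hs))).isClosed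
  have hEW : φ '' K.skeleton = E ∪ W := by
    apply Set.Subset.antisymm
    · rintro _ ⟨x, hx, rfl⟩
      have : ∃ s, ((∃ w, s = {w}) ∨ ∃ a b, K.graph.Adj a b ∧ s = {a, b}) ∧ x ∈ K.cell s := by
        rcases hx with ⟨w, hx⟩ | ⟨a, b, hab, hx⟩
        · exact ⟨_, Or.inl ⟨w, rfl⟩, hx⟩
        · exact ⟨_, Or.inr ⟨a, b, hab, rfl⟩, hx⟩
      obtain ⟨s, hs, hx⟩ := this
      by_cases e : s = {u, v}
      · exact Or.inl ⟨x, e ▸ hx, rfl⟩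
      · exact Or.inr (Set.mem_biUnion (show s ∈ T from ⟨hs, e⟩) ⟨x, hx, rfl⟩)
    · refine Set.union_subset (Set.image_mono hcell) (Set.iUnion₂_subset fun s hs => ?_)
      exact Set.image_mono (hTskel s hs)
  have hWN : W ∩ E ⊆ φ '' Set.range K.vert := by
    rintro y ⟨hyW, x, hx, rfl⟩
    simp only [hW, Set.mem_iUnion] at hyW
    obtain ⟨s, hs, x', hx', e⟩ := hyW
    obtain rfl := hinj (hTskel s hs hx') (hcell hx) e
    have hnsub : ¬ {u, v} ⊆ s := by
      intro hsub
      have h2 : ({u, v} : Finset V).card = 2 := Finset.card_pair huv.ne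
      rcases hs.1 with ⟨w, rfl⟩ | ⟨a, b, hab, rfl⟩
      · have := Finset.card_le_card hsub
        rw [h2, Finset.card_singleton] at this
        omega
      · exact hs.2 (Finset.eq_of_subset_of_card_le hsub
          (by rw [h2, Finset.card_pair hab.ne])).symm
    have : x' ∈ K.cell {u} ∨ x' ∈ K.cell {v} := by
      by_cases hu : u ∈ s
      · have hv : v ∉ s := fun hv => hnsub (by simp [Finset.insert_subset_iff, hu, hv])
        refine Or.inl fun w hw => ?_
        have := hx w hw
        simp only [Finset.mem_insert, Finset.mem_singleton] at this ⊢
        exact this.resolve_right fun e => hv (e ▸ hx' w hw)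
      · refine Or.inr fun w hw => ?_
        have := hx w hw
        simp only [Finset.mem_insert, Finset.mem_singleton] at this ⊢
        exact this.resolve_left fun e => hu (e ▸ hx' w hw)
    rcases this with h | h
    · exact ⟨x', ⟨u, (eq_vert h).symm⟩, rfl⟩
    · exact ⟨x', ⟨v, (eq_vert h).symm⟩, rfl⟩
  have hEinf : E.Infinite := by
    refine Set.Infinite.image (hinj.mono hcell) ?_
    have : Nonempty K.Pt := ⟨K.vert u⟩
    choose! m _ m2 m3 using fun t (ht : t ∈ Set.Icc (0 : ℝ) 1) =>
      exists_edge_point huv ht.1 ht.2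
    refine Set.infinite_of_injOn_mapsTo (f := m) ?_ m3 (Set.Icc_infinite (zero_lt_one' ℝ))
    intro t ht t' ht' e
    rw [← m2 t ht, ← m2 t' ht', e]
  obtain ⟨g, hgE, r, hr, a, b, c, hloc⟩ := exists_locally_line hF hEinf hWcl
    ((Set.finite_range K.vert).image φ) hWN
  rw [← hEW] at hloc
  choose D hD hfront using fun i => hface (f i) (hf i)
  have hEb : ∀ i, K.cell {u, v} ⊆ K.faceBoundary (f i) := by
    intro i x hx
    refine ⟨fun w hw => hsub i (hx w hw), ?_⟩
    obtain ⟨w, hw, hwn⟩ := Finset.exists_mem_notMem_of_card_lt_card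
      (s := {u, v}) (t := f i) (by
        rw [Finset.card_pair huv.ne, (K.isNClique_of_mem_faces _ (hf i)).card_eq]; norm_num)
    exact ⟨w, hw, by_contra fun e => hwn (hx w e)⟩
  have hy : ∀ i, ∃ y, y ∈ Metric.ball g r ∧ y ∈ D i := by
    intro i
    have : g ∈ closure (D i) := by
      refine frontier_subset_closure ?_
      rw [hfront]
      exact Set.image_mono (hEb i) hgE
    exact mem_closure_iff.1 this _ Metric.isOpen_ball (Metric.mem_ball_self hr)
  choose y hyb hyD using hy
  have hcomp : ∀ i, y i ∈ (φ '' K.skeleton)ᶜ ∧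
      D i = connectedComponentIn (φ '' K.skeleton)ᶜ (y i) := by
    intro i
    obtain ⟨-, x, hx, e⟩ := hD i
    have := hyD i
    rw [e] at this
    exact ⟨connectedComponentIn_subset _ _ this, e.trans (connectedComponentIn_eq this)⟩
  have hlin : IsLinearMap ℝ fun y : EuclideanSpace ℝ (Fin 2) => a * y 0 + b * y 1 := by
    constructor
    · intro p q; simp only [PiLp.add_apply]; ring
    · intro s p; simp only [PiLp.smul_apply, smul_eq_mul]; ring
  have hside : ∀ i j, ∀ H : Set (EuclideanSpace ℝ (Fin 2)), Convex ℝ H → H ⊆ Metric.ball g r →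
      (∀ y ∈ H, a * y 0 + b * y 1 + c ≠ 0) → y i ∈ H → y j ∈ H → D i = D j := by
    intro i j H hH hHb hH0 hi hj
    rw [(hcomp i).2, (hcomp j).2]
    refine connectedComponentIn_eq ?_
    have hsub : H ⊆ (φ '' K.skeleton)ᶜ := fun z hz hzs => hH0 z hz ((hloc z (hHb hz)).1 hzs)
    exact hH.isPreconnected.subset_connectedComponentIn hi hsub hj
  have hDf : ∀ i j, D i = D j → f i ⊆ f j := by
    intro i j e w hw
    have h1 := hfront i
    rw [e, hfront j] at h1
    have hwb : K.vert w ∈ K.faceBoundary (f i) := by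
      obtain ⟨a, b, -, haw, -, e⟩ := exists_face_eq (hf i) hw
      refine ⟨vert_mem_cell.2 hw, a, by rw [e]; simp, ?_⟩
      simp [vert, haw.ne]
    have h2 : φ (K.vert w) ∈ φ '' K.faceBoundary (f j) := by rw [h1]; exact ⟨_, hwb, rfl⟩
    obtain ⟨x, hx, e'⟩ := h2
    have := hinj (faceBoundary_subset_skeleton (hf j) hx)
      (faceBoundary_subset_skeleton (hf i) hwb) e'
    exact vert_mem_cell.1 (this ▸ hx.1)
  have hn0 : ∀ i, a * y i 0 + b * y i 1 + c ≠ 0 := fun i e =>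
    (hcomp i).1 ((hloc _ (hyb i)).2 e)
  have hpos : Convex ℝ (Metric.ball g r ∩ {y | -c < a * y 0 + b * y 1}) :=
    (convex_ball g r).inter (convex_halfSpace_gt hlin _)
  have hneg : Convex ℝ (Metric.ball g r ∩ {y | a * y 0 + b * y 1 < -c}) :=
    (convex_ball g r).inter (convex_halfSpace_lt hlin _)
  obtain ⟨i, j, hij, hs⟩ : ∃ i j, i ≠ j ∧
      ((0 < a * y i 0 + b * y i 1 + c) ↔ (0 < a * y j 0 + b * y j 1 + c)) := by
    obtain ⟨i, j, hij, e⟩ := Fintype.exists_ne_map_eq_of_card_lt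
      (fun i : Fin 3 => decide (0 < a * y i 0 + b * y i 1 + c)) (by simp)
    exact ⟨i, j, hij, by simpa using e⟩
  have hDij : D i = D j := by
    by_cases hi : 0 < a * y i 0 + b * y i 1 + c
    · have hj := hs.1 hi
      refine hside i j _ hpos Set.inter_subset_left (fun z hz e => ?_) ⟨hyb i, ?_⟩ ⟨hyb j, ?_⟩
      · have := hz.2; simp only [Set.mem_ofPred_eq] at this; linarith
      · simp only [Set.mem_ofPred_eq]; linarith
      · simp only [Set.mem_ofPred_eq]; linarith
    · have hj := mt hs.2 hi
      have hi' := lt_of_le_of_ne (not_lt.1 hi) (hn0 i)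
      have hj' := lt_of_le_of_ne (not_lt.1 hj) (hn0 j)
      refine hside i j _ hneg Set.inter_subset_left (fun z hz e => ?_) ⟨hyb i, ?_⟩ ⟨hyb j, ?_⟩
      · have := hz.2; simp only [Set.mem_ofPred_eq] at this; linarith
      · simp only [Set.mem_ofPred_eq]; linarith
      · simp only [Set.mem_ofPred_eq]; linarith
  exact ⟨i, j, hij, (hDf i j hDij).antisymm (hDf j i hDij.symm)⟩

end TriComplex

/-! ### Planar charts -/

namespace TriComplex

open MetricGeometry

variable {V : Type*} [Fintype V] [DecidableEq V] {K : TriComplex V}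

/-- Near `z`, developing the star of `z` in the plane does not increase distances. -/
theorem exists_dist_develop_le (hK : K.IsCAT0Complex) (z : K.Pt) : ∃ r > 0, ∀ P : V → ℂ,
    (∀ s, K.IsCell s → z ∈ K.cell s → IsPlacement K s P) →
    ∀ a b, K.d z a < r → K.d z b < r →
      (∀ s, a ∈ K.cell s → z ∈ K.cell s) ∧ dist (develop P a) (develop P b) ≤ K.d a b := by
  have hd := isCAT0Metric_d hK
  obtain ⟨ρ, hρ, H⟩ := exists_star_radius hK z
  refine ⟨ρ / 4, by positivity, fun P hP a b la lb => ⟨?_, ?_⟩⟩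
  · obtain ⟨k, p, hp, lp⟩ := exists_isPath_lt hK la
    have := H z a k p hp 1 one_pos (by rw [hd.self]; linarith) k le_rfl
    rw [hp.2.1] at this
    exact fun s hs => mem_cell_of_star (fun v hv => by simpa using this v hv) hs
  · have tr := hd.tri a z b
    rw [hd.comm a z] at tr
    refine le_of_forall_gt_imp_ge_of_dense fun L hL => ?_
    obtain ⟨k, p, hp, lp⟩ := exists_isPath_lt hK (show K.d a b < min L (ρ / 2) from
      lt_min hL (by linarith))
    have hst := H a b k p hp 1 one_pos (by linarith [lp.trans_le (min_le_right _ _)])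
    have := dist_le_range_sum_of_dist_le (f := fun i => develop P (p i))
      (d := fun i => K.cellDist (p i) (p (i + 1))) k (fun {i} hi => by
        obtain ⟨s, hs, m1, m2⟩ := hp.2.2 i hi
        have mz := mem_cell_of_star (fun v hv => by simpa using hst i hi.le v hv) m1
        exact ((hP s hs mz).cellDist_eq m1 m2).ge)
    rw [hp.1, hp.2.1] at this
    exact this.trans (lp.le.trans (min_le_left _ _))

theorem mem_cell_mono {s t : Finset V} (h : s ⊆ t) {x : K.Pt} (hx : x ∈ K.cell s) :
    x ∈ K.cell t := fun v hv => h (hx v hv)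

/-- A chart at a point whose star is a single cell. -/
theorem exists_chart_of_cell (hK : K.IsCAT0Complex) {z : K.Pt} {s : Finset V} (hs : K.IsCell s)
    (hmax : ∀ t, K.IsCell t → z ∈ K.cell t → t ⊆ s) :
    ∃ r > 0, ∃ Φ : K.Pt → ℂ, ∀ a b, K.d z a < r → K.d z b < r →
      K.d a b = dist (Φ a) (Φ b) := by
  obtain ⟨v, hv⟩ := hs.nonempty
  obtain ⟨P, hP, -⟩ := exists_placement hs hv
  obtain ⟨r, hr, H⟩ := exists_dist_develop_le hK z
  have H := H P fun t ht hz => hP.mono (hmax t ht hz)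
  refine ⟨r, hr, develop P, fun a b la lb => le_antisymm ?_ (H a b la lb).2⟩
  have mem : ∀ a b, K.d z a < r → K.d z b < r → a ∈ K.cell s := by
    intro a b la lb
    obtain ⟨t, ht, hat⟩ := a.2.2.2
    exact mem_cell_mono (hmax t ht ((H a b la lb).1 t hat)) hat
  have ma := mem a b la lb
  have mb := mem b a lb la
  rw [← hP.cellDist_eq ma mb]
  exact d_le_cellDist hs ma mb

/-- A segment from the upper to the lower half-plane crosses the real axis. -/
theorem exists_mem_segment_im_eq_zero {A B : ℂ} (hA : 0 ≤ A.im) (hB : B.im ≤ 0) :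
    ∃ y ∈ segment ℝ A B, y.im = 0 := by
  rcases eq_or_lt_of_le hA with h | h
  · exact ⟨A, left_mem_segment ℝ A B, h.symm⟩
  have hpos : 0 < A.im - B.im := by linarith
  refine ⟨(-B.im / (A.im - B.im)) • A + (A.im / (A.im - B.im)) • B,
    ⟨_, _, div_nonneg (by linarith) hpos.le, div_nonneg hA hpos.le, ?_, rfl⟩, ?_⟩
  · rw [← add_div, div_eq_one_iff_eq hpos.ne']; ring
  · simp only [Complex.add_im, Complex.smul_im, smul_eq_mul]
    field_simp
    ring

/-- A chart at an inner point of an edge that lies in two 2-cells, which are developed on both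
sides of the edge. -/
theorem exists_chart_of_two_faces (hK : K.IsCAT0Complex) {z : K.Pt} {u v c e : V}
    (huv : K.graph.Adj u v) (huc : K.graph.Adj u c) (hvc : K.graph.Adj v c)
    (hue : K.graph.Adj u e) (hve : K.graph.Adj v e) (hce : c ≠ e)
    (h1 : ({u, v, c} : Finset V) ∈ K.faces) (h2 : ({u, v, e} : Finset V) ∈ K.faces)
    (hz : z ∈ K.cell {u, v}) (hzu : z.1 u ≠ 0) (hzv : z.1 v ≠ 0)
    (hmax : ∀ t, K.IsCell t → z ∈ K.cell t → t ⊆ {u, v, c} ∨ t ⊆ {u, v, e}) :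
    ∃ r > 0, ∃ Φ : K.Pt → ℂ, ∀ a b, K.d z a < r → K.d z b < r →
      K.d a b = dist (Φ a) (Φ b) := by
  have hd := isCAT0Metric_d hK
  obtain ⟨τ, t0, t1, t2⟩ := exists_third_vertex h1 huv huc hvc
  obtain ⟨σ, s0, s1, s2⟩ := exists_third_vertex h2 huv hue hve
  have hl := K.len_pos _ _ huv
  set l := K.len u v with hldef
  set P : V → ℂ := fun w => if w = c then τ else if w = e then (starRingEnd ℂ) σ else
    if w = v then (l : ℂ) else 0 with hP
  have Pu : P u = 0 := by simp [hP, huc.ne, hue.ne, huv.ne]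
  have Pv : P v = l := by simp [hP, hvc.ne, hve.ne]
  have Pc : P c = τ := by simp [hP]
  have Pe : P e = (starRingEnd ℂ) σ := by simp [hP, hce.symm]
  have duv : dist (P u) (P v) = K.len u v := by
    rw [Pu, Pv]; simp [hldef, (K.len_pos _ _ huv).le]
  have pl1 : IsPlacement K {u, v, c} P := isPlacement_triple duv
    (by rw [Pu, Pc, t1]) (by rw [Pv, Pc, t2])
  have pl2 : IsPlacement K {u, v, e} P := isPlacement_triple duv
    (by rw [Pu, Pe, ← s1, ← Complex.dist_conj_conj 0 σ, map_zero])
    (by rw [Pv, Pe, ← s2, ← Complex.dist_conj_conj (l : ℂ) σ, Complex.conj_ofReal])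
  obtain ⟨r, hr, H⟩ := exists_dist_develop_le hK z
  have H := H P fun t ht hz => (hmax t ht hz).elim (fun h => pl1.mono h) fun h => pl2.mono h
  have zu : 0 < z.1 u := lt_of_le_of_ne (z.2.1 u) hzu.symm
  have zv : 0 < z.1 v := lt_of_le_of_ne (z.2.1 v) hzv.symm
  have sumuv : ∀ x ∈ K.cell {u, v}, x.1 u + x.1 v = 1 := by
    intro x hx
    rw [← Finset.sum_pair huv.ne]
    refine (Finset.sum_subset (Finset.subset_univ _) fun w _ hw => ?_).trans x.2.2.1
    exact by_contra fun e => hw (hx w e)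
  have dev_uv : ∀ x ∈ K.cell {u, v}, develop P x = ((x.1 v * l : ℝ) : ℂ) := by
    intro x hx
    have : develop P x = ∑ w ∈ ({u, v} : Finset V), x.1 w • P w := by
      refine (Finset.sum_subset (Finset.subset_univ _) fun w _ hw => ?_).symm
      rw [show x.1 w = 0 from by_contra fun e => hw (hx w e), zero_smul]
    rw [this, Finset.sum_pair huv.ne, Pu, Pv]
    simp
  have im_nonneg : ∀ x ∈ K.cell {u, v, c}, 0 ≤ (develop P x).im := by
    intro x hx
    rw [develop_im]
    refine Finset.sum_nonneg fun w _ => ?_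
    by_cases hw : w ∈ ({u, v, c} : Finset V)
    · simp only [Finset.mem_insert, Finset.mem_singleton] at hw
      rcases hw with rfl | rfl | rfl
      · simp [Pu]
      · simp [Pv]
      · rw [Pc]; exact mul_nonneg (x.2.1 _) t0.le
    · rw [show x.1 w = 0 from by_contra fun e => hw (hx w e), zero_mul]
  have im_nonpos : ∀ x ∈ K.cell {u, v, e}, (develop P x).im ≤ 0 := by
    intro x hx
    rw [develop_im]
    refine Finset.sum_nonpos fun w _ => ?_
    by_cases hw : w ∈ ({u, v, e} : Finset V)
    · simp only [Finset.mem_insert, Finset.mem_singleton] at hw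
      rcases hw with rfl | rfl | rfl
      · simp [Pu]
      · simp [Pv]
      · rw [Pe, Complex.conj_im]
        exact mul_nonpos_of_nonneg_of_nonpos (x.2.1 _) (by linarith)
    · rw [show x.1 w = 0 from by_contra fun e => hw (hx w e), zero_mul]
  set R := min r (min (z.1 u * l) (z.1 v * l)) with hR
  have cross : ∀ a b, K.d z a < R → K.d z b < R → a ∈ K.cell {u, v, c} → b ∈ K.cell {u, v, e} →
      K.d a b ≤ dist (develop P a) (develop P b) := by
    intro a b la lb ha hb
    have la' : K.d z a < r := la.trans_le (min_le_left _ _)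
    have lb' : K.d z b < r := lb.trans_le (min_le_left _ _)
    have lz' : K.d z z < r := by rw [hd.self]; exact hr
    obtain ⟨y, hy, hy0⟩ := exists_mem_segment_im_eq_zero (im_nonneg a ha) (im_nonpos b hb)
    -- the crossing point is so close to `z` that it lies on the edge
    have hyR : y ∈ Metric.ball (develop P z) R := by
      refine (convex_ball _ _).segment_subset ?_ ?_ hy
      · rw [Metric.mem_ball, dist_comm]
        exact ((H z a lz' la').2).trans_lt la
      · rw [Metric.mem_ball, dist_comm]
        exact ((H z b lz' lb').2).trans_lt lb
    have hyre : |y.re - z.1 v * l| < R := by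
      have := Complex.abs_re_le_norm (y - develop P z)
      rw [← Complex.dist_eq, Complex.sub_re, dev_uv z hz, Complex.ofReal_re] at this
      rw [dev_uv z hz] at hyR
      exact this.trans_lt hyR
    have hR1 : R ≤ z.1 u * l := (min_le_right _ _).trans (min_le_left _ _)
    have hR2 : R ≤ z.1 v * l := (min_le_right _ _).trans (min_le_right _ _)
    have hyl := abs_lt.1 hyre
    have hsum := sumuv z hz
    obtain ⟨m, -, m2, m3⟩ := exists_edge_point huv (t := y.re / l)
      (div_nonneg (by linarith [hyl.1]) hl.le) (by
        rw [div_le_one hl]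
        have : z.1 u * l + z.1 v * l = l := by rw [← add_mul, hsum, one_mul]
        linarith [hyl.2])
    have hm : develop P m = y := by
      rw [dev_uv m m3, m2, div_mul_cancel₀ _ hl.ne']
      exact Complex.ext (by simp) (by simp [hy0])
    have hm1 : m ∈ K.cell {u, v, c} := mem_cell_mono (by intro w; simp; tauto) m3
    have hm2 : m ∈ K.cell {u, v, e} := mem_cell_mono (by intro w; simp; tauto) m3
    calc K.d a b ≤ K.d a m + K.d m b := hd.tri _ _ _
      _ ≤ K.cellDist a m + K.cellDist m b :=
        add_le_add (d_le_cellDist (Or.inr (Or.inr h1)) ha hm1)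
          (d_le_cellDist (Or.inr (Or.inr h2)) hm2 hb)
      _ = dist (develop P a) (develop P b) := by
        rw [pl1.cellDist_eq ha hm1, pl2.cellDist_eq hm2 hb, hm]
        exact dist_add_dist_of_mem_segment hy
  refine ⟨R, lt_min hr (lt_min (by positivity) (by positivity)), develop P,
    fun a b la lb => le_antisymm ?_
      (H a b (la.trans_le (min_le_left _ _)) (lb.trans_le (min_le_left _ _))).2⟩
  have mem : ∀ a, K.d z a < R → a ∈ K.cell {u, v, c} ∨ a ∈ K.cell {u, v, e} := by
    intro a la
    obtain ⟨t, ht, hat⟩ := a.2.2.2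
    have la' := la.trans_le (min_le_left _ _)
    exact (hmax t ht ((H a a la' la').1 t hat)).imp (fun h => mem_cell_mono h hat)
      fun h => mem_cell_mono h hat
  rcases mem a la with ha | ha <;> rcases mem b lb with hb | hb
  · rw [← pl1.cellDist_eq ha hb]; exact d_le_cellDist (Or.inr (Or.inr h1)) ha hb
  · exact cross a b la lb ha hb
  · rw [hd.comm, dist_comm]; exact cross b a lb la hb ha
  · rw [← pl2.cellDist_eq ha hb]; exact d_le_cellDist (Or.inr (Or.inr h2)) ha hb

omit [Fintype V] in
theorem exists_third_vertex_of_mem {f : Finset V} (hf : f ∈ K.faces) {u v : V} (hu : u ∈ f)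
    (hv : v ∈ f) (huv : u ≠ v) :
    ∃ c, K.graph.Adj u v ∧ K.graph.Adj u c ∧ K.graph.Adj v c ∧ f = {u, v, c} := by
  obtain ⟨a, b, hab, hau, hbu, rfl⟩ := exists_face_eq hf hu
  simp only [Finset.mem_insert, Finset.mem_singleton] at hv
  rcases hv with rfl | rfl | rfl
  · exact ⟨b, hau.symm, hbu.symm, hab, by ext; simp; tauto⟩
  · exact ⟨a, hbu.symm, hau.symm, hab.symm, by ext; simp; tauto⟩
  · exact absurd rfl huv

/-- Every point of a planar complex other than the vertices has a neighbourhood that embeds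
isometrically in the plane. -/
theorem exists_chart (hpl : K.IsPlanar) (hK : K.IsCAT0Complex) {z : K.Pt}
    (hz : z ∉ Set.range K.vert) : ∃ r > 0, ∃ Φ : K.Pt → ℂ, ∀ a b, K.d z a < r → K.d z b < r →
      K.d a b = dist (Φ a) (Φ b) := by
  have hnv : ∀ w, z ∉ K.cell {w} := fun w hw => hz ⟨w, (eq_vert hw).symm⟩
  by_cases hfull : ∃ f ∈ K.faces, ∀ v ∈ f, z.1 v ≠ 0
  · obtain ⟨f, hf, hfz⟩ := hfull
    refine exists_chart_of_cell hK (Or.inr (Or.inr hf)) fun t ht hzt => ?_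
    have hsub : f ⊆ t := fun v hv => hzt v (hfz v hv)
    have hcard := (K.isNClique_of_mem_faces f hf).card_eq
    refine (Finset.eq_of_subset_of_card_le hsub ?_).ge
    rw [hcard]
    rcases ht with ⟨v, rfl⟩ | ⟨u, v, -, rfl⟩ | ht
    · simp
    · exact Finset.card_le_two.trans (by norm_num)
    · exact (K.isNClique_of_mem_faces t ht).card_eq.le
  push Not at hfull
  obtain ⟨u, v, huv, hzuv⟩ : ∃ u v, K.graph.Adj u v ∧ z ∈ K.cell {u, v} := by
    obtain ⟨s, hs, hzs⟩ := z.2.2.2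
    rcases hs with ⟨w, rfl⟩ | ⟨u, v, huv, rfl⟩ | hs
    · exact absurd hzs (hnv w)
    · exact ⟨u, v, huv, hzs⟩
    · obtain ⟨w, hw, hw0⟩ := hfull s hs
      obtain ⟨a, b, hab, -, -, rfl⟩ := exists_face_eq hs hw
      refine ⟨a, b, hab, fun x hx => ?_⟩
      have := hzs x hx
      simp only [Finset.mem_insert, Finset.mem_singleton] at this ⊢
      rcases this with h | h | rfl
      · exact Or.inl h
      · exact Or.inr h
      · exact absurd hw0 hx
  have hzu : z.1 u ≠ 0 := by
    intro e
    refine hnv v fun w hw => ?_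
    have := hzuv w hw
    simp only [Finset.mem_insert, Finset.mem_singleton] at this ⊢
    exact this.resolve_left fun h => hw (h ▸ e)
  have hzv : z.1 v ≠ 0 := by
    intro e
    refine hnv u fun w hw => ?_
    have := hzuv w hw
    simp only [Finset.mem_insert, Finset.mem_singleton] at this ⊢
    exact this.resolve_right fun h => hw (h ▸ e)
  have hsub : ∀ t, z ∈ K.cell t → {u, v} ⊆ t := fun t ht => by
    simp [Finset.insert_subset_iff, ht u hzu, ht v hzv]
  have hface : ∀ t, K.IsCell t → z ∈ K.cell t → t ⊆ {u, v} ∨ t ∈ K.faces := by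
    intro t ht hzt
    rcases ht with ⟨w, rfl⟩ | ⟨a, b, -, rfl⟩ | ht
    · exact absurd hzt (hnv w)
    · refine Or.inl (Finset.eq_of_subset_of_card_le (hsub _ hzt) ?_).ge
      rw [Finset.card_pair huv.ne]; exact Finset.card_le_two
    · exact Or.inr ht
  by_cases hall : ∀ t, K.IsCell t → z ∈ K.cell t → t ⊆ {u, v}
  · exact exists_chart_of_cell hK (Or.inr (Or.inl ⟨u, v, huv, rfl⟩)) hall
  push Not at hall
  obtain ⟨f, hfc, hzf, hfn⟩ := hall
  have hf := (hface f hfc hzf).resolve_left hfn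
  by_cases hall : ∀ t, K.IsCell t → z ∈ K.cell t → t ⊆ f
  · exact exists_chart_of_cell hK (Or.inr (Or.inr hf)) hall
  push Not at hall
  obtain ⟨g, hgc, hzg, hgn⟩ := hall
  have hg := (hface g hgc hzg).resolve_left fun h => hgn (h.trans (hsub f hzf))
  have hmax : ∀ t, K.IsCell t → z ∈ K.cell t → t ⊆ f ∨ t ⊆ g := by
    intro t ht hzt
    rcases hface t ht hzt with h | h
    · exact Or.inl (h.trans (hsub f hzf))
    obtain ⟨i, j, hij, e⟩ := exists_eq_of_three_faces hpl huv ![f, g, t]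
      (by intro i; fin_cases i <;> assumption)
      (by intro i; fin_cases i <;> exact hsub _ (by assumption))
    have hfg : f ≠ g := fun e => hgn e.ge
    fin_cases i <;> fin_cases j <;> simp at e hij
    · exact absurd e hfg
    · exact Or.inl e.ge
    · exact absurd e.symm hfg
    · exact Or.inr e.ge
    · exact Or.inl e.le
    · exact Or.inr e.le
  have mf := hsub f hzf
  have mg := hsub g hzg
  obtain ⟨c, -, huc, hvc, rfl⟩ := exists_third_vertex_of_mem hf (mf (by simp)) (mf (by simp)) huv.ne
  obtain ⟨e, -, hue, hve, rfl⟩ := exists_third_vertex_of_mem hg (mg (by simp)) (mg (by simp)) huv.ne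
  exact exists_chart_of_two_faces hK huv huc hvc hue hve (fun h => hgn (by rw [h])) hf hg hzuv
    hzu hzv hmax

theorem isPolygonal_d (hpl : K.IsPlanar) (hK : K.IsCAT0Complex) :
    IsPolygonal K.d (Set.range K.vert) where
  toIsCAT0Metric := isCAT0Metric_d hK
  finite := Set.finite_range _
  conical := exists_conical hK
  chart _ hz := exists_chart hpl hK hz

theorem IsSPM.isSectorFamily {x : K.Pt} {S : Set K.Cone} (hS : IsSPM K x S) :
    IsPolygonal.IsSectorFamily K.d x S Cone.apex Cone.p Cone.q Cone.carrier where
  angle_pos c hc := (hS.isCone c hc).2.2.1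
  angle_lt c hc := (hS.isCone c hc).2.2.2.1
  seg_subset c hc := (hS.isCone c hc).2.2.2.2.2
  disjoint c hc c' hc' hne := hS.disjoint c hc c' hc' hne
  left_mem c hc := (hS.apex_mem c hc).1
  right_mem c hc := (hS.apex_mem c hc).2

end TriComplex

theorem mainTheorem8 :
    ∃ C : ℕ, ∀ (V : Type*) [Fintype V] [DecidableEq V] (K : TriComplex V),
      K.IsPlanar → K.IsCAT0Complex →
        ∀ (x : K.Pt) (S : Set K.Cone), TriComplex.IsSPM K x S →
          S.Finite ∧ S.ncard ≤ C * Fintype.card V := by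
  refine ⟨6, fun V _ _ K hpl hK x S hS => ?_⟩
  obtain ⟨hfin, hcard⟩ := (TriComplex.isPolygonal_d hpl hK).finite_and_ncard_le hS.isSectorFamily
    fun c hc => (hS.side c hc).1.imp (fun ⟨v, h1, h2⟩ => ⟨K.vert v, ⟨v, rfl⟩, h1, h2⟩) id
  refine ⟨hfin, hcard.trans (Nat.mul_le_mul_left 6 ?_)⟩
  rw [← Set.image_univ, ← Nat.card_eq_fintype_card, ← Set.ncard_univ]
  exact Set.ncard_image_le
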